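/- Let $\mathbb R^4_1$ be Lorentz-Minkowski space with $\langle x,y\rangle=-x_0y_0+x_1y_1+x_2y_2+x_3y_3$, let $H^3=\{x:\langle x,x\rangle=-1,\ x_0>0\}$ and $S^3_1=\{x:\langle x,x\rangle=1\}$, and let $M^2$ be a connected smooth $2$-manifold. A *front* is a smooth map $f:M^2\to H^3$ together with a lift to a Legendrian immersion $L_f:M^2\to P(T^*H^3)$. Equivalently, $f$ carries a field of normal lines which near every point is spanned by a smooth unit normal field $\nu$ (that is, $\nu$ takes values in $S^3_1$, $\langle f,\nu\rangle=0$ and $\langle df,\nu\rangle=0$) such that $(f,\nu)$ is an immersion; below, unit normal fields are those spanning this line field. The front is *co-orientable* if it has a unit normal field defined on all of $M^2$. For a unit normal field $\nu$ of $f$ on an open set $U$ and $\delta\in\mathbb R$, put $$f_\delta=(\cosh\delta)f+(\sinh\delta)\nu,\qquad \nu_\delta=(\cosh\delta)\nu+(\sinh\delta)f .$$ On the regular set $R_{f_\delta}$ (the points where $df_\delta$ is injective) let $K_\delta$ be the Gaussian curvature of the metric induced by $f_\delta$, and let $H_\delta$ be the mean curvature of $f_\delta$ with respect to $\nu_\delta$,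 i.e. half the trace of the shape operator $A$ given by $d\nu_\delta=-df_\delta\circ A$. The front $f$ is *horospherical linear Weingarten* if every $p\in M^2$ has an open neighbourhood $U$ with a unit normal field $\nu$ on $U$, a $\delta_0\in\mathbb R$ and real constants $a,b$ with $a^2+b^2\neq0$ such that $f_{\delta_0}$ is an immersion on $U$ and $a(H_{\delta_0}-1)+bK_{\delta_0}=0$ on $U$. It is *non-flat* if its Gaussian curvature is nonzero at some regular point of $f$. **Theorem.** Let $f:M^2\to H^3$ be a non-flat horospherical linear Weingarten front. Then $f$ is co-orientable. Moreover, for a suitable choice of the global unit normal field $\nu$ there is a unique ratio $[a:b]$ of real constants with $a^2+b^2\neq 0$ such that for every $\delta\in\mathbb R$ the parallel front $f_\delta$ satisfies $$a(H_\delta-1)+b_\delta K_\delta=0\quad\text{on } R_{f_\delta},\qquad b_\delta:=b\,e^{2\delta}+\frac{a(e^{2\delta}-1)}2 ;$$ and for every choice of the global unit normal field there is at most one such ratio. -/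

import Mathlib

open scoped Manifold ContDiff

noncomputable section

namespace HypFront

/-! ## Lorentz-Minkowski 4-space and hyperbolic 3-space -/

/-- The vector space underlying the Lorentz-Minkowski space `ℝ⁴₁`. -/
abbrev R41 : Type := Fin 4 → ℝ

/-- The Lorentz metric of `ℝ⁴₁`, of signature `(-,+,+,+)`. -/
def mink (x y : R41) : ℝ := -(x 0 * y 0) + x 1 * y 1 + x 2 * y 2 + x 3 * y 3

/-- Hyperbolic 3-space, the upper sheet of the hyperboloid `⟨x, x⟩ = -1`. -/
def H3 : Set R41 := {x | mink x x = -1 ∧ 0 < x 0}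

/-- The coordinate plane on which surfaces are modelled. -/
abbrev E2 : Type := EuclideanSpace ℝ (Fin 2)

/-! ## Local differential geometry in a coordinate patch -/

/-- The partial derivative `∂ᵢ h` (of a scalar- or vector-valued map). -/
def pd {V : Type*} [NormedAddCommGroup V] [NormedSpace ℝ V] (i : Fin 2) (h : E2 → V) : E2 → V :=
  fun x => fderiv ℝ h x (EuclideanSpace.single i 1)

/-- The coefficients `⟨∂ᵢ F, ∂ⱼ F⟩` of the first fundamental form of `F`. -/
def fundI (F : E2 → R41) (i j : Fin 2) : E2 → ℝ :=
  fun x => mink (pd i F x) (pd j F x)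

/-- The coefficients `-⟨∂ᵢ F, ∂ⱼ n⟩` of the second fundamental form of `F` with respect to the
unit normal field `n`. -/
def fundII (F n : E2 → R41) (i j : Fin 2) : E2 → ℝ :=
  fun x => -mink (pd i F x) (pd j n x)

/-- The mean curvature `(E N - 2 F M + G L) / (2 (E G - F²))`, i.e. half the trace of `II` with
respect to `I`. -/
def coordMeanCurv (F n : E2 → R41) (x : E2) : ℝ :=
  (fundI F 0 0 x * fundII F n 1 1 x - 2 * (fundI F 0 1 x * fundII F n 0 1 x)
      + fundI F 1 1 x * fundII F n 0 0 x) /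
    (2 * (fundI F 0 0 x * fundI F 1 1 x - fundI F 0 1 x ^ 2))

/-- The (intrinsic) Gaussian curvature of the Riemannian metric `E du² + 2 F du dv + G dv²`, written
through `E, F, G` and their partial derivatives up to order two (Brioschi's formula). -/
def metricGaussCurv (E F G : E2 → ℝ) (x : E2) : ℝ :=
  (Matrix.det
      !![-(pd 1 (pd 1 E) x) / 2 + pd 0 (pd 1 F) x - pd 0 (pd 0 G) x / 2,
          pd 0 E x / 2, pd 0 F x - pd 1 E x / 2;
         pd 1 F x - pd 0 G x / 2, E x, F x;
         pd 1 G x / 2, F x, G x]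
    - Matrix.det
      !![0, pd 1 E x / 2, pd 0 G x / 2;
         pd 1 E x / 2, E x, F x;
         pd 0 G x / 2, F x, G x]) /
    (E x * G x - F x ^ 2) ^ 2

/-- The Gaussian curvature of the metric induced by `F`. -/
def coordGaussCurv (F : E2 → R41) (x : E2) : ℝ :=
  metricGaussCurv (fundI F 0 0) (fundI F 0 1) (fundI F 1 1) x

/-! ## Maps from a surface to hyperbolic space -/

section Surface

variable {M : Type*} [TopologicalSpace M] [ChartedSpace E2 M]

/-- The expression of `g` in the preferred chart at `p`. -/
def inChart (g : M → R41) (p : M) : E2 → R41 := g ∘ (extChartAt (𝓡 2) p).symm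

/-- `p` is a regular point of `g` : the differential of `g` at `p` is injective. -/
def RegularAt (g : M → R41) (p : M) : Prop :=
  Function.Injective (mfderiv (𝓡 2) 𝓘(ℝ, R41) g p)

/-- The regular set `R_g`. -/
def regularSet (g : M → R41) : Set M := {p | RegularAt g p}

/-- The mean curvature of `g` at a regular point `p`, with respect to the unit normal field `n`. -/
def meanCurv (g n : M → R41) (p : M) : ℝ :=
  coordMeanCurv (inChart g p) (inChart n p) (extChartAt (𝓡 2) p p)

/-- The Gaussian curvature at a regular point `p` of the metric induced by `g`. -/
def gaussCurv (g : M → R41) (p : M) : ℝ :=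
  coordGaussCurv (inChart g p) (extChartAt (𝓡 2) p p)

/-- `ν` is a smooth unit normal field of `f : M → H³` on the open set `U` : it takes values in
`S³₁` and satisfies `⟨f, ν⟩ = 0` and `⟨df, ν⟩ = 0`. -/
structure IsUnitNormalOn (f ν : M → R41) (U : Set M) : Prop where
  smooth : ContMDiffOn (𝓡 2) 𝓘(ℝ, R41) ∞ ν U
  unit : ∀ q ∈ U, mink (ν q) (ν q) = 1
  tangent : ∀ q ∈ U, mink (f q) (ν q) = 0
  normal : ∀ q ∈ U, ∀ v : TangentSpace (𝓡 2) q,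
    mink (mfderiv (𝓡 2) 𝓘(ℝ, R41) f q v) (ν q) = 0

/-- The unit normal field `ν` on `U` represents there the field of normal lines `ℓ`. -/
def Spans (ℓ : M → Submodule ℝ R41) (ν : M → R41) (U : Set M) : Prop :=
  ∀ q ∈ U, ℓ q = Submodule.span ℝ {ν q}

/-- A front `f : M → H³` together with its Legendrian immersion `L_f : M → P(T*H³)`.
By means of the metric, a point of `P(T*H³)` is a pair consisting of a point `x ∈ H³` and a line in
`T_x H³ = x^⊥`, so that `L_f` is `q ↦ (f q, ℓ q)`; near each point it is represented by a pair
`(f, ν)` with `ν` a smooth unit normal field spanning `ℓ` (`normal` is the Legendrian condition),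
and it is an immersion exactly if the pairs `(f, ν)` are. Nothing is said about the existence of
a global `ν`. -/
structure IsFront (f : M → R41) (ℓ : M → Submodule ℝ R41) : Prop where
  smooth : ContMDiff (𝓡 2) 𝓘(ℝ, R41) ∞ f
  mem_H3 : ∀ p, f p ∈ H3
  legendrian : ∀ p : M, ∃ U : Set M, IsOpen U ∧ p ∈ U ∧ ∃ ν : M → R41,
    IsUnitNormalOn f ν U ∧ Spans ℓ ν U ∧
    ∀ q ∈ U, Function.Injective
      (mfderiv (𝓡 2) 𝓘(ℝ, R41 × R41) (fun r => (f r, ν r)) q)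

/-- `ν` is a global unit normal field of the front `(f, ℓ)`. -/
def IsGlobalUnitNormal (f : M → R41) (ℓ : M → Submodule ℝ R41) (ν : M → R41) : Prop :=
  IsUnitNormalOn f ν Set.univ ∧ Spans ℓ ν Set.univ

/-- A front is co-orientable if it has a globally defined unit normal field. -/
def IsCoorientable (f : M → R41) (ℓ : M → Submodule ℝ R41) : Prop :=
  ∃ ν : M → R41, IsGlobalUnitNormal f ℓ ν

/-- The parallel front `f_δ = (cosh δ) f + (sinh δ) ν`. -/
def parallel (f ν : M → R41) (δ : ℝ) : M → R41 :=
  fun q => Real.cosh δ • f q + Real.sinh δ • ν q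

/-- Its unit normal field `ν_δ = (cosh δ) ν + (sinh δ) f`. -/
def parallelNormal (f ν : M → R41) (δ : ℝ) : M → R41 :=
  fun q => Real.cosh δ • ν q + Real.sinh δ • f q

/-- On `U`, the map `g` is an immersion which, with respect to its unit normal field `n`, satisfies
`a (H - 1) + b K = 0` for some constants `a, b` that are not both zero. -/
def IsHLWImmersionOn (g n : M → R41) (U : Set M) : Prop :=
  (∀ q ∈ U, RegularAt g q) ∧
  ∃ a b : ℝ, a ^ 2 + b ^ 2 ≠ 0 ∧
    ∀ q ∈ U, a * (meanCurv g n q - 1) + b * gaussCurv g q = 0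

/-- A horospherical linear Weingarten front: a front such that each point has a co-orientable
neighbourhood on which some parallel front is a horospherical linear Weingarten immersion. -/
def IsHLWFront (f : M → R41) (ℓ : M → Submodule ℝ R41) : Prop :=
  IsFront f ℓ ∧
  ∀ p : M, ∃ U : Set M, IsOpen U ∧ p ∈ U ∧ ∃ ν : M → R41,
    IsUnitNormalOn f ν U ∧ Spans ℓ ν U ∧
    ∃ δ₀ : ℝ, IsHLWImmersionOn (parallel f ν δ₀) (parallelNormal f ν δ₀) U

/-- A front is flat if its Gaussian curvature vanishes on its regular set. -/
def IsFlat (f : M → R41) : Prop := ∀ p ∈ regularSet f, gaussCurv f p = 0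

/-- With respect to the unit normal field `ν`, all parallel fronts `f_δ` satisfy
`a (H_δ - 1) + b_δ K_δ = 0` on their regular sets, where
`b_δ = b e^{2δ} + a (e^{2δ} - 1) / 2`. -/
def ParallelRelation (f ν : M → R41) (a b : ℝ) : Prop :=
  ∀ δ : ℝ, ∀ p ∈ regularSet (parallel f ν δ),
    a * (meanCurv (parallel f ν δ) (parallelNormal f ν δ) p - 1)
      + (b * Real.exp (2 * δ) + a * (Real.exp (2 * δ) - 1) / 2)
        * gaussCurv (parallel f ν δ) p = 0

end Surface

end HypFront

end

noncomputable section

namespace HypFront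

open Topology Filter

/-! ## Linear algebra of `ℝ⁴₁` -/

/-! Multiplied by the area density, the relation `a (H - 1) + b K = 0` becomes `Rel`, an identity
bilinear in `df` and `dν`, which still makes sense at singular points. It is preserved along the
parallel family with `b` replaced by `b_δ` (`rel_parallel_iff`). The Gauss equation
`coordGaussCurv_eq` connects it with the intrinsic curvature. It remains to glue local normals, each
with its own sign and ratio `[a:b]`, over the connected surface.

Two independent ratios at one point force `df + dν = 0`, the horospherical case
(`Jet.horospherical`). Hence the ratio can only change across pieces where `f + ν` is constant. The
sign is controlled by `exists_comb_const`: if `ν` and `-ν` both satisfy relations with nonzero first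
coefficient, a regular parallel surface has constant `H` and `K ≠ 0`, so it has constant principal
curvatures and is not flat. By `gaussKronecker_eq_sq` it is totally umbilic, and some `c f + d ν`
with `c² ≠ d²` is locally constant.

Such degenerate pieces are handled by unique continuation. `Rel` says that the wedge of `d(f + ν)`
and `dy` vanishes, where `y = -(a + b) f + b ν`. Thus `(f + ν) ∧ dy` is closed, and the conjugate
Gauss map `g` of `f + ν` satisfies `dg ∧ ω = 0` for a complex component `ω` of it. If `a + 2b ≠ 0`
and one of `f + ν`, `y` is constant on an open set accumulating at a point, then near that point
either a primitive of `ω` or `g` itself is a complex coordinate. The identity theorem in this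
coordinate extends the constancy (`LocalSurf.hv_eventually_const`, `LocalSurf.yv_eventually_const`).

The globalization has two cases. If some `c f + d ν` with `c² ≠ d²` is constant somewhere, it is
constant everywhere up to the sign of `ν`, and it determines the normal from `f`. Otherwise one
starts at a regular point with `K ≠ 0`, where `a ≠ 0`, and the ratio and the sign found there spread
by an open-closed argument. Uniqueness of the ratio is read off at that same point. -/

lemma mink_comm (x y : R41) : mink x y = mink y x := by simp only [mink]; ring

lemma mink_add_left (x y z : R41) : mink (x + y) z = mink x z + mink y z := by
  simp only [mink, Pi.add_apply]; ring

lemma mink_add_right (x y z : R41) : mink x (y + z) = mink x y + mink x z := by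
  simp only [mink, Pi.add_apply]; ring

lemma mink_smul_left (c : ℝ) (x y : R41) : mink (c • x) y = c * mink x y := by
  simp only [mink, Pi.smul_apply, smul_eq_mul]; ring

lemma mink_smul_right (c : ℝ) (x y : R41) : mink x (c • y) = c * mink x y := by
  simp only [mink, Pi.smul_apply, smul_eq_mul]; ring

lemma mink_neg_left (x y : R41) : mink (-x) y = -mink x y := by
  simp only [mink, Pi.neg_apply]; ring

lemma mink_neg_right (x y : R41) : mink x (-y) = -mink x y := by
  simp only [mink, Pi.neg_apply]; ring

lemma mink_sub_left (x y z : R41) : mink (x - y) z = mink x z - mink y z := by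
  simp only [mink, Pi.sub_apply]; ring

lemma mink_sub_right (x y z : R41) : mink x (y - z) = mink x y - mink x z := by
  simp only [mink, Pi.sub_apply]; ring

lemma mink_zero_left (x : R41) : mink 0 x = 0 := by simp [mink]

/-- The orthogonal complement of a timelike vector is spacelike. -/
lemma mink_self_nonneg {x X : R41} (hx : mink x x = -1) (hX : mink X x = 0) : 0 ≤ mink X X := by
  simp only [mink] at *
  have h1 : (X 0 * x 0) ^ 2 ≤ (X 1 ^ 2 + X 2 ^ 2 + X 3 ^ 2) * (x 1 ^ 2 + x 2 ^ 2 + x 3 ^ 2) := by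
    have : X 0 * x 0 = X 1 * x 1 + X 2 * x 2 + X 3 * x 3 := by linarith
    rw [this]
    nlinarith [sq_nonneg (X 1 * x 2 - X 2 * x 1), sq_nonneg (X 1 * x 3 - X 3 * x 1),
      sq_nonneg (X 2 * x 3 - X 3 * x 2)]
  have h2 : x 1 ^ 2 + x 2 ^ 2 + x 3 ^ 2 = x 0 ^ 2 - 1 := by linarith
  rw [h2] at h1
  by_contra h
  push Not at h
  nlinarith [sq_nonneg (x 0), sq_nonneg (X 0), sq_nonneg (x 1), sq_nonneg (x 2), sq_nonneg (x 3),
    sq_nonneg (X 1), sq_nonneg (X 2), sq_nonneg (X 3)]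

lemma eq_zero_of_mink_self_eq_zero {x X : R41} (hx : mink x x = -1) (hX : mink X x = 0)
    (h : mink X X = 0) : X = 0 := by
  simp only [mink] at *
  have h1 : (X 0 * x 0) ^ 2 ≤ (X 1 ^ 2 + X 2 ^ 2 + X 3 ^ 2) * (x 1 ^ 2 + x 2 ^ 2 + x 3 ^ 2) := by
    have : X 0 * x 0 = X 1 * x 1 + X 2 * x 2 + X 3 * x 3 := by linarith
    rw [this]
    nlinarith [sq_nonneg (X 1 * x 2 - X 2 * x 1), sq_nonneg (X 1 * x 3 - X 3 * x 1),
      sq_nonneg (X 2 * x 3 - X 3 * x 2)]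
  have h2 : x 1 ^ 2 + x 2 ^ 2 + x 3 ^ 2 = x 0 ^ 2 - 1 := by linarith
  have h3 : X 1 ^ 2 + X 2 ^ 2 + X 3 ^ 2 = X 0 ^ 2 := by linarith
  rw [h2, h3] at h1
  have h4 : X 0 ^ 2 = 0 := by nlinarith [sq_nonneg (X 0)]
  have e0 : X 0 = 0 := by simpa using h4
  have e1 : X 1 = 0 := by nlinarith [sq_nonneg (X 1), sq_nonneg (X 2), sq_nonneg (X 3)]
  have e2 : X 2 = 0 := by nlinarith [sq_nonneg (X 1), sq_nonneg (X 2), sq_nonneg (X 3)]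
  have e3 : X 3 = 0 := by nlinarith [sq_nonneg (X 1), sq_nonneg (X 2), sq_nonneg (X 3)]
  ext i
  fin_cases i <;> simp [e0, e1, e2, e3]

/-- The determinant of four vectors of `ℝ⁴₁`. -/
def vol (X Y x n : R41) : ℝ := Matrix.det (Matrix.of ![X, Y, x, n])

lemma vol_eq (X Y x n : R41) : vol X Y x n =
    (X 0 * Y 1 - X 1 * Y 0) * (x 2 * n 3 - x 3 * n 2)
      - (X 0 * Y 2 - X 2 * Y 0) * (x 1 * n 3 - x 3 * n 1)
      + (X 0 * Y 3 - X 3 * Y 0) * (x 1 * n 2 - x 2 * n 1)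
      + (X 1 * Y 2 - X 2 * Y 1) * (x 0 * n 3 - x 3 * n 0)
      - (X 1 * Y 3 - X 3 * Y 1) * (x 0 * n 2 - x 2 * n 0)
      + (X 2 * Y 3 - X 3 * Y 2) * (x 0 * n 1 - x 1 * n 0) := by
  simp [vol, Matrix.det_succ_row_zero, Fin.sum_univ_succ, Fin.succAbove]; ring

lemma vol_add_left (X X' Y x n : R41) : vol (X + X') Y x n = vol X Y x n + vol X' Y x n := by
  simp only [vol_eq, Pi.add_apply]; ring

lemma vol_smul_left (c : ℝ) (X Y x n : R41) : vol (c • X) Y x n = c * vol X Y x n := by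
  simp only [vol_eq, Pi.smul_apply, smul_eq_mul]; ring

lemma vol_swap (X Y x n : R41) : vol Y X x n = -vol X Y x n := by
  simp only [vol_eq]; ring

lemma vol_add_right (X Y Y' x n : R41) : vol X (Y + Y') x n = vol X Y x n + vol X Y' x n := by
  simp only [vol_eq, Pi.add_apply]; ring

lemma vol_smul_right (c : ℝ) (X Y x n : R41) : vol X (c • Y) x n = c * vol X Y x n := by
  simp only [vol_eq, Pi.smul_apply, smul_eq_mul]; ring

lemma vol_neg_last (X Y x n : R41) : vol X Y x (-n) = -vol X Y x n := by
  simp only [vol_eq, Pi.neg_apply]; ring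

lemma vol_self (X x n : R41) : vol X X x n = 0 := by
  simp only [vol_eq]; ring

lemma vol_comb_last (X Y x n : R41) (p q r t : ℝ) :
    vol X Y (p • x + q • n) (r • x + t • n) = (p * t - q * r) * vol X Y x n := by
  simp only [vol_eq, Pi.add_apply, Pi.smul_apply, smul_eq_mul]; ring

/-- The product of one matrix, the Lorentz form and the transpose of the other is a block-diagonal
Gram matrix whose second block is `diag(-1, 1)`. The sign of that block cancels the determinant of
the Lorentz form. -/
lemma vol_mul_vol {x n : R41} (hx : mink x x = -1) (hn : mink n n = 1) (hxn : mink x n = 0)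
    {X Y X' Y' : R41} (hX : mink X x = 0) (hX' : mink X' x = 0) (hY : mink Y x = 0)
    (hY' : mink Y' x = 0) (hXn : mink X n = 0) (hXn' : mink X' n = 0) (hYn : mink Y n = 0)
    (hYn' : mink Y' n = 0) :
    vol X Y x n * vol X' Y' x n = mink X X' * mink Y Y' - mink X Y' * mink Y X' := by
  have key : Matrix.of ![X, Y, x, n] * (Matrix.diagonal ![-1, 1, 1, 1] *
      (Matrix.of ![X', Y', x, n]).transpose) =
      !![mink X X', mink X Y', 0, 0; mink Y X', mink Y Y', 0, 0; 0, 0, -1, 0; 0, 0, 0, 1] := by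
    rw [mink_comm] at hX' hY' hXn' hYn'
    have hnx : mink n x = 0 := by rw [mink_comm, hxn]
    have e : ∀ a b : Fin 4, (Matrix.of ![X, Y, x, n] * (Matrix.diagonal ![-1, 1, 1, 1] *
        (Matrix.of ![X', Y', x, n]).transpose) : Matrix (Fin 4) (Fin 4) ℝ) a b
          = mink (![X, Y, x, n] a) (![X', Y', x, n] b) := by
      intro a b
      rw [Matrix.mul_apply]
      simp only [Matrix.diagonal_mul, Matrix.transpose_apply, Fin.sum_univ_four,
        Matrix.of_apply, mink, Matrix.cons_val]
      ring
    ext a b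
    rw [e]
    fin_cases a <;> fin_cases b <;> simp [*]
  have h2 := congrArg Matrix.det key
  rw [Matrix.det_mul, Matrix.det_mul, Matrix.det_transpose, Matrix.det_diagonal] at h2
  have h3 : ∀ a b c d : ℝ, Matrix.det !![a, b, 0, 0; c, d, 0, 0; 0, 0, -1, 0; 0, 0, 0, 1]
      = -(a * d - b * c) := by
    intro a b c d
    simp [Matrix.det_succ_row_zero, Fin.sum_univ_succ, Fin.succAbove]
    ring
  rw [h3] at h2
  simp only [Fin.prod_univ_four, Matrix.cons_val] at h2
  simp only [vol]
  linarith

/-- Two vectors orthogonal to `x, n` and independent modulo `x, n` span the tangent plane. -/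
lemma exists_comb {x n : R41} (hx : mink x x = -1) (hn : mink n n = 1) (hxn : mink x n = 0)
    {U V X : R41} (hU : mink U x = 0) (hV : mink V x = 0) (hX : mink X x = 0)
    (hUn : mink U n = 0) (hVn : mink V n = 0) (hXn : mink X n = 0)
    (hvol : vol U V x n ≠ 0) : ∃ p q : ℝ, X = p • U + q • V := by
  have hdet : IsUnit (Matrix.of ![U, V, x, n]).det := isUnit_iff_ne_zero.2 hvol
  obtain ⟨c, hc⟩ : ∃ c : Fin 4 → ℝ, Matrix.vecMul c (Matrix.of ![U, V, x, n]) = X :=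
    ⟨Matrix.vecMul X (Matrix.of ![U, V, x, n])⁻¹, by
      rw [Matrix.vecMul_vecMul, Matrix.nonsing_inv_mul _ hdet, Matrix.vecMul_one]⟩
  have hc' : X = c 0 • U + c 1 • V + c 2 • x + c 3 • n := by
    rw [← hc]
    ext i
    simp [Matrix.vecMul, dotProduct, Fin.sum_univ_succ]
    ring
  have h2 : c 2 = 0 := by
    have := congrArg (mink · x) hc'
    simp only [mink_add_left, mink_smul_left, hX, hU, hV, hx, mink_comm n x, hxn] at this
    linarith
  have h3 : c 3 = 0 := by
    have := congrArg (mink · n) hc'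
    simp only [mink_add_left, mink_smul_left, hXn, hUn, hVn, hn, hxn] at this
    linarith
  exact ⟨c 0, c 1, by rw [hc', h2, h3]; simp⟩

/-! ## First-order data of a surface with unit normal -/

/-- The values `x, n` of a surface in `H³` and its unit normal at a point, with differentials
`A, B`. -/
structure Jet (x n : R41) (A B : E2 →L[ℝ] R41) : Prop where
  xx : mink x x = -1
  xn : mink x n = 0
  nn : mink n n = 1
  Ax : ∀ v, mink (A v) x = 0
  An : ∀ v, mink (A v) n = 0
  Bx : ∀ v, mink (B v) x = 0
  Bn : ∀ v, mink (B v) n = 0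
  symm : ∀ v w, mink (A v) (B w) = mink (A w) (B v)

/-- The area density. -/
def areaForm (x n : R41) (A : E2 →L[ℝ] R41) (v w : E2) : ℝ := vol (A v) (A w) x n

/-- The mean curvature times the area density. -/
def meanForm (x n : R41) (A B : E2 →L[ℝ] R41) (v w : E2) : ℝ :=
  -(vol (A v) (B w) x n + vol (B v) (A w) x n) / 2

/-- The relation `a (H - 1) + b K = 0`, multiplied by the area density. -/
def Rel (x n : R41) (A B : E2 →L[ℝ] R41) (a b : ℝ) : Prop :=
  ∀ v w : E2, a * (meanForm x n A B v w - areaForm x n A v w)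
    + b * (areaForm x n B v w - areaForm x n A v w) = 0

abbrev e0 : E2 := EuclideanSpace.single 0 1
abbrev e1 : E2 := EuclideanSpace.single 1 1

lemma E2_decomp (v : E2) : v = v 0 • e0 + v 1 • e1 := by
  ext i; fin_cases i <;> simp [e0, e1]

section

variable {x n : R41} {A B : E2 →L[ℝ] R41}

lemma vol_bilin (A B : E2 →L[ℝ] R41) (x n : R41) (v w : E2) :
    vol (A v) (B w) x n = v 0 * w 0 * vol (A e0) (B e0) x n + v 0 * w 1 * vol (A e0) (B e1) x n
      + v 1 * w 0 * vol (A e1) (B e0) x n + v 1 * w 1 * vol (A e1) (B e1) x n := by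
  conv_lhs => rw [E2_decomp v, E2_decomp w]
  simp only [map_add, map_smul, vol_add_left, vol_add_right, vol_smul_left, vol_smul_right]
  ring

lemma areaForm_eq (x n : R41) (A : E2 →L[ℝ] R41) (v w : E2) :
    areaForm x n A v w = (v 0 * w 1 - v 1 * w 0) * areaForm x n A e0 e1 := by
  simp only [areaForm]
  rw [vol_bilin, vol_self, vol_self, vol_swap (A e0) (A e1)]
  ring

lemma meanForm_eq (x n : R41) (A B : E2 →L[ℝ] R41) (v w : E2) :
    meanForm x n A B v w = (v 0 * w 1 - v 1 * w 0) * meanForm x n A B e0 e1 := by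
  simp only [meanForm]
  rw [vol_bilin A B, vol_bilin B A, vol_swap (A e0) (B e1), vol_swap (A e0) (B e0),
    vol_swap (A e1) (B e0), vol_swap (A e1) (B e1)]
  ring

lemma rel_iff_basis (a b : ℝ) : Rel x n A B a b ↔
    a * (meanForm x n A B e0 e1 - areaForm x n A e0 e1)
      + b * (areaForm x n B e0 e1 - areaForm x n A e0 e1) = 0 := by
  refine ⟨fun h => h e0 e1, fun h v w => ?_⟩
  rw [meanForm_eq, areaForm_eq, areaForm_eq x n B]
  linear_combination (v 0 * w 1 - v 1 * w 0) * h

/-- The differentials of the parallel surface and its normal. -/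
abbrev parA (A B : E2 →L[ℝ] R41) (δ : ℝ) : E2 →L[ℝ] R41 := Real.cosh δ • A + Real.sinh δ • B

lemma Jet.parallel (h : Jet x n A B) (δ : ℝ) :
    Jet (Real.cosh δ • x + Real.sinh δ • n) (Real.cosh δ • n + Real.sinh δ • x)
      (parA A B δ) (parA B A δ) := by
  have hc := Real.cosh_sq' δ
  have hnx : mink n x = 0 := by rw [mink_comm, h.xn]
  constructor
  · simp only [mink_add_left, mink_add_right, mink_smul_left, mink_smul_right, h.xx, h.nn, h.xn,
      hnx]; linear_combination -hc
  · simp only [mink_add_left, mink_add_right, mink_smul_left, mink_smul_right, h.xx, h.nn, h.xn,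
      hnx]; ring
  · simp only [mink_add_left, mink_add_right, mink_smul_left, mink_smul_right, h.xx, h.nn, h.xn,
      hnx]; linear_combination hc
  iterate 4
    intro v
    simp [mink_add_left, mink_add_right, mink_smul_left, mink_smul_right, h.Ax, h.An, h.Bx, h.Bn]
  · intro v w
    simp only [_root_.add_apply, _root_.smul_apply, mink_add_left,
      mink_add_right, mink_smul_left, mink_smul_right]
    rw [h.symm v w, mink_comm (B v) (A w), mink_comm (B v) (B w), mink_comm (A v) (A w),
      mink_comm (B w) (A v), h.symm v w]

lemma vol_parallel (X Y x n : R41) (δ : ℝ) :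
    vol X Y (Real.cosh δ • x + Real.sinh δ • n) (Real.cosh δ • n + Real.sinh δ • x)
      = vol X Y x n := by
  rw [add_comm (Real.cosh δ • n), vol_comb_last]
  have hc := Real.cosh_sq' δ
  linear_combination vol X Y x n * hc

lemma areaForm_parallel (x n : R41) (A B : E2 →L[ℝ] R41) (δ : ℝ) (v w : E2) :
    areaForm (Real.cosh δ • x + Real.sinh δ • n) (Real.cosh δ • n + Real.sinh δ • x)
        (parA A B δ) v w
      = Real.cosh δ ^ 2 * areaForm x n A v w - 2 * Real.cosh δ * Real.sinh δ * meanForm x n A B v w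
        + Real.sinh δ ^ 2 * areaForm x n B v w := by
  simp only [areaForm, meanForm, vol_parallel, _root_.add_apply,
    _root_.smul_apply, vol_add_left, vol_add_right, vol_smul_left, vol_smul_right]
  ring

lemma areaForm_parallel' (x n : R41) (A B : E2 →L[ℝ] R41) (δ : ℝ) (v w : E2) :
    areaForm (Real.cosh δ • x + Real.sinh δ • n) (Real.cosh δ • n + Real.sinh δ • x)
        (parA B A δ) v w
      = Real.cosh δ ^ 2 * areaForm x n B v w - 2 * Real.cosh δ * Real.sinh δ * meanForm x n A B v w
        + Real.sinh δ ^ 2 * areaForm x n A v w := by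
  simp only [areaForm, meanForm, vol_parallel, _root_.add_apply,
    _root_.smul_apply, vol_add_left, vol_add_right, vol_smul_left, vol_smul_right]
  ring

lemma meanForm_parallel (x n : R41) (A B : E2 →L[ℝ] R41) (δ : ℝ) (v w : E2) :
    meanForm (Real.cosh δ • x + Real.sinh δ • n) (Real.cosh δ • n + Real.sinh δ • x)
        (parA A B δ) (parA B A δ) v w
      = (Real.cosh δ ^ 2 + Real.sinh δ ^ 2) * meanForm x n A B v w
        - Real.cosh δ * Real.sinh δ * (areaForm x n A v w + areaForm x n B v w) := by
  simp only [areaForm, meanForm, vol_parallel, _root_.add_apply,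
    _root_.smul_apply, vol_add_left, vol_add_right, vol_smul_left, vol_smul_right]
  ring

lemma exp_two_mul_eq (δ : ℝ) : Real.exp (2 * δ) = (Real.cosh δ + Real.sinh δ) ^ 2 := by
  rw [Real.cosh_add_sinh, sq, ← Real.exp_add]; ring_nf

/-- With densities `p` (area), `r` (mean) and `q` (area of the normal), `q - p` is the same for all
parallel surfaces, while `r - p` becomes `e^{2δ} (r - p) - (e^{2δ} - 1) / 2 * (q - p)`. The shift in
`b_δ` compensates the last term, so the whole expression is just multiplied by `e^{2δ}`. -/
lemma rel_parallel_iff (x n : R41) (A B : E2 →L[ℝ] R41) (δ a b : ℝ) :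
    Rel (Real.cosh δ • x + Real.sinh δ • n) (Real.cosh δ • n + Real.sinh δ • x)
      (parA A B δ) (parA B A δ) a (b * Real.exp (2 * δ) + a * (Real.exp (2 * δ) - 1) / 2)
      ↔ Rel x n A B a b := by
  have hc := Real.cosh_sq' δ
  have he : Real.exp (2 * δ) ≠ 0 := (Real.exp_pos _).ne'
  refine forall_congr' fun v => forall_congr' fun w => ?_
  rw [areaForm_parallel, areaForm_parallel', meanForm_parallel]
  rw [← mul_right_inj' (b := _ * (_ - _) + b * _) he, mul_zero]
  refine Eq.congr ?_ rfl
  rw [exp_two_mul_eq]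
  generalize Real.cosh δ = c at *
  generalize Real.sinh δ = s at *
  generalize areaForm x n A v w = p
  generalize areaForm x n B v w = q
  generalize meanForm x n A B v w = r
  linear_combination (a * (q - p) / 2 + (b * (c + s) ^ 2 + a * ((c + s) ^ 2 - 1) / 2) * (q - p)) * hc

/-- Both tangent vectors are orthogonal to `x` and `n`, so a linear dependence among the four rows
cannot involve `x` or `n`. -/
lemma Jet.injective_iff (h : Jet x n A B) :
    Function.Injective A ↔ areaForm x n A e0 e1 ≠ 0 := by
  constructor
  · intro hA h0
    obtain ⟨c, hc0, hc⟩ := Matrix.exists_vecMul_eq_zero_iff.2 h0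
    have hc' : c 0 • A e0 + c 1 • A e1 + c 2 • x + c 3 • n = 0 := by
      rw [← hc]
      ext i
      simp [Matrix.vecMul, dotProduct, Fin.sum_univ_succ]
      ring
    have hnx : mink n x = 0 := by rw [mink_comm, h.xn]
    have h2 : c 2 = 0 := by
      have := congrArg (mink · x) hc'
      simp only [mink_add_left, mink_smul_left, h.Ax, h.xx, hnx, mink_zero_left] at this
      linarith
    have h3 : c 3 = 0 := by
      have := congrArg (mink · n) hc'
      simp only [mink_add_left, mink_smul_left, h.An, h.xn, h.nn, mink_zero_left] at this
      linarith
    have h4 : A (c 0 • e0 + c 1 • e1) = A 0 := by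
      simpa [h2, h3] using hc'
    have h5 := hA h4
    have h60 : c 0 = 0 := by simpa [e0, e1] using congrArg (· 0) h5
    have h61 : c 1 = 0 := by simpa [e0, e1] using congrArg (· 1) h5
    apply hc0
    ext i
    fin_cases i <;> simp [h2, h3, h60, h61]
  · intro h0
    rw [injective_iff_map_eq_zero]
    intro v hv
    have h1 := areaForm_eq x n A v e1
    have h2 := areaForm_eq x n A v e0
    simp only [areaForm, hv] at h1 h2 h0
    have hz : ∀ Y, vol 0 Y x n = 0 := fun Y => by simpa using vol_smul_left 0 0 Y x n
    rw [hz] at h1 h2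
    simp [e0, e1, h0] at h1 h2
    rw [E2_decomp v, h1]
    simp [e0, e1] at *
    tauto

end

/-! ### Curvature identities at a regular point, and degenerate first-order data. -/

section

variable {x n : R41} {A B : E2 →L[ℝ] R41}

lemma Jet.areaForm_mul_areaForm (h : Jet x n A B) :
    areaForm x n A e0 e1 * areaForm x n A e0 e1
      = mink (A e0) (A e0) * mink (A e1) (A e1) - mink (A e0) (A e1) ^ 2 := by
  rw [areaForm, vol_mul_vol h.xx h.nn h.xn (h.Ax _) (h.Ax _) (h.Ax _) (h.Ax _) (h.An _) (h.An _)
    (h.An _) (h.An _), mink_comm (A e1) (A e0)]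
  ring

lemma Jet.areaForm_mul_meanForm (h : Jet x n A B) :
    2 * (areaForm x n A e0 e1 * meanForm x n A B e0 e1)
      = -(mink (A e0) (A e0) * mink (A e1) (B e1)) + 2 * (mink (A e0) (A e1) * mink (A e0) (B e1))
        - mink (A e1) (A e1) * mink (A e0) (B e0) := by
  have h1 := vol_mul_vol h.xx h.nn h.xn (h.Ax e0) (h.Ax e0) (h.Ax e1) (h.Bx e1) (h.An e0) (h.An e0)
    (h.An e1) (h.Bn e1)
  have h2 := vol_mul_vol h.xx h.nn h.xn (h.Ax e0) (h.Bx e0) (h.Ax e1) (h.Ax e1) (h.An e0) (h.Bn e0)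
    (h.An e1) (h.An e1)
  rw [mink_comm (A e1) (A e0)] at h1
  rw [← h.symm e0 e1] at h2
  simp only [areaForm, meanForm]
  linear_combination -h1 - h2

lemma Jet.areaForm_mul_areaForm' (h : Jet x n A B) :
    areaForm x n A e0 e1 * areaForm x n B e0 e1
      = mink (A e0) (B e0) * mink (A e1) (B e1) - mink (A e0) (B e1) ^ 2 := by
  rw [areaForm, areaForm, vol_mul_vol h.xx h.nn h.xn (h.Ax _) (h.Bx _) (h.Ax _) (h.Bx _) (h.An _)
    (h.Bn _) (h.An _) (h.Bn _), ← h.symm e0 e1]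
  ring

lemma Jet.gram_pos (h : Jet x n A B) (hA : Function.Injective A) :
    0 < mink (A e0) (A e0) * mink (A e1) (A e1) - mink (A e0) (A e1) ^ 2 := by
  rw [← h.areaForm_mul_areaForm]
  exact mul_self_pos.2 (h.injective_iff.1 hA)

/-- At a regular point, the mean and Gaussian curvature satisfy `a (H - 1) + b K = 0` if and only
if the first-order data do. -/
lemma Jet.rel_iff (h : Jet x n A B) (hA : Function.Injective A) (a b : ℝ) :
    a * ((mink (A e0) (A e0) * -mink (A e1) (B e1) - 2 * (mink (A e0) (A e1) * -mink (A e0) (B e1))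
      + mink (A e1) (A e1) * -mink (A e0) (B e0)) /
        (2 * (mink (A e0) (A e0) * mink (A e1) (A e1) - mink (A e0) (A e1) ^ 2)) - 1)
      + b * ((-mink (A e0) (B e0) * -mink (A e1) (B e1) - (-mink (A e0) (B e1)) ^ 2
        - (mink (A e0) (A e0) * mink (A e1) (A e1) - mink (A e0) (A e1) ^ 2)) /
        (mink (A e0) (A e0) * mink (A e1) (A e1) - mink (A e0) (A e1) ^ 2)) = 0
      ↔ Rel x n A B a b := by
  have h0 := h.injective_iff.1 hA
  rw [rel_iff_basis]
  have e1 := h.areaForm_mul_areaForm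
  have e2 := h.areaForm_mul_meanForm
  have e3 := h.areaForm_mul_areaForm'
  rw [← e1]
  have e2' : (mink (A e0) (A e0) * -mink (A HypFront.e1) (B HypFront.e1)
      - 2 * (mink (A e0) (A HypFront.e1) * -mink (A e0) (B HypFront.e1))
      + mink (A HypFront.e1) (A HypFront.e1) * -mink (A e0) (B e0))
      = 2 * (areaForm x n A e0 HypFront.e1 * meanForm x n A B e0 HypFront.e1) := by
    rw [e2]; ring
  have e3' : (-mink (A e0) (B e0) * -mink (A HypFront.e1) (B HypFront.e1)
      - (-mink (A e0) (B HypFront.e1)) ^ 2)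
      = areaForm x n A e0 HypFront.e1 * areaForm x n B e0 HypFront.e1 := by
    rw [e3]; ring
  rw [e2', e3']
  generalize areaForm x n A e0 HypFront.e1 = p at *
  generalize areaForm x n B e0 HypFront.e1 = q at *
  generalize meanForm x n A B e0 HypFront.e1 = r at *
  have : a * (2 * (p * r) / (2 * (p * p)) - 1) + b * ((p * q - p * p) / (p * p))
      = (a * (r - p) + b * (q - p)) / p := by
    field_simp
  rw [this, div_eq_zero_iff]
  simp [h0]

/-- Some parallel surface is regular at the point. -/
def Reg (A B : E2 →L[ℝ] R41) : Prop := ∃ δ : ℝ, Function.Injective (parA A B δ)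

lemma Reg.imm (h : Reg A B) {v : E2} (hA : A v = 0) (hB : B v = 0) : v = 0 := by
  obtain ⟨δ, hδ⟩ := h
  apply hδ
  simp [hA, hB]

/-- The plane orthogonal to `x` and `n` is the same for all parallel surfaces, so the tangent
vectors of a regular one serve as a frame even where `A` is singular. -/
lemma Reg.exists_frame (h : Jet x n A B) (hr : Reg A B) :
    ∃ U V : R41, vol U V x n ≠ 0 ∧ ∀ X : R41, mink X x = 0 → mink X n = 0 →
      ∃ p q : ℝ, X = p • U + q • V := by
  obtain ⟨δ, hδ⟩ := hr
  have hj := h.parallel δ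
  have h0 := hj.injective_iff.1 hδ
  rw [areaForm, vol_parallel] at h0
  refine ⟨_, _, h0, fun X hX hXn => ?_⟩
  have aux : ∀ v, mink (parA A B δ v) x = 0 ∧ mink (parA A B δ v) n = 0 := fun v => by
    simp [mink_add_left, mink_smul_left, h.Ax, h.Bx, h.An, h.Bn]
  exact exists_comb h.xx h.nn h.xn (aux _).1 (aux _).1 hX (aux _).2 (aux _).2 hXn h0

/-- The relation `a (H - 1) + b K = 0` says that the wedge product of the differentials of `x + n`
and of `-(a + b) x + b n` vanishes. -/
lemma Rel.wedge (h : Jet x n A B) (hr : Reg A B) {a b : ℝ} (hab : Rel x n A B a b) (v w : E2)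
    (i j : Fin 4) :
    ((A v + B v) i * (-(a + b) • A w + b • B w) j - (A v + B v) j * (-(a + b) • A w + b • B w) i)
    = ((A w + B w) i * (-(a + b) • A v + b • B v) j
      - (A w + B w) j * (-(a + b) • A v + b • B v) i) := by
  obtain ⟨U, V, h0, hs⟩ := hr.exists_frame h
  obtain ⟨p1, q1, h1⟩ := hs _ (h.Ax v) (h.An v)
  obtain ⟨p2, q2, h2⟩ := hs _ (h.Ax w) (h.An w)
  obtain ⟨p3, q3, h3⟩ := hs _ (h.Bx v) (h.Bn v)
  obtain ⟨p4, q4, h4⟩ := hs _ (h.Bx w) (h.Bn w)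
  have hR := hab v w
  simp only [meanForm, areaForm, h1, h2, h3, h4, vol_add_left, vol_add_right, vol_smul_left,
    vol_smul_right, vol_self, vol_swap U V] at hR
  -- All four vectors lie in the plane of `U` and `V`, so a wedge product has a single component and
  -- `Rel` is exactly its vanishing.
  have hS : a * (-((p1 * q4 - q1 * p4) + (p3 * q2 - q3 * p2)) / 2 - (p1 * q2 - q1 * p2))
      + b * ((p3 * q4 - q3 * p4) - (p1 * q2 - q1 * p2)) = 0 := by
    apply mul_right_cancel₀ h0
    linear_combination hR
  simp only [h1, h2, h3, h4, Pi.add_apply, Pi.smul_apply, smul_eq_mul]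
  linear_combination 2 * (U i * V j - U j * V i) * hS

/-- With `B = -A ∘ S`, the identity is `S² - 2HS + K = 0` paired with the first fundamental form.
Here `K` is the extrinsic curvature `det S`. The inequality holds because `S` is self-adjoint for a
definite form and so has real eigenvalues. -/
lemma Jet.cayley_hamilton (h : Jet x n A B) (hA : Function.Injective A) {H K : ℝ}
    (hH : meanForm x n A B e0 e1 = H * areaForm x n A e0 e1)
    (hK : areaForm x n B e0 e1 = K * areaForm x n A e0 e1) :
    K ≤ H ^ 2 ∧
    ∀ v w, mink (B v) (B w) + 2 * H * mink (A v) (B w) + K * mink (A v) (A w) = 0 := by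
  have h0 := h.injective_iff.1 hA
  have hG := h.gram_pos hA
  have hE : 0 ≤ mink (A e0) (A e0) := mink_self_nonneg h.xx (h.Ax _)
  have hs : ∀ X : R41, mink X x = 0 → mink X n = 0 → ∃ p q : ℝ, X = p • A e0 + q • A e1 :=
    fun X hX hXn => exists_comb h.xx h.nn h.xn (h.Ax _) (h.Ax _) hX (h.An _) (h.An _) hXn h0
  obtain ⟨p, q, hB0⟩ := hs _ (h.Bx e0) (h.Bn e0)
  obtain ⟨r, t, hB1⟩ := hs _ (h.Bx e1) (h.Bn e1)
  have hsym := h.symm e0 e1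
  simp only [areaForm, meanForm, hB0, hB1, vol_add_left, vol_add_right, vol_smul_left,
    vol_smul_right, vol_self, vol_swap (A e0) (A e1)] at hH hK h0
  have hH' : p + t = -2 * H := by
    apply mul_right_cancel₀ h0
    linear_combination -2 * hH
  have hK' : p * t - q * r = K := by
    apply mul_right_cancel₀ h0
    linear_combination hK
  simp only [hB0, hB1, mink_add_right, mink_smul_right, mink_comm (A e1) (A e0)] at hsym
  have key : ∀ v w, mink (B v) (B w) + 2 * H * mink (A v) (B w) + K * mink (A v) (A w)
      = v 0 * w 0 * (mink (B e0) (B e0) + 2 * H * mink (A e0) (B e0) + K * mink (A e0) (A e0))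
      + v 0 * w 1 * (mink (B e0) (B e1) + 2 * H * mink (A e0) (B e1) + K * mink (A e0) (A e1))
      + v 1 * w 0 * (mink (B e1) (B e0) + 2 * H * mink (A e1) (B e0) + K * mink (A e1) (A e0))
      + v 1 * w 1 * (mink (B e1) (B e1) + 2 * H * mink (A e1) (B e1) + K * mink (A e1) (A e1)) := by
    intro v w
    conv_lhs => rw [E2_decomp v, E2_decomp w]
    simp only [map_add, map_smul, mink_add_left, mink_add_right, mink_smul_left, mink_smul_right]
    ring
  have hH2 : H = -(p + t) / 2 := by linarith
  refine ⟨?_, fun v w => ?_⟩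
  · rw [hH2, ← hK']
    generalize mink (A e0) (A e0) = E at *
    generalize mink (A e0) (A e1) = F at *
    generalize mink (A e1) (A e1) = G at *
    have hE' : 0 < E := by
      rcases hE.lt_or_eq with h | h
      · exact h
      · rw [← h] at hG; nlinarith [sq_nonneg F]
    -- The discriminant of `S` is `(p - t)² + 4qr = 4 (H² - K)`. After multiplication by `E²`, the
    -- symmetry of the second fundamental form turns it into a sum of squares.
    have : 0 ≤ E ^ 2 * ((p - t) ^ 2 + 4 * (q * r)) := by
      have : E ^ 2 * ((p - t) ^ 2 + 4 * (q * r))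
          = ((p - t) * E + 2 * q * F) ^ 2 + 4 * q ^ 2 * (E * G - F ^ 2) := by
        linear_combination 4 * q * E * hsym
      rw [this]; positivity
    have := nonneg_of_mul_nonneg_right this (by positivity)
    nlinarith
  · rw [key, hB0, hB1]
    simp only [mink_add_left, mink_add_right, mink_smul_left, mink_smul_right,
      mink_comm (A e1) (A e0)]
    rw [hH2, ← hK']
    generalize mink (A e0) (A e0) = E at *
    generalize mink (A e0) (A e1) = F at *
    generalize mink (A e1) (A e1) = G at *
    linear_combination (-v 0 * w 0 * q + v 1 * w 1 * r + v 1 * w 0 * p - v 0 * w 1 * t) * hsym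

/-- Here Cayley-Hamilton says that `B v + k A v` has length zero, and this vector is spacelike. -/
lemma Jet.umbilic (h : Jet x n A B) (hA : Function.Injective A) {k : ℝ}
    (hH : meanForm x n A B e0 e1 = k * areaForm x n A e0 e1)
    (hK : areaForm x n B e0 e1 = k ^ 2 * areaForm x n A e0 e1) (v : E2) : B v + k • A v = 0 := by
  have hc := (h.cayley_hamilton hA hH hK).2 v v
  apply eq_zero_of_mink_self_eq_zero h.xx
  · simp [mink_add_left, mink_smul_left, h.Ax, h.Bx]
  · simp only [mink_add_left, mink_add_right, mink_smul_left, mink_smul_right]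
    rw [mink_comm (B v) (A v)]
    linear_combination hc

/-- The only point type satisfying two independent relations is the horospherical one. -/
lemma Jet.horospherical (h : Jet x n A B) (hr : Reg A B) (h1 : Rel x n A B 1 0)
    (h2 : Rel x n A B 0 1) (v : E2) : A v + B v = 0 := by
  obtain ⟨δ, hδ⟩ := hr
  have hj := h.parallel δ
  have e1 := (rel_parallel_iff x n A B δ 1 0).2 h1
  have e2 := (rel_parallel_iff x n A B δ 0 1).2 h2
  rw [rel_iff_basis] at e1 e2
  have he : Real.exp (2 * δ) ≠ 0 := (Real.exp_pos _).ne'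
  simp only [zero_mul, zero_add, one_mul, zero_div, add_zero, mul_eq_zero, he, false_or] at e1 e2
  rw [e2, mul_zero, add_zero] at e1
  have hu := hj.umbilic hδ (k := 1) (by linarith) (by linarith) v
  have hcs : Real.cosh δ + Real.sinh δ ≠ 0 := by
    rw [Real.cosh_add_sinh]; exact (Real.exp_pos _).ne'
  have : (Real.cosh δ + Real.sinh δ) • (A v + B v) = 0 := by
    rw [← hu]
    simp only [_root_.add_apply, _root_.smul_apply]
    module
  exact (smul_eq_zero.1 this).resolve_left hcs

lemma Rel.of_add_eq_zero (h : ∀ v, A v + B v = 0) (a b : ℝ) : Rel x n A B a b := by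
  have : B = -A := by ext1 v; exact eq_neg_of_add_eq_zero_right (h v)
  subst this
  intro v w
  have e : ∀ X Y, vol (-X) Y x n = -vol X Y x n := fun X Y => by simpa using vol_smul_left (-1) X Y x n
  have e' : ∀ X Y, vol X (-Y) x n = -vol X Y x n := fun X Y => by
    simpa using vol_smul_right (-1) X Y x n
  simp only [meanForm, areaForm, _root_.neg_apply, e, e']
  ring

lemma Rel.of_two {a b a' b' : ℝ} (h1 : Rel x n A B a b) (h2 : Rel x n A B a' b')
    (h : a * b' - a' * b ≠ 0) (c d : ℝ) : Rel x n A B c d := by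
  intro v w
  apply mul_left_cancel₀ h
  linear_combination (c * b' - d * a') * h1 v w + (d * a - c * b) * h2 v w

lemma Rel.smul {a b : ℝ} (h : Rel x n A B a b) (c : ℝ) : Rel x n A B (c * a) (c * b) := by
  intro v w
  linear_combination c * h v w

/-- For these coefficients the second factor `-(a + b) A + b B` of the wedge product is `c A + d B`,
which vanishes. -/
lemma Rel.of_comb_eq_zero {c d : ℝ} (hcd : ∀ v, c • A v + d • B v = 0) :
    Rel x n A B (-(c + d)) d := by
  intro v w
  by_cases hd : d = 0
  · subst hd
    by_cases hc : c = 0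
    · simp [hc]
    · have hA : A = 0 := by ext1 v; simpa [hc] using hcd v
      have hz : ∀ Y, vol 0 Y x n = 0 := fun Y => by simpa using vol_smul_left 0 0 Y x n
      have hz' : ∀ Y, vol Y 0 x n = 0 := fun Y => by simpa using vol_smul_right 0 Y 0 x n
      simp [meanForm, areaForm, hA, hz, hz']
  · have hB : ∀ v, B v = (-(c / d)) • A v := by
      intro v
      apply smul_right_injective _ hd
      have := hcd v
      simp only [neg_smul, smul_neg, smul_smul, mul_div_cancel₀ _ hd]
      exact eq_neg_of_add_eq_zero_right this
    simp only [meanForm, areaForm, hB, vol_smul_left, vol_smul_right]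
    field_simp
    ring

/-- A relation not proportional to the one in `Rel.of_comb_eq_zero` would force `A + B = 0`.
Together with `c A + d B = 0` and `c ≠ d` this gives `A = B = 0`, against regularity. -/
lemma Rel.ratio_of_comb_eq_zero (h : Jet x n A B) (hr : Reg A B) {c d a b : ℝ}
    (hcd : ∀ v, c • A v + d • B v = 0) (hne : c ^ 2 ≠ d ^ 2) (hab : Rel x n A B a b) :
    a * d + b * (c + d) = 0 := by
  by_contra hh
  have h1 := (Rel.of_comb_eq_zero (x := x) (n := n) hcd)
  have hh' : a * d - -(c + d) * b ≠ 0 := by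
    intro h'; apply hh; linarith
  have h2 := hab.of_two h1 hh'
  have h3 := h.horospherical hr (h2 _ _) (h2 _ _)
  have hv : ∀ v : E2, v = 0 := by
    intro v
    have hA : A v = 0 := by
      have e : (c - d) • A v = 0 := by
        have e1 := hcd v
        have e2 : B v = -A v := eq_neg_of_add_eq_zero_right (h3 v)
        rw [e2] at e1
        rw [← e1]; module
      refine (smul_eq_zero.1 e).resolve_left fun h' => hne ?_
      rw [sub_eq_zero.1 h']
    exact hr.imm hA (by simpa [hA] using h3 v)
  have := congrArg (· 0) (hv e0)
  simp [e0] at this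

lemma Rel.neg_iff {a b : ℝ} : Rel x (-n) A (-B) a b ↔
    ∀ v w, a * (meanForm x n A B v w + areaForm x n A v w)
      - b * (areaForm x n B v w - areaForm x n A v w) = 0 := by
  refine forall_congr' fun v => forall_congr' fun w => Eq.congr ?_ rfl
  have e : ∀ X Y, vol (-X) Y x n = -vol X Y x n := fun X Y => by simpa using vol_smul_left (-1) X Y x n
  have e' : ∀ X Y, vol X (-Y) x n = -vol X Y x n := fun X Y => by
    simpa using vol_smul_right (-1) X Y x n
  simp only [meanForm, areaForm, _root_.neg_apply, e, e', vol_neg_last]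
  ring

/-- If both unit normals satisfy a relation with non-vanishing first coefficient, the parallel
surfaces have constant curvatures. -/
lemma exists_const_curv (a b a' b' δ : ℝ) (ha : a ≠ 0) (ha' : a' ≠ 0) :
    ∃ H K : ℝ, ∀ (x n : R41) (A B : E2 →L[ℝ] R41), Jet x n A B → Function.Injective (parA A B δ) →
      Rel x n A B a b → Rel x (-n) A (-B) a' b' →
      K ≠ 1 ∧
      meanForm (Real.cosh δ • x + Real.sinh δ • n) (Real.cosh δ • n + Real.sinh δ • x)
        (parA A B δ) (parA B A δ) e0 e1
        = H * areaForm (Real.cosh δ • x + Real.sinh δ • n) (Real.cosh δ • n + Real.sinh δ • x)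
          (parA A B δ) e0 e1 ∧
      areaForm (Real.cosh δ • x + Real.sinh δ • n) (Real.cosh δ • n + Real.sinh δ • x)
        (parA B A δ) e0 e1
        = K * areaForm (Real.cosh δ • x + Real.sinh δ • n) (Real.cosh δ • n + Real.sinh δ • x)
          (parA A B δ) e0 e1 := by
  set c := Real.cosh δ with hc
  set s := Real.sinh δ with hs
  have hcs : c ^ 2 = 1 + s ^ 2 := Real.cosh_sq' δ
  set u := b / a with hu
  set w := b' / a' with hw
  -- The two relations are linear and homogeneous in the densities `p, q, r`, so they make all three
  -- multiples of `Q = q - p`. In units of `Q`, `t0` is the area density of the parallel surface and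
  -- `t1` its mean density; regularity gives `t0 ≠ 0`.
  set t0 := c ^ 2 * ((u + w) / 2) - 2 * c * s * ((w - u) / 2) + s ^ 2 * (1 + (u + w) / 2) with ht0
  set t1 := (c ^ 2 + s ^ 2) * ((w - u) / 2) - c * s * (1 + (u + w)) with ht1
  refine ⟨t1 / t0, 1 + 1 / t0, fun x n A B hJ hinj h1 h2 => ?_⟩
  have h0 := (hJ.parallel δ).injective_iff.1 hinj
  rw [Rel.neg_iff] at h2
  specialize h1 e0 e1
  specialize h2 e0 e1
  have h3 := areaForm_parallel x n A B δ e0 e1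
  have h4 := areaForm_parallel' x n A B δ e0 e1
  have h5 := meanForm_parallel x n A B δ e0 e1
  rw [← hc, ← hs] at h3 h4 h5 h0
  rw [h3] at h0
  rw [h3, h4, h5]
  generalize areaForm x n A e0 e1 = p at *
  generalize areaForm x n B e0 e1 = q at *
  generalize meanForm x n A B e0 e1 = r at *
  have hb : b = u * a := by rw [hu]; field_simp
  have hb' : b' = w * a' := by rw [hw]; field_simp
  have g1 : r - p + u * (q - p) = 0 := by
    apply mul_left_cancel₀ ha; rw [hb] at h1; linear_combination h1
  have g2 : r + p - w * (q - p) = 0 := by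
    apply mul_left_cancel₀ ha'; rw [hb'] at h2; linear_combination h2
  obtain ⟨Q, hQ⟩ : ∃ Q, Q = q - p := ⟨_, rfl⟩
  have gp : p = (u + w) / 2 * Q := by rw [hQ]; linear_combination (g2 - g1) / 2
  have gr : r = (w - u) / 2 * Q := by rw [hQ]; linear_combination (g2 + g1) / 2
  have gq : q = (1 + (u + w) / 2) * Q := by linear_combination gp - hQ
  have gt : c ^ 2 * p - 2 * c * s * r + s ^ 2 * q = t0 * Q := by rw [gp, gr, gq, ht0]; ring
  rw [gt] at h0 ⊢
  have ht : t0 ≠ 0 := left_ne_zero_of_mul h0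
  refine ⟨by simp [ht], ?_, ?_⟩
  · have e : t1 / t0 * (t0 * Q) = t1 * Q := by field_simp
    rw [gp, gr, gq, e, ht1]; ring
  · have e : (1 + 1 / t0) * (t0 * Q) = t0 * Q + Q := by field_simp
    rw [gp, gr, gq, e, ht0]
    linear_combination Q * hcs

end

/-! ## Unique continuation in a coordinate patch -/

/-- The inverse function theorem on a coordinate patch. -/
lemma exists_local_inverse {G : Type*} [NormedAddCommGroup G] [NormedSpace ℝ G]
    [FiniteDimensional ℝ G] (hG : Module.finrank ℝ G = 2) {z : E2 → G} {Ω : Set E2}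
    (hΩ : IsOpen Ω) (hz : ContDiffOn ℝ ∞ z Ω) {x₀ : E2} (hx₀ : x₀ ∈ Ω)
    (hinj : Function.Injective (fderiv ℝ z x₀)) :
    ∃ φ : OpenPartialHomeomorph E2 G, x₀ ∈ φ.source ∧ φ.source ⊆ Ω ∧ (∀ x, φ x = z x) ∧
      ContDiffOn ℝ ∞ φ.symm φ.target ∧
      (∀ x ∈ φ.source, ∀ u, fderiv ℝ φ.symm (φ x) (fderiv ℝ z x u) = u) ∧
      (∀ x ∈ φ.source, ∀ u, fderiv ℝ z x (fderiv ℝ φ.symm (φ x) u) = u) := by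
  have hE : Module.finrank ℝ E2 = 2 := by simp
  have := FiniteDimensional.complete ℝ G
  have hca : ∀ x ∈ Ω, ContDiffAt ℝ ∞ z x := fun x hx => hz.contDiffAt (hΩ.mem_nhds hx)
  let e : E2 ≃L[ℝ] G := (LinearEquiv.ofInjectiveOfFinrankEq
    (fderiv ℝ z x₀ : E2 →ₗ[ℝ] G) hinj (by rw [hE, hG])).toContinuousLinearEquiv
  have he : (e : E2 →L[ℝ] G) = fderiv ℝ z x₀ := by ext1 v; rfl
  have hstrict : HasStrictFDerivAt z (e : E2 →L[ℝ] G) x₀ := by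
    rw [he]; exact (hca x₀ hx₀).hasStrictFDerivAt (by simp)
  have hcont : ContinuousOn (fderiv ℝ z) Ω := hz.continuousOn_fderiv_of_isOpen hΩ (by simp)
  -- Restricting to points where the differential is invertible makes the inverse smooth on its
  -- whole domain, not only at the image of `x₀`.
  have hopen : IsOpen (Ω ∩ fderiv ℝ z ⁻¹' Set.range ((↑) : (E2 ≃L[ℝ] G) → E2 →L[ℝ] G)) :=
    hcont.isOpen_inter_preimage hΩ ContinuousLinearEquiv.isOpen
  let ψ := hstrict.toOpenPartialHomeomorph z
  let φ := ψ.restrOpen _ hopen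
  have hsrc : φ.source = ψ.source ∩ (Ω ∩ fderiv ℝ z ⁻¹' Set.range ((↑) : (E2 ≃L[ℝ] G) → _)) :=
    rfl
  have hφ : ∀ x, φ x = z x := fun x => rfl
  have hder : ∀ x ∈ φ.source, ∃ e : E2 ≃L[ℝ] G, fderiv ℝ z x = e ∧
      HasFDerivAt φ.symm (e.symm : G →L[ℝ] E2) (φ x) := by
    intro x hx
    rw [hsrc] at hx
    obtain ⟨e, he⟩ := hx.2.2
    refine ⟨e, he.symm, ?_⟩
    have hx' : x ∈ φ.source := by rw [hsrc]; exact hx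
    apply φ.hasFDerivAt_symm (φ.map_source hx')
    rw [φ.left_inv hx', he]
    exact ((hca x hx.2.1).differentiableAt (by simp)).hasFDerivAt
  refine ⟨φ, ⟨hstrict.mem_toOpenPartialHomeomorph_source, hx₀, e, he⟩, ?_, hφ, ?_, ?_, ?_⟩
  · rw [hsrc]; exact fun x hx => hx.2.1
  · intro y hy
    have hx := φ.map_target hy
    obtain ⟨e', he', -⟩ := hder _ hx
    have hc := hca _ (hsrc ▸ hx).2.1
    refine (φ.contDiffAt_symm hy (f₀' := e') ?_ hc).contDiffWithinAt
    rw [← he']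
    exact (hc.differentiableAt (by simp)).hasFDerivAt
  · intro x hx u
    obtain ⟨e', he', h⟩ := hder x hx
    rw [h.fderiv, he']; simp
  · intro x hx u
    obtain ⟨e', he', h⟩ := hder x hx
    rw [h.fderiv, he']; simp

/-- Unique continuation for a function that is holomorphic with respect to the complex
coordinate `z`. -/
lemma eventually_eq_of_holomorphic {z k : E2 → ℂ} {Ω O : Set E2} {x₀ : E2} {c : ℂ}
    (hΩ : IsOpen Ω) (hx₀ : x₀ ∈ Ω) (hz : ContDiffOn ℝ ∞ z Ω) (hk : DifferentiableOn ℝ k Ω)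
    (hinj : Function.Injective (fderiv ℝ z x₀))
    (hkz : ∀ x ∈ Ω, ∀ v w,
      fderiv ℝ k x v * fderiv ℝ z x w = fderiv ℝ k x w * fderiv ℝ z x v)
    (hO : IsOpen O) (hxO : x₀ ∈ closure O) (hc : ∀ x ∈ Ω ∩ O, k x = c) :
    ∀ᶠ x in 𝓝 x₀, k x = c := by
  obtain ⟨φ, hxφ, hφΩ, hφz, hsm, hl, hr⟩ := exists_local_inverse (G := ℂ) (by simp) hΩ hz hx₀ hinj
  obtain ⟨r, hr0, hball⟩ := Metric.isOpen_iff.1 φ.open_target _ (φ.map_source hxφ)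
  have hhol : ∀ y ∈ φ.target, DifferentiableAt ℂ (k ∘ φ.symm) y := by
    intro y hy
    have hx := φ.map_target hy
    have hdk : DifferentiableAt ℝ k (φ.symm y) :=
      hk.differentiableAt (hΩ.mem_nhds (hφΩ hx))
    have hds : DifferentiableAt ℝ φ.symm y :=
      (hsm.contDiffAt (φ.open_target.mem_nhds hy)).differentiableAt (by simp)
    rw [differentiableAt_complex_iff_differentiableAt_real]
    refine ⟨hdk.comp y hds, ?_⟩
    rw [fderiv_comp y hdk hds]
    -- Evaluated on the preimages of `I` and `1` under `dz`, the condition `dk ∧ dz = 0` is the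
    -- Cauchy-Riemann equation.
    have h1 := hkz _ (hφΩ hx) (fderiv ℝ φ.symm y Complex.I) (fderiv ℝ φ.symm y 1)
    have h2 := hr _ hx Complex.I
    have h3 := hr _ hx 1
    rw [φ.right_inv hy] at h2 h3
    rw [h2, h3] at h1
    simp only [ContinuousLinearMap.comp_apply, smul_eq_mul]
    linear_combination h1
  have hana : AnalyticOnNhd ℂ (k ∘ φ.symm) (Metric.ball (φ x₀) r) :=
    DifferentiableOn.analyticOnNhd
      (fun y hy => (hhol y (hball hy)).differentiableWithinAt) Metric.isOpen_ball
  have hopen : IsOpen (φ.source ∩ φ ⁻¹' Metric.ball (φ x₀) r) :=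
    φ.isOpen_inter_preimage Metric.isOpen_ball
  have hmem : x₀ ∈ φ.source ∩ φ ⁻¹' Metric.ball (φ x₀) r := ⟨hxφ, Metric.mem_ball_self hr0⟩
  obtain ⟨x₁, hx₁, hx₁O⟩ := mem_closure_iff.1 hxO _ hopen hmem
  have hev : k ∘ φ.symm =ᶠ[𝓝 (φ x₁)] fun _ => c := by
    have h1 : ∀ᶠ y in 𝓝 (φ x₁), φ.symm y ∈ φ.source ∩ O := by
      have : Tendsto φ.symm (𝓝 (φ x₁)) (𝓝 x₁) := by
        have := φ.continuousAt_symm (φ.map_source hx₁.1)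
        rwa [ContinuousAt, φ.left_inv hx₁.1] at this
      exact this ((φ.open_source.inter hO).mem_nhds ⟨hx₁.1, hx₁O⟩)
    filter_upwards [h1] with y hy
    exact hc _ ⟨hφΩ hy.1, hy.2⟩
  have heq := hana.eqOn_of_preconnected_of_eventuallyEq analyticOnNhd_const
    (convex_ball _ _).isPreconnected hx₁.2 hev
  filter_upwards [hopen.mem_nhds hmem] with x hx
  have := heq hx.2
  simpa [φ.left_inv hx.1] using this

/-! ## The holomorphic data of a surface satisfying a linear relation -/

/-- For a null vector `h`, the quotient `mbC h / lC s h` is the stereographic coordinate of its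
direction. The two values `s = 1` and `s = -1` project from opposite poles, so one of them is always
admissible. -/
def lC (s : ℝ) : R41 →L[ℝ] ℂ :=
  Complex.ofRealCLM ∘L (ContinuousLinearMap.proj (R := ℝ) (φ := fun _ : Fin 4 => ℝ) 0
    - s • ContinuousLinearMap.proj (R := ℝ) (φ := fun _ : Fin 4 => ℝ) 3)

def mC : R41 →L[ℝ] ℂ :=
  Complex.ofRealCLM ∘L (ContinuousLinearMap.proj (R := ℝ) (φ := fun _ : Fin 4 => ℝ) 1)
    + Complex.I • Complex.ofRealCLM ∘L
      (ContinuousLinearMap.proj (R := ℝ) (φ := fun _ : Fin 4 => ℝ) 2)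

def mbC : R41 →L[ℝ] ℂ :=
  Complex.ofRealCLM ∘L (ContinuousLinearMap.proj (R := ℝ) (φ := fun _ : Fin 4 => ℝ) 1)
    - Complex.I • Complex.ofRealCLM ∘L
      (ContinuousLinearMap.proj (R := ℝ) (φ := fun _ : Fin 4 => ℝ) 2)

lemma lC_apply (s : ℝ) (X : R41) : lC s X = ((X 0 - s * X 3 : ℝ) : ℂ) := by simp [lC]

lemma mC_apply (X : R41) : mC X = X 1 + Complex.I * X 2 := by simp [mC]

lemma mbC_apply (X : R41) : mbC X = X 1 - Complex.I * X 2 := by simp [mbC]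

/-- A complex-valued alternating form. -/
def wf (s : ℝ) (h X : R41) : ℂ := lC s h * mC X - mC h * lC s X

/-- The conjugate of `wf`, and the numerator in the quotient rule for `mbC h / lC s h`. -/
def wb (s : ℝ) (h X : R41) : ℂ := lC s h * mbC X - mbC h * lC s X

/-- On the orthogonal complement of `h` the real part is conformal to the metric, and the imaginary
part depends on `X` and `Y` only through `X ∧ Y`. So the product is unchanged when a pair is
replaced by another with the same inner product and the same wedge. -/
lemma wb_mul_wf {s : ℝ} (hs : s = 1 ∨ s = -1) {h X Y : R41} (hh : mink h h = 0)
    (hX : mink X h = 0) (hY : mink Y h = 0) :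
    wb s h X * wf s h Y = (((h 0 - s * h 3) * (h 0 - s * h 3) * mink X Y : ℝ) : ℂ)
      + Complex.I * (((h 0 - s * h 3) * ((h 0 - s * h 3) * (X 1 * Y 2 - X 2 * Y 1)
        + h 1 * ((X 2 * Y 0 - X 0 * Y 2) - s * (X 2 * Y 3 - X 3 * Y 2))
        - h 2 * ((X 1 * Y 0 - X 0 * Y 1) - s * (X 1 * Y 3 - X 3 * Y 1))) : ℝ) : ℂ) := by
  simp only [mink] at hh hX hY
  simp only [wb, wf, lC_apply, mC_apply, mbC_apply]
  rcases hs with rfl | rfl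
  · apply Complex.ext
    · simp [mink]
      linear_combination (X 0 - X 3) * (Y 0 - Y 3) * hh - (h 0 - h 3) * (Y 0 - Y 3) * hX
        - (h 0 - h 3) * (X 0 - X 3) * hY
    · simp
      ring
  · apply Complex.ext
    · simp [mink]
      linear_combination (X 0 + X 3) * (Y 0 + Y 3) * hh - (h 0 + h 3) * (Y 0 + Y 3) * hX
        - (h 0 + h 3) * (X 0 + X 3) * hY
    · simp
      ring

lemma wf_eq_of_wedge (s : ℝ) {X Y X' Y' : R41}
    (H : ∀ i j, X i * Y j - X j * Y i = X' i * Y' j - X' j * Y' i) : wf s X Y = wf s X' Y' := by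
  have H' : ∀ i j, (X i : ℂ) * Y j - X j * Y i = X' i * Y' j - X' j * Y' i := fun i j => by
    exact_mod_cast congrArg ((↑) : ℝ → ℂ) (H i j)
  simp only [wf, lC_apply, mC_apply]
  push_cast
  linear_combination H' 0 1 + Complex.I * H' 0 2 - s * (H' 3 1 + Complex.I * H' 3 2)

/-- Taking `Y = X` in `wb_mul_wf`, the real part is a nonzero multiple of `mink X X`, and `X` is
spacelike because it is orthogonal to `f`. -/
lemma eq_zero_of_wf {s : ℝ} (hs : s = 1 ∨ s = -1) {f h X : R41} (hf : mink f f = -1)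
    (hh : mink h h = 0) (hX : mink X h = 0) (hXf : mink X f = 0) (hl : lC s h ≠ 0)
    (h0 : wf s h X = 0) : X = 0 := by
  have := congrArg Complex.re (wb_mul_wf hs hh hX hX)
  rw [h0] at this
  rw [lC_apply] at hl
  have hl' : h 0 - s * h 3 ≠ 0 := by exact_mod_cast hl
  simp [-Complex.ofReal_mul, -Complex.ofReal_sub, -Complex.ofReal_add, hl',
    Complex.ofReal_re] at this
  exact eq_zero_of_mink_self_eq_zero hf hXf this

lemma eq_zero_of_wb {s : ℝ} (hs : s = 1 ∨ s = -1) {f h X : R41} (hf : mink f f = -1)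
    (hh : mink h h = 0) (hX : mink X h = 0) (hXf : mink X f = 0) (hl : lC s h ≠ 0)
    (h0 : wb s h X = 0) : X = 0 := by
  have := congrArg Complex.re (wb_mul_wf hs hh hX hX)
  rw [h0] at this
  rw [lC_apply] at hl
  have hl' : h 0 - s * h 3 ≠ 0 := by exact_mod_cast hl
  simp [-Complex.ofReal_mul, -Complex.ofReal_sub, -Complex.ofReal_add, hl',
    Complex.ofReal_re] at this
  exact eq_zero_of_mink_self_eq_zero hf hXf this

/-- A surface patch with unit normal, all of whose points are regular for some parallel surface and
satisfy the linear relation with coefficients `a, b`. -/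
structure LocalSurf (F N : E2 → R41) (Ω : Set E2) (a b : ℝ) : Prop where
  isOpen : IsOpen Ω
  smF : ContDiffOn ℝ ∞ F Ω
  smN : ContDiffOn ℝ ∞ N Ω
  jet : ∀ x ∈ Ω, Jet (F x) (N x) (fderiv ℝ F x) (fderiv ℝ N x)
  reg : ∀ x ∈ Ω, Reg (fderiv ℝ F x) (fderiv ℝ N x)
  rel : ∀ x ∈ Ω, Rel (F x) (N x) (fderiv ℝ F x) (fderiv ℝ N x) a b

lemma LocalSurf.mono {F N : E2 → R41} {Ω Ω' : Set E2} {a b : ℝ} (S : LocalSurf F N Ω a b)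
    (hΩ' : IsOpen Ω') (h : Ω' ⊆ Ω) : LocalSurf F N Ω' a b :=
  ⟨hΩ', S.smF.mono h, S.smN.mono h, fun x hx => S.jet x (h hx), fun x hx => S.reg x (h hx),
    fun x hx => S.rel x (h hx)⟩

lemma two_le_infty : (2 : WithTop ℕ∞) ≤ ∞ := by
  have : ((2 : ℕ∞) : WithTop ℕ∞) ≤ ∞ := WithTop.coe_le_coe.2 le_top
  exact this

namespace LocalSurf

variable {F N : E2 → R41} {Ω : Set E2} {a b : ℝ}

/-- The null vector `f + ν`. -/
def hv (F N : E2 → R41) : E2 → R41 := fun x => F x + N x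

/-- The second factor in the wedge form of `Rel`: `Rel.wedge` says that the wedge of `d(hv)` and
`d(yv)` vanishes. -/
def yv (F N : E2 → R41) (a b : ℝ) : E2 → R41 := fun x => -(a + b) • F x + b • N x

/-- The closed form `(f + ν) ∧ d(-(a + b) f + b ν)`, in complex components. -/
def om (s : ℝ) (F N : E2 → R41) (a b : ℝ) : E2 → E2 →L[ℝ] ℂ := fun x =>
  lC s (hv F N x) • (mC ∘L fderiv ℝ (yv F N a b) x)
    - mC (hv F N x) • (lC s ∘L fderiv ℝ (yv F N a b) x)

/-- The conjugate of the hyperbolic Gauss map `[f + ν]`. -/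
def gm (s : ℝ) (F N : E2 → R41) : E2 → ℂ := fun x => mbC (hv F N x) / lC s (hv F N x)

lemma om_apply (s : ℝ) (x v : E2) :
    om s F N a b x v = wf s (hv F N x) (fderiv ℝ (yv F N a b) x v) := by
  simp [om, wf]

variable (S : LocalSurf F N Ω a b)
include S

lemma diffF {x : E2} (hx : x ∈ Ω) : DifferentiableAt ℝ F x :=
  (S.smF.contDiffAt (S.isOpen.mem_nhds hx)).differentiableAt (by simp)

lemma diffN {x : E2} (hx : x ∈ Ω) : DifferentiableAt ℝ N x :=
  (S.smN.contDiffAt (S.isOpen.mem_nhds hx)).differentiableAt (by simp)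

lemma smh : ContDiffOn ℝ ∞ (hv F N) Ω := S.smF.add S.smN

lemma smy : ContDiffOn ℝ ∞ (yv F N a b) Ω := (S.smF.const_smul _).add (S.smN.const_smul _)

lemma fderiv_hv {x : E2} (hx : x ∈ Ω) (v : E2) :
    fderiv ℝ (hv F N) x v = fderiv ℝ F x v + fderiv ℝ N x v := by
  have : HasFDerivAt (hv F N) (fderiv ℝ F x + fderiv ℝ N x) x :=
    (S.diffF hx).hasFDerivAt.add (S.diffN hx).hasFDerivAt
  rw [this.fderiv]; rfl

lemma fderiv_yv {x : E2} (hx : x ∈ Ω) (v : E2) :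
    fderiv ℝ (yv F N a b) x v = -(a + b) • fderiv ℝ F x v + b • fderiv ℝ N x v := by
  have : HasFDerivAt (yv F N a b) (-(a + b) • fderiv ℝ F x + b • fderiv ℝ N x) x :=
    ((S.diffF hx).hasFDerivAt.const_smul (-(a + b))).add ((S.diffN hx).hasFDerivAt.const_smul b)
  rw [this.fderiv]; rfl

lemma hv_null {x : E2} (hx : x ∈ Ω) : mink (hv F N x) (hv F N x) = 0 := by
  have J := S.jet x hx
  simp only [hv, mink_add_left, mink_add_right, J.xx, J.nn, J.xn, mink_comm (N x) (F x)]
  ring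

lemma dhv_perp {x : E2} (hx : x ∈ Ω) (v : E2) :
    mink (fderiv ℝ (hv F N) x v) (hv F N x) = 0 ∧ mink (fderiv ℝ (hv F N) x v) (F x) = 0 := by
  have J := S.jet x hx
  rw [S.fderiv_hv hx]
  simp [hv, mink_add_left, mink_add_right, J.Ax, J.An, J.Bx, J.Bn]

lemma dyv_perp {x : E2} (hx : x ∈ Ω) (v : E2) :
    mink (fderiv ℝ (yv F N a b) x v) (hv F N x) = 0 ∧
      mink (fderiv ℝ (yv F N a b) x v) (F x) = 0 := by
  have J := S.jet x hx
  rw [S.fderiv_yv hx]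
  simp only [hv, mink_add_left, mink_add_right, mink_smul_left, J.Ax, J.An, J.Bx, J.Bn]
  simp

lemma wedge {x : E2} (hx : x ∈ Ω) (v w : E2) (i j : Fin 4) :
    fderiv ℝ (hv F N) x v i * fderiv ℝ (yv F N a b) x w j
      - fderiv ℝ (hv F N) x v j * fderiv ℝ (yv F N a b) x w i
    = fderiv ℝ (hv F N) x w i * fderiv ℝ (yv F N a b) x v j
      - fderiv ℝ (hv F N) x w j * fderiv ℝ (yv F N a b) x v i := by
  simp only [S.fderiv_hv hx, S.fderiv_yv hx]
  exact (S.rel x hx).wedge (S.jet x hx) (S.reg x hx) v w i j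

lemma mink_dhv_dyv {x : E2} (hx : x ∈ Ω) (v w : E2) :
    mink (fderiv ℝ (hv F N) x v) (fderiv ℝ (yv F N a b) x w)
      = mink (fderiv ℝ (hv F N) x w) (fderiv ℝ (yv F N a b) x v) := by
  have J := S.jet x hx
  simp only [S.fderiv_hv hx, S.fderiv_yv hx, mink_add_left, mink_add_right, mink_smul_right]
  rw [mink_comm (fderiv ℝ F x v) (fderiv ℝ F x w), mink_comm (fderiv ℝ N x v) (fderiv ℝ N x w),
    mink_comm (fderiv ℝ N x v) (fderiv ℝ F x w), mink_comm (fderiv ℝ N x w) (fderiv ℝ F x v),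
    J.symm v w]

/-- The conjugate Gauss map is holomorphic: `dg ∧ ω = 0`. -/
lemma wb_mul_om {s : ℝ} (hs : s = 1 ∨ s = -1) {x : E2} (hx : x ∈ Ω) (v w : E2) :
    wb s (hv F N x) (fderiv ℝ (hv F N) x v) * om s F N a b x w
      = wb s (hv F N x) (fderiv ℝ (hv F N) x w) * om s F N a b x v := by
  rw [om_apply, om_apply, wb_mul_wf hs (S.hv_null hx) (S.dhv_perp hx v).1 (S.dyv_perp hx w).1,
    wb_mul_wf hs (S.hv_null hx) (S.dhv_perp hx w).1 (S.dyv_perp hx v).1, S.mink_dhv_dyv hx v w,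
    S.wedge hx v w 1 2, S.wedge hx v w 2 0, S.wedge hx v w 2 3, S.wedge hx v w 1 0,
    S.wedge hx v w 1 3]

lemma sm_om (s : ℝ) : ContDiffOn ℝ ∞ (om s F N a b) Ω := by
  have h1 : ContDiffOn ℝ ∞ (fderiv ℝ (yv F N a b)) Ω := S.smy.fderiv_of_isOpen S.isOpen (by simp)
  have h2 : ∀ L : R41 →L[ℝ] ℂ, ContDiffOn ℝ ∞ (fun x => L (hv F N x)) Ω := fun L =>
    L.contDiff.comp_contDiffOn S.smh
  have h3 : ∀ L : R41 →L[ℝ] ℂ, ContDiffOn ℝ ∞ (fun x => L ∘L fderiv ℝ (yv F N a b) x) Ω := fun L =>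
    contDiffOn_const.clm_comp h1
  exact ((h2 _).smul (h3 _)).sub ((h2 _).smul (h3 _))

/-- The derivative of `ω` splits into a term in `dh` and `dy`, symmetric because their wedge
vanishes, and a term in the second derivative of `y`, symmetric by Schwarz. -/
lemma om_closed (s : ℝ) {x : E2} (hx : x ∈ Ω) (u v : E2) :
    fderiv ℝ (om s F N a b) x u v = fderiv ℝ (om s F N a b) x v u := by
  have hnx := S.isOpen.mem_nhds hx
  have hd : DifferentiableAt ℝ (om s F N a b) x :=
    ((S.sm_om s).contDiffAt hnx).differentiableAt (by simp)
  have h1 : ContDiffOn ℝ ∞ (fderiv ℝ (yv F N a b)) Ω := S.smy.fderiv_of_isOpen S.isOpen (by simp)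
  have hdy : HasFDerivAt (fderiv ℝ (yv F N a b)) (fderiv ℝ (fderiv ℝ (yv F N a b)) x) x :=
    ((h1.contDiffAt hnx).differentiableAt (by simp)).hasFDerivAt
  have hdh : HasFDerivAt (hv F N) (fderiv ℝ (hv F N) x) x :=
    ((S.smh.contDiffAt hnx).differentiableAt (by simp)).hasFDerivAt
  have hsymm : IsSymmSndFDerivAt ℝ (yv F N a b) x :=
    (S.smy.contDiffAt hnx).isSymmSndFDerivAt (by simp; exact two_le_infty)
  have key : ∀ u v, fderiv ℝ (om s F N a b) x u v
      = wf s (fderiv ℝ (hv F N) x u) (fderiv ℝ (yv F N a b) x v)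
        + wf s (hv F N x) (fderiv ℝ (fderiv ℝ (yv F N a b)) x u v) := by
    intro u v
    have e1 : fderiv ℝ (om s F N a b) x u v = fderiv ℝ (fun x => om s F N a b x v) x u := by
      have : HasFDerivAt (fun x => om s F N a b x v) ((fderiv ℝ (om s F N a b) x).flip v) x := by
        simpa using hd.hasFDerivAt.clm_apply (hasFDerivAt_const v x)
      rw [this.fderiv]; rfl
    have hc : ∀ L : R41 →L[ℝ] ℂ, HasFDerivAt (fun x => L (hv F N x)) (L ∘L fderiv ℝ (hv F N) x) x :=
      fun L => L.hasFDerivAt.comp x hdh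
    have hyv : HasFDerivAt (fun x => fderiv ℝ (yv F N a b) x v)
        ((fderiv ℝ (fderiv ℝ (yv F N a b)) x).flip v) x := by
      simpa using hdy.clm_apply (hasFDerivAt_const v x)
    have hy : ∀ L : R41 →L[ℝ] ℂ, HasFDerivAt (fun x => L (fderiv ℝ (yv F N a b) x v))
        (L ∘L (fderiv ℝ (fderiv ℝ (yv F N a b)) x).flip v) x :=
      fun L => L.hasFDerivAt.comp x hyv
    have e2 := ((hc (lC s)).mul (hy mC)).sub ((hc mC).mul (hy (lC s)))
    have e3 : (fun x => om s F N a b x v) = fun x => lC s (hv F N x) * mC (fderiv ℝ (yv F N a b) x v)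
        - mC (hv F N x) * lC s (fderiv ℝ (yv F N a b) x v) := by
      funext x; simp [om]
    rw [e1, e3]
    erw [e2.fderiv]
    simp [wf]
    ring
  rw [key, key, hsymm.eq u v, wf_eq_of_wedge s (S.wedge hx u v)]

lemma sm_gm {s : ℝ} (hl : ∀ x ∈ Ω, lC s (hv F N x) ≠ 0) : ContDiffOn ℝ ∞ (gm s F N) Ω := by
  have h2 : ∀ L : R41 →L[ℝ] ℂ, ContDiffOn ℝ ∞ (fun x => L (hv F N x)) Ω := fun L =>
    L.contDiff.comp_contDiffOn S.smh
  unfold gm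
  simp only [div_eq_mul_inv]
  exact (h2 _).mul ((h2 _).inv hl)

lemma fderiv_gm {s : ℝ} {x : E2} (hx : x ∈ Ω) (hl : lC s (hv F N x) ≠ 0) (v : E2) :
    fderiv ℝ (gm s F N) x v
      = wb s (hv F N x) (fderiv ℝ (hv F N) x v) / lC s (hv F N x) ^ 2 := by
  have hdh : HasFDerivAt (hv F N) (fderiv ℝ (hv F N) x) x :=
    ((S.smh.contDiffAt (S.isOpen.mem_nhds hx)).differentiableAt (by simp)).hasFDerivAt
  have hc : ∀ L : R41 →L[ℝ] ℂ, HasFDerivAt (fun x => L (hv F N x)) (L ∘L fderiv ℝ (hv F N) x) x :=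
    fun L => L.hasFDerivAt.comp x hdh
  have h1 : HasFDerivAt (fun y => (lC s (hv F N y))⁻¹) _ x :=
    (hasFDerivAt_inv' (𝕜 := ℝ) hl).comp x (hc (lC s))
  have e := (hc mbC).mul h1
  have e' : gm s F N = (fun x => mbC (hv F N x)) * fun y => (lC s (hv F N y))⁻¹ := by
    funext y
    simp [gm, div_eq_mul_inv]
  rw [e', e.fderiv]
  simp [wb]
  field_simp
  ring

end LocalSurf

/-! ### Propagation of constancy to points of the closure. -/

lemma fderiv_eq_zero_of_closure {V : Type*} [NormedAddCommGroup V] [NormedSpace ℝ V] {g : E2 → V}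
    {Ω O : Set E2} (hΩ : IsOpen Ω) (hg : ContDiffOn ℝ ∞ g Ω) {x₀ : E2} (hx₀ : x₀ ∈ Ω)
    (hO : IsOpen O) (hxO : x₀ ∈ closure O) {C : V} (hC : ∀ x ∈ Ω ∩ O, g x = C) :
    fderiv ℝ g x₀ = 0 := by
  have hcont : ContinuousOn (fderiv ℝ g) Ω := hg.continuousOn_fderiv_of_isOpen hΩ (by simp)
  by_contra h
  have hopen : IsOpen (Ω ∩ fderiv ℝ g ⁻¹' {0}ᶜ) :=
    hcont.isOpen_inter_preimage hΩ isOpen_compl_singleton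
  obtain ⟨x, hx, hxO'⟩ := mem_closure_iff.1 hxO _ hopen ⟨hx₀, h⟩
  apply hx.2
  have : g =ᶠ[𝓝 x] fun _ => C := by
    filter_upwards [(hΩ.inter hO).mem_nhds ⟨hx.1, hxO'⟩] with y hy using hC y hy
  rw [Set.mem_singleton_iff, this.fderiv_eq]
  simp

lemma eventually_eq_of_fderiv_eq_zero {V : Type*} [NormedAddCommGroup V] [NormedSpace ℝ V]
    {g : E2 → V} {Ω O : Set E2} (hΩ : IsOpen Ω) (hg : DifferentiableOn ℝ g Ω) {x₀ : E2}
    (hx₀ : x₀ ∈ Ω) (hxO : x₀ ∈ closure O) {C : V} (hC : ∀ x ∈ Ω ∩ O, g x = C)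
    (hd : ∀ᶠ x in 𝓝 x₀, fderiv ℝ g x = 0) : ∀ᶠ x in 𝓝 x₀, g x = C := by
  obtain ⟨r, hr, hball⟩ := Metric.eventually_nhds_iff_ball.1 (hd.and (hΩ.mem_nhds hx₀))
  obtain ⟨x₁, hx₁, hx₁O⟩ := mem_closure_iff.1 hxO _ Metric.isOpen_ball (Metric.mem_ball_self hr)
  filter_upwards [Metric.ball_mem_nhds x₀ hr] with x hx
  rw [← hC x₁ ⟨(hball _ hx₁).2, hx₁O⟩]
  exact Metric.isOpen_ball.is_const_of_fderiv_eq_zero (convex_ball _ _).isPreconnected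
    (hg.mono fun y hy => (hball y hy).2) (fun y hy => (hball y hy).1) hx hx₁

namespace LocalSurf

variable {F N : E2 → R41} {Ω : Set E2} {a b : ℝ}

variable (S : LocalSurf F N Ω a b)
include S

/-- If both `h 0 - h 3` and `h 0 + h 3` vanished, the null vector `h = f + ν` would be zero,
contradicting `⟨h, f⟩ = -1`. -/
lemma exists_sign {x : E2} (hx : x ∈ Ω) : ∃ s : ℝ, (s = 1 ∨ s = -1) ∧ lC s (hv F N x) ≠ 0 := by
  by_contra! h
  have h1 := h 1 (Or.inl rfl)
  have h2 := h (-1) (Or.inr rfl)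
  have hn := S.hv_null hx
  have hf : mink (hv F N x) (F x) = -1 := by
    have J := S.jet x hx
    simp [hv, mink_add_left, J.xx, mink_comm (N x), J.xn]
  rw [lC_apply, Complex.ofReal_eq_zero] at h1 h2
  generalize hv F N x = X at *
  simp only [mink] at hn hf
  have e0 : X 0 = 0 := by linarith
  have e3 : X 3 = 0 := by linarith
  rw [e0, e3] at hn hf
  have e1 : X 1 = 0 := by nlinarith [sq_nonneg (X 1), sq_nonneg (X 2)]
  have e2 : X 2 = 0 := by nlinarith [sq_nonneg (X 1), sq_nonneg (X 2)]
  rw [e1, e2] at hf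
  norm_num at hf

lemma exists_ball {x₀ : E2} (hx₀ : x₀ ∈ Ω) : ∃ s r : ℝ, (s = 1 ∨ s = -1) ∧ 0 < r ∧
    Metric.ball x₀ r ⊆ Ω ∧ ∀ x ∈ Metric.ball x₀ r, lC s (hv F N x) ≠ 0 := by
  obtain ⟨s, hs, hl⟩ := S.exists_sign hx₀
  have hc : ContinuousOn (fun x => lC s (hv F N x)) Ω :=
    (lC s).continuous.comp_continuousOn S.smh.continuousOn
  have ho : IsOpen (Ω ∩ (fun x => lC s (hv F N x)) ⁻¹' {0}ᶜ) :=
    hc.isOpen_inter_preimage S.isOpen isOpen_compl_singleton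
  obtain ⟨r, hr, hb⟩ := Metric.isOpen_iff.1 ho x₀ ⟨hx₀, hl⟩
  exact ⟨s, r, hs, hr, fun x hx => (hb hx).1, fun x hx => (hb hx).2⟩

/-- A surface satisfying an elliptic relation which is horospherical near some points accumulating
at `x₀` is horospherical near `x₀`. -/
theorem hv_eventually_const (hab : a + 2 * b ≠ 0) {x₀ : E2} (hx₀ : x₀ ∈ Ω) {O : Set E2}
    (hO : IsOpen O) (hxO : x₀ ∈ closure O) {C : R41} (hC : ∀ x ∈ Ω ∩ O, hv F N x = C) :
    ∀ᶠ x in 𝓝 x₀, hv F N x = C := by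
  have hd0 := fderiv_eq_zero_of_closure S.isOpen S.smh hx₀ hO hxO hC
  obtain ⟨s, r, hs, hr, hsub, hl⟩ := S.exists_ball hx₀
  set B := Metric.ball x₀ r with hB
  have hxB : x₀ ∈ B := Metric.mem_ball_self hr
  have hBo : IsOpen B := Metric.isOpen_ball
  have S' := S.mono hBo hsub
  have hom := S'.sm_om s
  -- Poincaré lemma on a ball: the closed form `ω` has a primitive `z`.
  obtain ⟨z, hz⟩ := (convex_ball x₀ r).exists_forall_hasFDerivAt_of_fderiv_symmetric hBo
    (hom.differentiableOn (by simp)) (fun x hx u v => S'.om_closed s hx u v)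
  have hzf : ∀ x ∈ B, fderiv ℝ z x = om s F N a b x := fun x hx => (hz x hx).fderiv
  have hzs : ContDiffOn ℝ ∞ z B := by
    rw [contDiffOn_infty_iff_fderiv_of_isOpen hBo]
    exact ⟨fun x hx => (hz x hx).differentiableAt.differentiableWithinAt,
      hom.congr hzf⟩
  -- At `x₀` one has `dN = -dF`, hence `dy = -(a + 2b) dF`, which is injective. So `z` is a complex
  -- coordinate near `x₀`, and `dg ∧ dz = 0` makes the Gauss map holomorphic in it.
  have hinj : Function.Injective (fderiv ℝ z x₀) := by
    rw [hzf x₀ hxB, injective_iff_map_eq_zero]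
    intro v hv0
    rw [om_apply] at hv0
    have h1 := eq_zero_of_wf hs (S.jet x₀ hx₀).xx (S.hv_null hx₀) (S.dyv_perp hx₀ v).1
      (S.dyv_perp hx₀ v).2 (hl x₀ hxB) hv0
    rw [S.fderiv_yv hx₀] at h1
    have h2 : fderiv ℝ F x₀ v + fderiv ℝ N x₀ v = 0 := by
      rw [← S.fderiv_hv hx₀, hd0]; rfl
    have h3 : (a + 2 * b) • fderiv ℝ F x₀ v = 0 := by
      rw [eq_neg_of_add_eq_zero_right h2] at h1
      rw [← neg_eq_zero, ← h1]; module
    have h4 := (smul_eq_zero.1 h3).resolve_left hab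
    rw [h4, zero_add] at h2
    exact (S.reg x₀ hx₀).imm h4 h2
  have hG := eventually_eq_of_holomorphic (z := z) (k := gm s F N) (c := mbC C / lC s C) hBo hxB hzs
    ((S'.sm_gm hl).differentiableOn (by simp)) hinj
    (fun x hx v w => by
      rw [S'.fderiv_gm hx (hl x hx), S'.fderiv_gm hx (hl x hx), hzf x hx, div_mul_eq_mul_div,
        S'.wb_mul_om hs hx, div_mul_eq_mul_div])
    hO hxO (fun x hx => by rw [gm, hC x ⟨hsub hx.1, hx.2⟩])
  refine eventually_eq_of_fderiv_eq_zero S.isOpen (S.smh.differentiableOn (by simp)) hx₀ hxO hC ?_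
  filter_upwards [hG.eventually_nhds, hBo.mem_nhds hxB] with x hx hxB'
  have hxΩ := hsub hxB'
  have h0 : fderiv ℝ (gm s F N) x = 0 := by
    rw [Filter.EventuallyEq.fderiv_eq hx]; simp
  ext1 v
  have h1 := S'.fderiv_gm hxB' (hl x hxB') v
  rw [h0] at h1
  have h2 : wb s (hv F N x) (fderiv ℝ (hv F N) x v) = 0 := by
    have := (div_eq_zero_iff.1 h1.symm).resolve_right (pow_ne_zero 2 (hl x hxB'))
    exact this
  exact eq_zero_of_wb hs (S.jet x hxΩ).xx (S.hv_null hxΩ) (S.dhv_perp hxΩ v).1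
      (S.dhv_perp hxΩ v).2 (hl x hxB') h2

/-- A surface satisfying an elliptic relation which is parallel to a point or a totally geodesic
plane near some points accumulating at `x₀` is so near `x₀`. -/
theorem yv_eventually_const (hab : a + 2 * b ≠ 0) {x₀ : E2} (hx₀ : x₀ ∈ Ω) {O : Set E2}
    (hO : IsOpen O) (hxO : x₀ ∈ closure O) {C : R41} (hC : ∀ x ∈ Ω ∩ O, yv F N a b x = C) :
    ∀ᶠ x in 𝓝 x₀, yv F N a b x = C := by
  have hd0 := fderiv_eq_zero_of_closure S.isOpen S.smy hx₀ hO hxO hC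
  obtain ⟨s, r, hs, hr, hsub, hl⟩ := S.exists_ball hx₀
  have S₁ := S.mono Metric.isOpen_ball hsub
  -- The roles are exchanged: since `dy = 0` at `x₀`, the Gauss map `g` is the complex coordinate,
  -- and the function to be continued is the quotient `ω / dg`.
  have hinj : Function.Injective (fderiv ℝ (gm s F N) x₀) := by
    have hxB := Metric.mem_ball_self (x := x₀) hr
    rw [injective_iff_map_eq_zero]
    intro v hv0
    rw [S₁.fderiv_gm hxB (hl x₀ hxB)] at hv0
    have h1 := eq_zero_of_wb hs (S.jet x₀ hx₀).xx (S.hv_null hx₀) (S.dhv_perp hx₀ v).1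
      (S.dhv_perp hx₀ v).2 (hl x₀ hxB)
      ((div_eq_zero_iff.1 hv0).resolve_right (pow_ne_zero 2 (hl x₀ hxB)))
    rw [S.fderiv_hv hx₀] at h1
    have h2 : -(a + b) • fderiv ℝ F x₀ v + b • fderiv ℝ N x₀ v = 0 := by
      rw [← S.fderiv_yv hx₀, hd0]; rfl
    have h3 : (a + 2 * b) • fderiv ℝ F x₀ v = 0 := by
      rw [eq_neg_of_add_eq_zero_right h1] at h2
      rw [← neg_eq_zero, ← h2]; module
    have h4 := (smul_eq_zero.1 h3).resolve_left hab
    rw [h4, zero_add] at h1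
    exact (S.reg x₀ hx₀).imm h4 h1
  have hg₁ := S₁.sm_gm hl
  have hdg₁ := hg₁.fderiv_of_isOpen Metric.isOpen_ball (m := ∞) (by simp)
  have hne0 : fderiv ℝ (gm s F N) x₀ e0 ≠ 0 := by
    intro h
    have h1 := hinj (h.trans (map_zero _).symm)
    simpa [e0] using congrArg (· 0) h1
  -- Where `∂₀ g ≠ 0`, the condition `dg ∧ ω = 0` gives `ω = μ dg` with a smooth factor `μ`.
  set B := Metric.ball x₀ r ∩ (fun x => fderiv ℝ (gm s F N) x e0) ⁻¹' {0}ᶜ with hB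
  have hBo : IsOpen B :=
    (hdg₁.clm_apply contDiffOn_const).continuousOn.isOpen_inter_preimage Metric.isOpen_ball
      isOpen_compl_singleton
  have hxB : x₀ ∈ B := ⟨Metric.mem_ball_self hr, hne0⟩
  have hBb : B ⊆ Metric.ball x₀ r := Set.inter_subset_left
  have hsub' : B ⊆ Ω := hBb.trans hsub
  have S' := S.mono hBo hsub'
  have hl' : ∀ x ∈ B, lC s (hv F N x) ≠ 0 := fun x hx => hl x (hBb hx)
  have hg := S'.sm_gm hl'
  have hdg := hdg₁.mono hBb
  have hne : ∀ x ∈ B, fderiv ℝ (gm s F N) x e0 ≠ 0 := fun x hx => hx.2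
  have hom := S'.sm_om s
  set μ : E2 → ℂ := fun x => om s F N a b x e0 * (fderiv ℝ (gm s F N) x e0)⁻¹ with hμ
  have hμs : ContDiffOn ℝ ∞ μ B :=
    (hom.clm_apply contDiffOn_const).mul ((hdg.clm_apply contDiffOn_const).inv hne)
  have hker : ∀ x ∈ B, ∀ v w, fderiv ℝ (gm s F N) x v * om s F N a b x w
      = fderiv ℝ (gm s F N) x w * om s F N a b x v := fun x hx v w => by
    rw [S'.fderiv_gm hx (hl' x hx), S'.fderiv_gm hx (hl' x hx), div_mul_eq_mul_div,
        S'.wb_mul_om hs hx, div_mul_eq_mul_div]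
  have hμo : ∀ x ∈ B, ∀ v, om s F N a b x v = μ x * fderiv ℝ (gm s F N) x v := fun x hx v => by
    have := hker x hx e0 v
    have h0 := hne x hx
    rw [hμ]
    field_simp
    linear_combination this
  have hdμ : ∀ x ∈ B, ∀ u v, fderiv ℝ (om s F N a b) x u v
      = fderiv ℝ μ x u * fderiv ℝ (gm s F N) x v
        + μ x * fderiv ℝ (fderiv ℝ (gm s F N)) x u v := by
    intro x hx u v
    have hnx := hBo.mem_nhds hx
    have h1 : HasFDerivAt (fun x => om s F N a b x v) ((fderiv ℝ (om s F N a b) x).flip v) x := by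
      simpa using ((hom.contDiffAt hnx).differentiableAt (by simp)).hasFDerivAt.clm_apply
        (hasFDerivAt_const v x)
    have h2 : HasFDerivAt (fun x => fderiv ℝ (gm s F N) x v)
        ((fderiv ℝ (fderiv ℝ (gm s F N)) x).flip v) x := by
      simpa using ((hdg.contDiffAt hnx).differentiableAt (by simp)).hasFDerivAt.clm_apply
        (hasFDerivAt_const v x)
    have h3 := ((hμs.contDiffAt hnx).differentiableAt (by simp)).hasFDerivAt.mul h2
    have h4 : (fun x => om s F N a b x v) =ᶠ[𝓝 x] μ * fun x => fderiv ℝ (gm s F N) x v := by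
      filter_upwards [hnx] with y hy using hμo y hy v
    have h5 := congrArg (· u) ((h3.congr_of_eventuallyEq h4).unique h1)
    simp at h5
    rw [← h5]; ring
  -- Since `μ dg` is closed, `dμ ∧ dg = 0`, so `μ` is holomorphic in the coordinate `g`; it vanishes
  -- on `O` because `dy` does.
  have hzero : ∀ᶠ x in 𝓝 x₀, μ x = 0 := by
    refine eventually_eq_of_holomorphic (z := gm s F N) hBo hxB hg
      (hμs.differentiableOn (by simp)) hinj (fun x hx v w => ?_) hO hxO (fun x hx => ?_)
    · have h1 := hdμ x hx v w
      have h2 := hdμ x hx w v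
      have h3 := S'.om_closed s hx v w
      have h4 : IsSymmSndFDerivAt ℝ (gm s F N) x :=
        (hg.contDiffAt (hBo.mem_nhds hx)).isSymmSndFDerivAt (by simp; exact two_le_infty)
      have h5 := h4.eq v w
      rw [h5] at h1
      linear_combination h3 - h1 + h2
    · have h1 : fderiv ℝ (yv F N a b) x = 0 :=
        fderiv_eq_zero_of_closure S.isOpen S.smy (hsub' hx.1) hO (subset_closure hx.2) hC
      have h2 : om s F N a b x e0 = 0 := by
        rw [om_apply, h1]
        simp [wf]
      simp [hμ, h2]
  refine eventually_eq_of_fderiv_eq_zero S.isOpen (S.smy.differentiableOn (by simp)) hx₀ hxO hC ?_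
  filter_upwards [hzero, hBo.mem_nhds hxB] with x hx hxB'
  have hxΩ := hsub' hxB'
  ext1 v
  have h2 : wf s (hv F N x) (fderiv ℝ (yv F N a b) x v) = 0 := by
    rw [← om_apply, hμo x hxB', hx, zero_mul]
  exact eq_zero_of_wf hs (S.jet x hxΩ).xx (S.hv_null hxΩ) (S.dyv_perp hxΩ v).1
      (S.dyv_perp hxΩ v).2 (hl' x hxB') h2

end LocalSurf

/-! ## The Gauss equation -/

lemma HasFDerivAt.mink {G H : E2 → R41} {G' H' : E2 →L[ℝ] R41} {x : E2} (hG : HasFDerivAt G G' x)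
    (hH : HasFDerivAt H H' x) : ∃ L : E2 →L[ℝ] ℝ,
      HasFDerivAt (fun y => HypFront.mink (G y) (H y)) L x ∧
      ∀ v, L v = HypFront.mink (G' v) (H x) + HypFront.mink (G x) (H' v) := by
  have h1 := fun i => hasFDerivAt_pi'.1 hG i
  have h2 := fun i => hasFDerivAt_pi'.1 hH i
  have e := ((((h1 0).mul (h2 0)).neg.add ((h1 1).mul (h2 1))).add ((h1 2).mul (h2 2))).add
    ((h1 3).mul (h2 3))
  refine ⟨_, e, fun v => ?_⟩
  simp [HypFront.mink]
  ring

lemma fderiv_mink {G H : E2 → R41} {x : E2} (hG : DifferentiableAt ℝ G x)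
    (hH : DifferentiableAt ℝ H x) (v : E2) :
    fderiv ℝ (fun y => mink (G y) (H y)) x v
      = mink (fderiv ℝ G x v) (H x) + mink (G x) (fderiv ℝ H x v) := by
  obtain ⟨L, h1, h2⟩ := HasFDerivAt.mink hG.hasFDerivAt hH.hasFDerivAt
  rw [h1.fderiv, h2]

lemma pd_mink {G H : E2 → R41} {x : E2} (hG : DifferentiableAt ℝ G x)
    (hH : DifferentiableAt ℝ H x) (k : Fin 2) :
    pd k (fun y => mink (G y) (H y)) x = mink (pd k G x) (H x) + mink (G x) (pd k H x) :=
  fderiv_mink hG hH _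

lemma pd_congr {V : Type*} [NormedAddCommGroup V] [NormedSpace ℝ V] {g h : E2 → V} {Ω : Set E2}
    (hΩ : IsOpen Ω) (H : Set.EqOn g h Ω) (k : Fin 2) : Set.EqOn (pd k g) (pd k h) Ω := by
  intro x hx
  have : g =ᶠ[𝓝 x] h := by filter_upwards [hΩ.mem_nhds hx] with y hy using H hy
  simp only [pd, this.fderiv_eq]

lemma pd_smooth {V : Type*} [NormedAddCommGroup V] [NormedSpace ℝ V] {g : E2 → V} {Ω : Set E2}
    (hΩ : IsOpen Ω) (hg : ContDiffOn ℝ ∞ g Ω) (k : Fin 2) : ContDiffOn ℝ ∞ (pd k g) Ω :=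
  (hg.fderiv_of_isOpen hΩ (by simp)).clm_apply contDiffOn_const

lemma pd_comm {V : Type*} [NormedAddCommGroup V] [NormedSpace ℝ V] {g : E2 → V} {Ω : Set E2}
    (hΩ : IsOpen Ω) (hg : ContDiffOn ℝ ∞ g Ω) (k l : Fin 2) {x : E2} (hx : x ∈ Ω) :
    pd k (pd l g) x = pd l (pd k g) x := by
  have h1 : ∀ i, HasFDerivAt (fun y => fderiv ℝ g y (EuclideanSpace.single i 1))
      ((fderiv ℝ (fderiv ℝ g) x).flip (EuclideanSpace.single i 1)) x := fun i => by
    simpa using (((hg.fderiv_of_isOpen hΩ (m := ∞) (by simp)).contDiffAt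
      (hΩ.mem_nhds hx)).differentiableAt (by simp)).hasFDerivAt.clm_apply
        (hasFDerivAt_const (EuclideanSpace.single i (1 : ℝ)) x)
  have h2 : IsSymmSndFDerivAt ℝ g x :=
    (hg.contDiffAt (hΩ.mem_nhds hx)).isSymmSndFDerivAt (by simp; exact two_le_infty)
  have h3 : ∀ k l, pd k (pd l g) x
      = fderiv ℝ (fderiv ℝ g) x (EuclideanSpace.single k 1) (EuclideanSpace.single l 1) := by
    intro k l
    rw [pd]
    have := (h1 l).fderiv
    unfold pd
    rw [this]; rfl
  rw [h3, h3, h2.eq]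

/-- The left side is the Gram determinant of `X, A e0, A e1` against `Y, A e0, A e1`. Only the
components of `X` and `Y` along `n` and `x` survive, the latter with a minus sign because `x` is
timelike. -/
lemma Jet.gram_three {x n : R41} {A B : E2 →L[ℝ] R41} (h : Jet x n A B)
    (hA : Function.Injective A) (X Y : R41) :
    mink X Y * (mink (A e0) (A e0) * mink (A e1) (A e1) - mink (A e0) (A e1) ^ 2)
      - (mink X (A e0) * (mink (A e0) Y * mink (A e1) (A e1) - mink (A e0) (A e1) * mink (A e1) Y)
        + mink X (A e1) * (mink (A e0) (A e0) * mink (A e1) Y - mink (A e0) (A e1) * mink (A e0) Y))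
    = (mink (A e0) (A e0) * mink (A e1) (A e1) - mink (A e0) (A e1) ^ 2)
      * (mink X n * mink Y n - mink X x * mink Y x) := by
  have h0 := h.injective_iff.1 hA
  have hnx : mink n x = 0 := by rw [mink_comm, h.xn]
  obtain ⟨p, q, hpq⟩ := exists_comb h.xx h.nn h.xn (h.Ax e0) (h.Ax e1)
    (X := X - mink X n • n + mink X x • x)
    (by simp [mink_add_left, mink_sub_left, mink_smul_left, hnx, h.xx]) (h.An e0) (h.An e1)
    (by simp [mink_add_left, mink_sub_left, mink_smul_left, h.xn, h.nn]) h0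
  have hX : X = p • A e0 + q • A e1 + mink X n • n - mink X x • x := by
    rw [← hpq]; abel
  have e : ∀ Z, mink X Z = p * mink (A e0) Z + q * mink (A e1) Z + mink X n * mink n Z
      - mink X x * mink x Z := by
    intro Z
    conv_lhs => rw [hX]
    simp only [mink_add_left, mink_sub_left, mink_smul_left]
  rw [e Y, e (A e0), e (A e1), mink_comm n (A e0), mink_comm n (A e1), mink_comm x (A e0),
    mink_comm x (A e1), h.An, h.An, h.Ax, h.Ax, mink_comm (A e1) (A e0), mink_comm n Y,
    mink_comm x Y]
  ring

/-- In Brioschi's formula the third derivatives of `F` cancel. What remains is a difference of two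
Gram determinants, of `F_uu` against `F_vv` and of `F_uv` against itself, both evaluated by
`Jet.gram_three`. Their components along `F` are minus the first fundamental form, which produces
the curvature `-1` of the ambient space. -/
theorem coordGaussCurv_eq {F N : E2 → R41} {Ω : Set E2} (hΩ : IsOpen Ω)
    (hF : ContDiffOn ℝ ∞ F Ω) (hN : ContDiffOn ℝ ∞ N Ω)
    (hJ : ∀ x ∈ Ω, Jet (F x) (N x) (fderiv ℝ F x) (fderiv ℝ N x)) {x : E2} (hx : x ∈ Ω)
    (hinj : Function.Injective (fderiv ℝ F x)) :
    coordGaussCurv F x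
      = (fundII F N 0 0 x * fundII F N 1 1 x - fundII F N 0 1 x ^ 2
          - (fundI F 0 0 x * fundI F 1 1 x - fundI F 0 1 x ^ 2))
        / (fundI F 0 0 x * fundI F 1 1 x - fundI F 0 1 x ^ 2) := by
  have hd : ∀ {V : Type} [NormedAddCommGroup V] [NormedSpace ℝ V] {g : E2 → V},
      ContDiffOn ℝ ∞ g Ω → ∀ y ∈ Ω, DifferentiableAt ℝ g y := fun hg y hy =>
    (hg.contDiffAt (hΩ.mem_nhds hy)).differentiableAt (by simp)
  have s1 : ∀ i, ContDiffOn ℝ ∞ (pd i F) Ω := fun i => pd_smooth hΩ hF i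
  have s2 : ∀ i j, ContDiffOn ℝ ∞ (pd i (pd j F)) Ω := fun i j => pd_smooth hΩ (s1 j) i
  have d1 : ∀ i j k, ∀ y ∈ Ω, pd k (fundI F i j) y
      = mink (pd k (pd i F) y) (pd j F y) + mink (pd i F y) (pd k (pd j F) y) :=
    fun i j k y hy => pd_mink (hd (s1 i) y hy) (hd (s1 j) y hy) k
  have d2 : ∀ i j k l, pd l (pd k (fundI F i j)) x
      = mink (pd l (pd k (pd i F)) x) (pd j F x) + mink (pd k (pd i F) x) (pd l (pd j F) x)
        + (mink (pd l (pd i F) x) (pd k (pd j F) x)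
          + mink (pd i F x) (pd l (pd k (pd j F)) x)) := by
    intro i j k l
    rw [pd_congr hΩ (fun y hy => d1 i j k y hy) l hx]
    rw [← pd_mink (hd (s2 k i) x hx) (hd (s1 j) x hx), ← pd_mink (hd (s1 i) x hx) (hd (s2 k j) x hx)]
    have hm : ∀ {G H : E2 → R41}, DifferentiableAt ℝ G x → DifferentiableAt ℝ H x →
        DifferentiableAt ℝ (fun y => mink (G y) (H y)) x := fun hG hH =>
      (HasFDerivAt.mink hG.hasFDerivAt hH.hasFDerivAt).choose_spec.1.differentiableAt
    have := fderiv_add (hm (hd (s2 k i) x hx) (hd (s1 j) x hx))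
      (hm (hd (s1 i) x hx) (hd (s2 k j) x hx))
    exact congrArg (· (EuclideanSpace.single l 1)) this
  have c1 : ∀ y ∈ Ω, pd 0 (pd 1 F) y = pd 1 (pd 0 F) y := fun y hy => pd_comm hΩ hF 0 1 hy
  have c2 : pd 1 (pd 1 (pd 0 F)) x = pd 0 (pd 1 (pd 1 F)) x := by
    rw [← pd_congr hΩ (fun y hy => c1 y hy) 1 hx, pd_comm hΩ (s1 1) 1 0 hx]
  have c3 : pd 0 (pd 0 (pd 1 F)) x = pd 0 (pd 1 (pd 0 F)) x :=
    pd_congr hΩ (fun y hy => c1 y hy) 0 hx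
  have hFx : ∀ i k, mink (pd k (pd i F) x) (F x) = -mink (pd i F x) (pd k F x) := by
    intro i k
    have h1 := pd_mink (hd (s1 i) x hx) (hd hF x hx) k
    have h2 : Set.EqOn (fun y => mink (pd i F y) (F y)) (fun _ => (0 : ℝ)) Ω :=
      fun y hy => (hJ y hy).Ax _
    rw [pd_congr hΩ h2 k hx] at h1
    simp [pd] at h1 ⊢
    linarith
  have hNx : ∀ i k, fundII F N i k x = mink (pd k (pd i F) x) (N x) := by
    intro i k
    have h1 := pd_mink (hd (s1 i) x hx) (hd hN x hx) k
    have h2 : Set.EqOn (fun y => mink (pd i F y) (N y)) (fun _ => (0 : ℝ)) Ω :=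
      fun y hy => (hJ y hy).An _
    rw [pd_congr hΩ h2 k hx] at h1
    simp [pd, fundII] at h1 ⊢
    linarith
  have J := hJ x hx
  have hD := J.gram_pos hinj
  have g1 := J.gram_three hinj (pd 0 (pd 0 F) x) (pd 1 (pd 1 F) x)
  have g2 := J.gram_three hinj (pd 1 (pd 0 F) x) (pd 1 (pd 0 F) x)
  rw [hFx, hFx, ← hNx, ← hNx] at g1
  rw [hFx, ← hNx] at g2
  have a0 : fderiv ℝ F x e0 = pd 0 F x := rfl
  have a1 : fderiv ℝ F x e1 = pd 1 F x := rfl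
  rw [a0, a1] at g1 g2 hD
  have hI : ∀ i j, fundI F i j x = mink (pd i F x) (pd j F x) := fun i j => rfl
  simp only [coordGaussCurv, metricGaussCurv, Matrix.det_fin_three, Matrix.of_apply,
    Matrix.cons_val, d2]
  simp only [d1 _ _ _ x hx, c1 x hx, c2, c3]
  simp only [hI]
  rw [mink_comm (pd 0 F x) (pd 0 (pd 1 (pd 1 F)) x), mink_comm (pd 1 F x) (pd 0 (pd 1 (pd 0 F)) x)]
  simp only [mink_comm (pd 0 F x) (pd 1 (pd 0 F) x), mink_comm (pd 1 F x) (pd 1 (pd 0 F) x),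
    mink_comm (pd 0 F x) (pd 0 (pd 0 F) x),
    mink_comm (pd 0 F x) (pd 1 (pd 1 F) x), mink_comm (pd 1 F x) (pd 1 (pd 1 F) x)] at g1 g2 ⊢
  rw [div_eq_div_iff (pow_ne_zero 2 hD.ne') hD.ne']
  linear_combination (mink (pd 0 F x) (pd 0 F x) * mink (pd 1 F x) (pd 1 F x)
    - mink (pd 0 F x) (pd 1 F x) ^ 2) * (g1 - g2)

/-! ## Surfaces with constant principal curvatures -/

lemma coord_rel_iff {F N : E2 → R41} {Ω : Set E2} (hΩ : IsOpen Ω)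
    (hF : ContDiffOn ℝ ∞ F Ω) (hN : ContDiffOn ℝ ∞ N Ω)
    (hJ : ∀ x ∈ Ω, Jet (F x) (N x) (fderiv ℝ F x) (fderiv ℝ N x)) {x : E2} (hx : x ∈ Ω)
    (hinj : Function.Injective (fderiv ℝ F x)) (a b : ℝ) :
    a * (coordMeanCurv F N x - 1) + b * coordGaussCurv F x = 0
      ↔ Rel (F x) (N x) (fderiv ℝ F x) (fderiv ℝ N x) a b := by
  rw [coordGaussCurv_eq hΩ hF hN hJ hx hinj]
  exact (hJ x hx).rel_iff hinj a b

/-! ### Curves of constant Lorentz product, and the rank-one factors of a surface with constant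
principal curvatures. -/

lemma hasDerivAt_mink {γ η : ℝ → R41} {γ' η' : R41} {t : ℝ} (h : HasDerivAt γ γ' t)
    (h' : HasDerivAt η η' t) :
    HasDerivAt (fun t => mink (γ t) (η t)) (mink γ' (η t) + mink (γ t) η') t := by
  have h1 := fun i => hasDerivAt_pi.1 h i
  have h2 := fun i => hasDerivAt_pi.1 h' i
  have e := ((((h1 0).mul (h2 0)).neg.add ((h1 1).mul (h2 1))).add ((h1 2).mul (h2 2))).add
    ((h1 3).mul (h2 3))
  refine e.congr_deriv ?_
  simp [mink]
  ring

lemma mink_deriv_of_const {γ : ℝ → R41} {I : Set ℝ} (hI : IsOpen I) (hγ : ContDiffOn ℝ ∞ γ I)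
    {v : R41} {c : ℝ} (h : ∀ t ∈ I, mink v (γ t) = c) : ∀ t ∈ I, mink v (deriv γ t) = 0 := by
  intro t ht
  have hd := ((hγ.contDiffAt (hI.mem_nhds ht)).differentiableAt (by simp)).hasDerivAt
  have h1 := hasDerivAt_mink (hasDerivAt_const t v) hd
  have h2 : (fun t => mink v (γ t)) =ᶠ[𝓝 t] fun _ => c := by
    filter_upwards [hI.mem_nhds ht] with s hs using h s hs
  have := h1.unique ((hasDerivAt_const t c).congr_of_eventuallyEq h2)
  simpa [mink_zero_left] using this

lemma mink_self_deriv_of_const {γ : ℝ → R41} {I : Set ℝ} (hI : IsOpen I)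
    (hγ : ContDiffOn ℝ ∞ γ I) {c : ℝ} (h : ∀ t ∈ I, mink (γ t) (γ t) = c) :
    ∀ t ∈ I, mink (γ t) (deriv (deriv γ) t) = -mink (deriv γ t) (deriv γ t) := by
  have hγ' : ContDiffOn ℝ ∞ (deriv γ) I := hγ.deriv_of_isOpen hI (by simp)
  have hd : ∀ t ∈ I, HasDerivAt γ (deriv γ t) t := fun t ht =>
    ((hγ.contDiffAt (hI.mem_nhds ht)).differentiableAt (by simp)).hasDerivAt
  have hd' : ∀ t ∈ I, HasDerivAt (deriv γ) (deriv (deriv γ) t) t := fun t ht =>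
    ((hγ'.contDiffAt (hI.mem_nhds ht)).differentiableAt (by simp)).hasDerivAt
  have e1 : ∀ t ∈ I, mink (γ t) (deriv γ t) = 0 := by
    intro t ht
    have h1 := hasDerivAt_mink (hd t ht) (hd t ht)
    have h2 : (fun t => mink (γ t) (γ t)) =ᶠ[𝓝 t] fun _ => c := by
      filter_upwards [hI.mem_nhds ht] with s hs using h s hs
    have := h1.unique ((hasDerivAt_const t c).congr_of_eventuallyEq h2)
    rw [mink_comm (deriv γ t)] at this
    linarith
  intro t ht
  have h1 := hasDerivAt_mink (hd t ht) (hd' t ht)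
  have h2 : (fun t => mink (γ t) (deriv γ t)) =ᶠ[𝓝 t] fun _ => 0 := by
    filter_upwards [hI.mem_nhds ht] with s hs using e1 s hs
  have := h1.unique ((hasDerivAt_const t (0 : ℝ)).congr_of_eventuallyEq h2)
  linarith

/-- Since `k` is a root of the characteristic polynomial, `B + k A` has rank at most one; a
coordinate not identically zero on its image detects its kernel. -/
lemma Jet.comb_eq_zero_of_coord {x n : R41} {A B : E2 →L[ℝ] R41} (h : Jet x n A B)
    {H K k : ℝ}
    (hH : meanForm x n A B e0 e1 = H * areaForm x n A e0 e1)
    (hK : areaForm x n B e0 e1 = K * areaForm x n A e0 e1) (hk : k ^ 2 - 2 * H * k + K = 0)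
    {v w : E2} {i : Fin 4} (hv : (B v + k • A v) i ≠ 0) (hw : (B w + k • A w) i = 0) :
    B w + k • A w = 0 := by
  have perp : ∀ v, mink (B v + k • A v) x = 0 ∧ mink (B v + k • A v) n = 0 := fun v => by
    simp [mink_add_left, mink_smul_left, h.Ax, h.Bx, h.An, h.Bn]
  have hvol : vol (B v + k • A v) (B w + k • A w) x n = 0 := by
    have h1 := areaForm_eq x n A v w
    have h2 := areaForm_eq x n B v w
    have h3 := meanForm_eq x n A B v w
    rw [hH] at h3
    rw [hK] at h2
    simp only [areaForm, meanForm] at h1 h2 h3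
    simp only [vol_add_left, vol_add_right, vol_smul_left, vol_smul_right]
    linear_combination h2 - 2 * k * h3 + k ^ 2 * h1
      + (v 0 * w 1 - v 1 * w 0) * vol (A e0) (A e1) x n * hk
  have pv := perp v
  have pw := perp w
  clear perp
  generalize B v + k • A v = V at *
  generalize B w + k • A w = W at *
  have hg := vol_mul_vol h.xx h.nn h.xn pv.1 pv.1 pw.1 pw.1 pv.2
    pv.2 pw.2 pw.2
  rw [hvol, mink_comm W V] at hg
  have hVV : mink V V ≠ 0 := by
    intro h0
    apply hv
    rw [eq_zero_of_mink_self_eq_zero h.xx pv.1 h0]; rfl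
  have hz : mink V V • W - mink V W • V = 0 := by
    apply eq_zero_of_mink_self_eq_zero h.xx
    · rw [mink_sub_left, mink_smul_left, mink_smul_left, pv.1, pw.1]; ring
    · simp only [mink_sub_left, mink_sub_right, mink_smul_left, mink_smul_right, mink_comm W V]
      linear_combination -mink V V * hg
  have hi := congrFun hz i
  simp only [Pi.sub_apply, Pi.smul_apply, smul_eq_mul, hw, mul_zero, zero_sub, Pi.zero_apply,
    neg_eq_zero, mul_eq_zero, hv, or_false] at hi
  rw [hi, zero_smul, sub_zero] at hz
  exact (smul_eq_zero.1 hz).resolve_left hVV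

/-- A surface with constant principal curvatures is totally umbilic or flat. -/
theorem gaussKronecker_eq_sq {F N : E2 → R41} {Ω : Set E2} (hΩ : IsOpen Ω)
    (hF : ContDiffOn ℝ ∞ F Ω) (hN : ContDiffOn ℝ ∞ N Ω)
    (hJ : ∀ x ∈ Ω, Jet (F x) (N x) (fderiv ℝ F x) (fderiv ℝ N x))
    (hinj : ∀ x ∈ Ω, Function.Injective (fderiv ℝ F x)) {H K : ℝ} (hK1 : K ≠ 1)
    (hH : ∀ x ∈ Ω, meanForm (F x) (N x) (fderiv ℝ F x) (fderiv ℝ N x) e0 e1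
      = H * areaForm (F x) (N x) (fderiv ℝ F x) e0 e1)
    (hK : ∀ x ∈ Ω, areaForm (F x) (N x) (fderiv ℝ N x) e0 e1
      = K * areaForm (F x) (N x) (fderiv ℝ F x) e0 e1) {x₀ : E2} (hx₀ : x₀ ∈ Ω) :
    K = H ^ 2 := by
  by_contra hne
  have hdF : ∀ x ∈ Ω, HasFDerivAt F (fderiv ℝ F x) x := fun x hx =>
    ((hF.contDiffAt (hΩ.mem_nhds hx)).differentiableAt (by simp)).hasFDerivAt
  have hdN : ∀ x ∈ Ω, HasFDerivAt N (fderiv ℝ N x) x := fun x hx =>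
    ((hN.contDiffAt (hΩ.mem_nhds hx)).differentiableAt (by simp)).hasFDerivAt
  have hCH := fun x hx => (hJ x hx).cayley_hamilton (hinj x hx) (hH x hx) (hK x hx)
  have hlt : K < H ^ 2 := lt_of_le_of_ne (hCH x₀ hx₀).1 hne
  obtain ⟨k₁, k₂, hk, hs, hp⟩ : ∃ k₁ k₂ : ℝ, k₁ ≠ k₂ ∧ k₁ + k₂ = 2 * H ∧ k₁ * k₂ = K := by
    have h1 : 0 < √(H ^ 2 - K) := Real.sqrt_pos.2 (by linarith)
    have h2 := Real.sq_sqrt (show 0 ≤ H ^ 2 - K by linarith)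
    refine ⟨H + √(H ^ 2 - K), H - √(H ^ 2 - K), by intro h; linarith, by ring, ?_⟩
    linear_combination -h2
  have hq : ∀ k, k = k₁ ∨ k = k₂ → k ^ 2 - 2 * H * k + K = 0 := by
    rintro k (rfl | rfl) <;> rw [← hs, ← hp] <;> ring
  -- For a constant principal curvature `k` the map `ν + k f` has a differential of rank one, so its
  -- image is a curve. One coordinate from each of the two curves gives local coordinates `(s, t)`
  -- on the surface.
  set y : ℝ → E2 → R41 := fun k x => N x + k • F x with hy
  have hys : ∀ k, ContDiffOn ℝ ∞ (y k) Ω := fun k => hN.add (hF.const_smul k)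
  have hyd : ∀ k, ∀ x ∈ Ω, HasFDerivAt (y k) (fderiv ℝ N x + k • fderiv ℝ F x) x := fun k x hx =>
    (hdN x hx).add ((hdF x hx).const_smul k)
  have hyf : ∀ k, ∀ x ∈ Ω, ∀ v, fderiv ℝ (y k) x v = fderiv ℝ N x v + k • fderiv ℝ F x v := by
    intro k x hx v; rw [(hyd k x hx).fderiv]; rfl
  have hcomp : ∀ k, k = k₁ ∨ k = k₂ → ∃ (v : E2) (i : Fin 4), fderiv ℝ (y k) x₀ v i ≠ 0 := by
    intro k hk'
    by_contra! h0
    have hB : ∀ v, fderiv ℝ N x₀ v = -k • fderiv ℝ F x₀ v := by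
      intro v
      have : fderiv ℝ (y k) x₀ v = 0 := funext fun i => h0 v i
      rw [hyf k x₀ hx₀] at this
      rw [eq_neg_of_add_eq_zero_left this, neg_smul]
    have h1 := hH x₀ hx₀
    have h2 := (hJ x₀ hx₀).injective_iff.1 (hinj x₀ hx₀)
    simp only [meanForm, hB, vol_smul_left, vol_smul_right] at h1
    rw [areaForm] at h1 h2
    have h3 : k = H := by
      apply mul_right_cancel₀ h2
      linear_combination h1
    rcases hk' with h | h
    · apply hk; linarith
    · apply hk; linarith
  obtain ⟨v₁, i₁, h₁⟩ := hcomp k₁ (Or.inl rfl)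
  obtain ⟨v₂, i₂, h₂⟩ := hcomp k₂ (Or.inr rfl)
  have hopen : ∀ k v i, IsOpen (Ω ∩ (fun x => fderiv ℝ (y k) x v i) ⁻¹' {0}ᶜ) := by
    intro k v i
    refine ContinuousOn.isOpen_inter_preimage ?_ hΩ isOpen_compl_singleton
    have := ((hys k).fderiv_of_isOpen hΩ (m := ∞) (by simp)).clm_apply (contDiffOn_const (c := v))
    exact (continuous_apply i).comp_continuousOn this.continuousOn
  set Ω' := (Ω ∩ (fun x => fderiv ℝ (y k₁) x v₁ i₁) ⁻¹' {0}ᶜ)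
    ∩ (Ω ∩ (fun x => fderiv ℝ (y k₂) x v₂ i₂) ⁻¹' {0}ᶜ) with hΩ'
  have hΩ'o : IsOpen Ω' := (hopen _ _ _).inter (hopen _ _ _)
  have hsub : Ω' ⊆ Ω := fun x hx => hx.1.1
  have hx₀' : x₀ ∈ Ω' := ⟨⟨hx₀, h₁⟩, ⟨hx₀, h₂⟩⟩
  set z : E2 → ℝ × ℝ := fun x => (y k₁ x i₁, y k₂ x i₂) with hz
  have hc : ∀ k i, ContDiffOn ℝ ∞ (fun x => y k x i) Ω := fun k i =>
    (ContinuousLinearMap.proj (R := ℝ) (φ := fun _ : Fin 4 => ℝ) i).contDiff.comp_contDiffOn (hys k)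
  have hzs : ContDiffOn ℝ ∞ z Ω' := ((hc k₁ i₁).prodMk (hc k₂ i₂)).mono hsub
  have hcd : ∀ k i, ∀ x ∈ Ω, HasFDerivAt (fun x => y k x i)
      ((ContinuousLinearMap.proj (R := ℝ) (φ := fun _ : Fin 4 => ℝ) i) ∘L fderiv ℝ (y k) x) x := by
    intro k i x hx
    have := ((hyd k x hx).differentiableAt).hasFDerivAt
    exact (ContinuousLinearMap.proj (R := ℝ) (φ := fun _ : Fin 4 => ℝ) i).hasFDerivAt.comp x this
  have hzf : ∀ x ∈ Ω', ∀ u, fderiv ℝ z x u = (fderiv ℝ (y k₁) x u i₁, fderiv ℝ (y k₂) x u i₂) := by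
    intro x hx u
    rw [((hcd k₁ i₁ x (hsub hx)).prodMk (hcd k₂ i₂ x (hsub hx))).fderiv]
    rfl
  have hker₁ : ∀ x ∈ Ω', ∀ w, fderiv ℝ (y k₁) x w i₁ = 0 → fderiv ℝ (y k₁) x w = 0 := by
    intro x hx w hw
    have hxΩ := hsub hx
    have hv : fderiv ℝ (y k₁) x v₁ i₁ ≠ 0 := hx.1.2
    rw [hyf k₁ x hxΩ] at hw hv ⊢
    exact (hJ x hxΩ).comb_eq_zero_of_coord (hH x hxΩ) (hK x hxΩ)
      (hq _ (Or.inl rfl)) hv hw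
  have hker₂ : ∀ x ∈ Ω', ∀ w, fderiv ℝ (y k₂) x w i₂ = 0 → fderiv ℝ (y k₂) x w = 0 := by
    intro x hx w hw
    have hxΩ := hsub hx
    have hv : fderiv ℝ (y k₂) x v₂ i₂ ≠ 0 := hx.2.2
    rw [hyf k₂ x hxΩ] at hw hv ⊢
    exact (hJ x hxΩ).comb_eq_zero_of_coord (hH x hxΩ) (hK x hxΩ)
      (hq _ (Or.inr rfl)) hv hw
  have hzinj : Function.Injective (fderiv ℝ z x₀) := by
    rw [injective_iff_map_eq_zero]
    intro u hu
    rw [hzf x₀ hx₀', Prod.mk_eq_zero] at hu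
    have e1 := hker₁ x₀ hx₀' u hu.1
    have e2 := hker₂ x₀ hx₀' u hu.2
    rw [hyf _ x₀ hx₀] at e1 e2
    apply hinj x₀ hx₀
    rw [map_zero]
    have e3 : (k₁ - k₂) • fderiv ℝ F x₀ u = 0 := by
      rw [← sub_self (0 : R41)]
      nth_rw 1 [← e1]
      rw [← e2]; module
    exact (smul_eq_zero.1 e3).resolve_left (sub_ne_zero.2 hk)
  obtain ⟨φ, hxφ, hφΩ, hφz, hsm, hl, hr⟩ :=
    exists_local_inverse (G := ℝ × ℝ) (by simp) hΩ'o hzs hx₀' hzinj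
  obtain ⟨⟨s₀, t₀⟩, hst⟩ : ∃ p : ℝ × ℝ, p = φ x₀ := ⟨_, rfl⟩
  obtain ⟨r, hr0, hball⟩ := Metric.isOpen_iff.1 φ.open_target _ (φ.map_source hxφ)
  rw [← hst] at hball
  rw [← ball_prod_same] at hball
  set I := Metric.ball s₀ r with hI
  set J := Metric.ball t₀ r with hJdef
  have hs₀ : s₀ ∈ I := Metric.mem_ball_self hr0
  have ht₀ : t₀ ∈ J := Metric.mem_ball_self hr0
  have hIo : IsOpen I := Metric.isOpen_ball
  have hJo : IsOpen J := Metric.isOpen_ball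
  have htgt : ∀ s ∈ I, ∀ t ∈ J, (s, t) ∈ φ.target := fun s hs t ht => hball ⟨hs, ht⟩
  have hmem : ∀ s ∈ I, ∀ t ∈ J, φ.symm (s, t) ∈ Ω' := fun s hs t ht =>
    hφΩ (φ.map_target (htgt s hs t ht))
  have hYd : ∀ k, ∀ s ∈ I, ∀ t ∈ J, HasFDerivAt (fun p => y k (φ.symm p))
      (fderiv ℝ (y k) (φ.symm (s, t)) ∘L fderiv ℝ φ.symm (s, t)) (s, t) := by
    intro k s hs t ht
    have h1 := ((hyd k _ (hsub (hmem s hs t ht))).differentiableAt).hasFDerivAt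
    have h2 := ((hsm.contDiffAt (φ.open_target.mem_nhds (htgt s hs t ht))).differentiableAt
      (by simp)).hasFDerivAt
    exact h1.comp _ h2
  have hsur : ∀ s ∈ I, ∀ t ∈ J, ∀ u, fderiv ℝ z (φ.symm (s, t)) (fderiv ℝ φ.symm (s, t) u) = u := by
    intro s hs t ht u
    have := hr _ (φ.map_target (htgt s hs t ht)) u
    rwa [φ.right_inv (htgt s hs t ht)] at this
  have hYt : ∀ k, ∀ s ∈ I, ∀ t ∈ J, HasDerivAt (fun t => y k (φ.symm (s, t)))
      (fderiv ℝ (y k) (φ.symm (s, t)) (fderiv ℝ φ.symm (s, t) (0, 1))) t := by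
    intro k s hs t ht
    have h1 : HasDerivAt (fun t : ℝ => (s, t)) (0, 1) t :=
      (hasDerivAt_const t s).prodMk (hasDerivAt_id t)
    exact (hYd k s hs t ht).comp_hasDerivAt t h1
  have hYs : ∀ k, ∀ s ∈ I, ∀ t ∈ J, HasDerivAt (fun s => y k (φ.symm (s, t)))
      (fderiv ℝ (y k) (φ.symm (s, t)) (fderiv ℝ φ.symm (s, t) (1, 0))) s := by
    intro k s hs t ht
    have h1 : HasDerivAt (fun s : ℝ => (s, t)) (1, 0) s :=
      (hasDerivAt_id s).prodMk (hasDerivAt_const s t)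
    exact (hYd k s hs t ht).comp_hasDerivAt s h1
  have hconst₁ : ∀ s ∈ I, ∀ t ∈ J, y k₁ (φ.symm (s, t)) = y k₁ (φ.symm (s, t₀)) := by
    intro s hs t ht
    refine hJo.is_const_of_deriv_eq_zero (convex_ball _ _).isPreconnected
      (fun t ht => (hYt k₁ s hs t ht).differentiableAt.differentiableWithinAt)
      (fun t ht => ?_) ht ht₀
    rw [(hYt k₁ s hs t ht).deriv]
    apply hker₁ _ (hmem s hs t ht)
    have := hsur s hs t ht (0, 1)
    rw [hzf _ (hmem s hs t ht)] at this
    exact congrArg Prod.fst this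
  have hconst₂ : ∀ s ∈ I, ∀ t ∈ J, y k₂ (φ.symm (s, t)) = y k₂ (φ.symm (s₀, t)) := by
    intro s hs t ht
    refine hIo.is_const_of_deriv_eq_zero (convex_ball _ _).isPreconnected
      (fun s hs => (hYs k₂ s hs t ht).differentiableAt.differentiableWithinAt)
      (fun s hs => ?_) hs hs₀
    rw [(hYs k₂ s hs t ht).deriv]
    apply hker₂ _ (hmem s hs t ht)
    have := hsur s hs t ht (1, 0)
    rw [hzf _ (hmem s hs t ht)] at this
    exact congrArg Prod.snd this
  have hyy : ∀ k l, ∀ x ∈ Ω, mink (y k x) (y l x) = 1 - k * l := by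
    intro k l x hx
    have j := hJ x hx
    simp only [hy, mink_add_left, mink_add_right, mink_smul_left, mink_smul_right, j.xx, j.nn, j.xn,
      mink_comm (N x) (F x)]
    ring
  set γ : ℝ → R41 := fun s => y k₁ (φ.symm (s, t₀)) with hγ
  set η : ℝ → R41 := fun t => y k₂ (φ.symm (s₀, t)) with hη
  have hγs : ContDiffOn ℝ ∞ γ I := by
    have h1 : ContDiffOn ℝ ∞ (fun s : ℝ => φ.symm (s, t₀)) I :=
      hsm.comp (contDiff_id.prodMk contDiff_const).contDiffOn fun s hs => htgt s hs t₀ ht₀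
    exact (hys k₁).comp h1 fun s hs => hsub (hmem s hs t₀ ht₀)
  have hηs : ContDiffOn ℝ ∞ η J := by
    have h1 : ContDiffOn ℝ ∞ (fun t : ℝ => φ.symm (s₀, t)) J :=
      hsm.comp (contDiff_const.prodMk contDiff_id).contDiffOn fun t ht => htgt s₀ hs₀ t ht
    exact (hys k₂).comp h1 fun t ht => hsub (hmem s₀ hs₀ t ht)
  have hγ's : ContDiffOn ℝ ∞ (deriv γ) I := hγs.deriv_of_isOpen hIo (by simp)
  have hη's : ContDiffOn ℝ ∞ (deriv η) J := hηs.deriv_of_isOpen hJo (by simp)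
  -- The product is constant although `s` and `t` vary independently, so all mixed derivatives of
  -- the two curves are orthogonal.
  have hγη : ∀ t ∈ J, ∀ s ∈ I, mink (η t) (γ s) = 1 - k₂ * k₁ := by
    intro t ht s hs
    rw [← hyy k₂ k₁ _ (hsub (hmem s hs t ht)), hconst₁ s hs t ht, hconst₂ s hs t ht]
  have d10 : ∀ t ∈ J, ∀ s ∈ I, mink (η t) (deriv γ s) = 0 := fun t ht =>
    mink_deriv_of_const hIo hγs (hγη t ht)
  have d20 : ∀ t ∈ J, ∀ s ∈ I, mink (η t) (deriv (deriv γ) s) = 0 := fun t ht =>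
    mink_deriv_of_const hIo hγ's (d10 t ht)
  have d01 : ∀ s ∈ I, ∀ t ∈ J, mink (γ s) (deriv η t) = 0 := fun s hs =>
    mink_deriv_of_const hJo hηs fun t ht => (mink_comm _ _).trans (hγη t ht s hs)
  have d02 : ∀ s ∈ I, ∀ t ∈ J, mink (γ s) (deriv (deriv η) t) = 0 := fun s hs =>
    mink_deriv_of_const hJo hη's (d01 s hs)
  have d11 : ∀ s ∈ I, ∀ t ∈ J, mink (deriv γ s) (deriv η t) = 0 := fun s hs =>
    mink_deriv_of_const hJo hηs fun t ht => (mink_comm _ _).trans (d10 t ht s hs)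
  have d12 : ∀ s ∈ I, ∀ t ∈ J, mink (deriv γ s) (deriv (deriv η) t) = 0 := fun s hs =>
    mink_deriv_of_const hJo hη's (d11 s hs)
  have d21 : ∀ s ∈ I, ∀ t ∈ J, mink (deriv (deriv γ) s) (deriv η t) = 0 := fun s hs =>
    mink_deriv_of_const hJo hηs fun t ht => (mink_comm _ _).trans (d20 t ht s hs)
  have d22 : ∀ s ∈ I, ∀ t ∈ J, mink (deriv (deriv γ) s) (deriv (deriv η) t) = 0 := fun s hs =>
    mink_deriv_of_const hJo hη's (d21 s hs)
  have n1 := mink_self_deriv_of_const hIo hγs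
    (fun s hs => hyy k₁ k₁ _ (hsub (hmem s hs t₀ ht₀))) s₀ hs₀
  have n2 := mink_self_deriv_of_const hJo hηs
    (fun t ht => hyy k₂ k₂ _ (hsub (hmem s₀ hs₀ t ht))) t₀ ht₀
  have hxp : φ.symm (s₀, t₀) = x₀ := by rw [hst, φ.left_inv hxφ]
  have j := hJ x₀ hx₀
  have hγ' := (hYs k₁ s₀ hs₀ t₀ ht₀).deriv
  have hη' := (hYt k₂ s₀ hs₀ t₀ ht₀).deriv
  rw [hxp] at hγ' hη'
  have perp : ∀ k u, mink (fderiv ℝ (y k) x₀ u) (F x₀) = 0 ∧ mink (fderiv ℝ (y k) x₀ u) (N x₀) = 0 :=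
    fun k u => by
      rw [hyf k x₀ hx₀]
      simp [mink_add_left, mink_smul_left, j.Ax, j.Bx, j.An, j.Bn]
  set U := deriv γ s₀ with hU
  set V := deriv η t₀ with hV
  have hUp : mink U (F x₀) = 0 ∧ mink U (N x₀) = 0 := by
    have := perp k₁ (fderiv ℝ φ.symm (s₀, t₀) (1, 0))
    rwa [← hγ'] at this
  have hVp : mink V (F x₀) = 0 ∧ mink V (N x₀) = 0 := by
    have := perp k₂ (fderiv ℝ φ.symm (s₀, t₀) (0, 1))
    rwa [← hη'] at this
  have hUU : mink U U ≠ 0 := by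
    intro h0
    have h1 := eq_zero_of_mink_self_eq_zero j.xx hUp.1 h0
    have h2 := hsur s₀ hs₀ t₀ ht₀ (1, 0)
    rw [hxp, hzf x₀ hx₀'] at h2
    have h3 := congrArg Prod.fst h2
    have h4 : fderiv ℝ (y k₁) x₀ (fderiv ℝ φ.symm (s₀, t₀) (1, 0)) = 0 := hγ'.symm.trans h1
    simp only [h4] at h3
    simp at h3
  have hVV : mink V V ≠ 0 := by
    intro h0
    have h1 := eq_zero_of_mink_self_eq_zero j.xx hVp.1 h0
    have h2 := hsur s₀ hs₀ t₀ ht₀ (0, 1)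
    rw [hxp, hzf x₀ hx₀'] at h2
    have h3 := congrArg Prod.snd h2
    have h4 : fderiv ℝ (y k₂) x₀ (fderiv ℝ φ.symm (s₀, t₀) (0, 1)) = 0 := hη'.symm.trans h1
    simp only [h4] at h3
    simp at h3
  have hUV : mink U V = 0 := d11 s₀ hs₀ t₀ ht₀
  have hvol : vol U V (F x₀) (N x₀) ≠ 0 := by
    intro h0
    have := vol_mul_vol j.xx j.nn j.xn hUp.1 hUp.1 hVp.1 hVp.1 hUp.2 hUp.2 hVp.2 hVp.2
    rw [h0, hUV, mink_comm V U, hUV] at this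
    have h3 : mink U U * mink V V = 0 := by linarith
    exact (mul_ne_zero hUU hVV) h3
  have hγ0 : γ s₀ = N x₀ + k₁ • F x₀ := by simp only [hγ, hy, hxp]
  have hη0 : η t₀ = N x₀ + k₂ • F x₀ := by simp only [hη, hy, hxp]
  set X := deriv (deriv γ) s₀ with hX
  set Y := deriv (deriv η) t₀ with hY
  have hnx : mink (N x₀) (F x₀) = 0 := by rw [mink_comm, j.xn]
  -- `γ''` is expanded in the frame `U, V, N, F`. Pairing with `V` kills `β`, and pairing with
  -- `η''`, which is orthogonal to both `U` and `γ''`, leaves only the `N` and `F` components. As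
  -- these are related by `k₂` and `k₁`, the outcome is `k₁ k₂ = 1`.
  obtain ⟨α, β, hαβ⟩ := exists_comb j.xx j.nn j.xn hUp.1 hVp.1
    (X := X - mink X (N x₀) • N x₀ + mink X (F x₀) • F x₀)
    (by simp [mink_add_left, mink_sub_left, mink_smul_left, hnx, j.xx]) hUp.2 hVp.2
    (by simp [mink_add_left, mink_sub_left, mink_smul_left, j.xn, j.nn]) hvol
  have hXe : ∀ Z, mink X Z = α * mink U Z + β * mink V Z + mink X (N x₀) * mink (N x₀) Z
      - mink X (F x₀) * mink (F x₀) Z := by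
    intro Z
    have : X = α • U + β • V + mink X (N x₀) • N x₀ - mink X (F x₀) • F x₀ := by
      rw [← hαβ]; abel
    conv_lhs => rw [this]
    simp only [mink_add_left, mink_sub_left, mink_smul_left]
  have b1 := hXe V
  rw [d21 s₀ hs₀ t₀ ht₀, hUV, mink_comm (N x₀) V, mink_comm (F x₀) V, hVp.1, hVp.2] at b1
  have hβ : β = 0 := by
    have : β * mink V V = 0 := by linarith
    exact (mul_eq_zero.1 this).resolve_right hVV
  have b2 := hXe Y
  rw [d22 s₀ hs₀ t₀ ht₀, hβ, d12 s₀ hs₀ t₀ ht₀, mink_comm (N x₀) Y, mink_comm (F x₀) Y] at b2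
  have b3 := d20 t₀ ht₀ s₀ hs₀
  have b4 := d02 s₀ hs₀ t₀ ht₀
  rw [hη0, mink_comm, mink_add_right, mink_smul_right] at b3
  rw [hγ0, mink_comm, mink_add_right, mink_smul_right] at b4
  rw [hγ0, mink_comm, mink_add_right, mink_smul_right] at n1
  rw [hη0, mink_comm, mink_add_right, mink_smul_right] at n2
  -- If it vanished, `X` would be orthogonal to `γ` as well, whereas `⟨γ, γ''⟩ = -⟨γ', γ'⟩ ≠ 0`.
  have hXF : mink X (F x₀) ≠ 0 := by
    intro h0
    rw [h0] at b3 n1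
    apply hUU; linarith
  have hYF : mink Y (F x₀) ≠ 0 := by
    intro h0
    rw [h0] at b4 n2
    apply hVV; linarith
  apply hK1
  have h0 : mink X (F x₀) * mink Y (F x₀) ≠ 0 := mul_ne_zero hXF hYF
  apply mul_right_cancel₀ h0
  rw [← hp]
  have e3 : mink X (N x₀) = -(k₂ * mink X (F x₀)) := by linarith
  have e4 : mink Y (N x₀) = -(k₁ * mink Y (F x₀)) := by linarith
  rw [e3, e4] at b2
  linear_combination -b2

/-! ## Transfer between the manifold and its charts -/

section Charts

variable {M : Type*} [TopologicalSpace M] [ChartedSpace E2 M]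

/-- The differential of a vector-valued map on the surface. -/
def dM (g : M → R41) (q : M) : E2 →L[ℝ] R41 := mfderiv (𝓡 2) 𝓘(ℝ, R41) g q

/-- The part of the preferred chart at `p` which corresponds to `U`. -/
def patch (p : M) (U : Set M) : Set E2 :=
  (extChartAt (𝓡 2) p).target ∩ (extChartAt (𝓡 2) p).symm ⁻¹' U

lemma isOpen_patch (p : M) {U : Set M} (hU : IsOpen U) : IsOpen (patch p U) :=
  (continuousOn_extChartAt_symm p).isOpen_inter_preimage (isOpen_extChartAt_target p) hU

lemma mem_patch {p q : M} {U : Set M} (hq : q ∈ U) (hqp : q ∈ (extChartAt (𝓡 2) p).source) :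
    extChartAt (𝓡 2) p q ∈ patch p U :=
  ⟨(extChartAt (𝓡 2) p).map_source hqp, by
    rw [Set.mem_preimage, (extChartAt (𝓡 2) p).left_inv hqp]; exact hq⟩

lemma mem_patch_self {p : M} {U : Set M} (hp : p ∈ U) : extChartAt (𝓡 2) p p ∈ patch p U :=
  mem_patch hp (mem_extChartAt_source p)

lemma inChart_apply (g : M → R41) {p q : M} (hqp : q ∈ (extChartAt (𝓡 2) p).source) :
    inChart g p (extChartAt (𝓡 2) p q) = g q := by
  simp only [inChart, Function.comp_apply, (extChartAt (𝓡 2) p).left_inv hqp]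

lemma dM_eq_fderiv {g : M → R41} {q : M} (hg : MDifferentiableAt (𝓡 2) 𝓘(ℝ, R41) g q) :
    dM g q = fderiv ℝ (inChart g q) (extChartAt (𝓡 2) q q) := by
  have h : HasFDerivWithinAt (inChart g q) (dM g q) (Set.range (𝓡 2)) (extChartAt (𝓡 2) q q) :=
    hg.hasMFDerivAt.2
  rw [ModelWithCorners.range_eq_univ, hasFDerivWithinAt_univ] at h
  exact h.fderiv.symm

variable [IsManifold (𝓡 2) ∞ M]

lemma contDiffOn_inChart {g : M → R41} {U : Set M} (hg : ContMDiffOn (𝓡 2) 𝓘(ℝ, R41) ∞ g U)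
    (p : M) : ContDiffOn ℝ ∞ (inChart g p) (patch p U) := by
  rw [← contMDiffOn_iff_contDiffOn]
  exact hg.comp ((contMDiffOn_extChartAt_symm p).mono Set.inter_subset_left) fun x hx => hx.2

/-- The same isomorphism `e` serves for every `g`, so identities relating `df` and `dν` pass between
the chart at `p` and the intrinsic differentials. -/
lemma exists_equiv_fderiv (p : M) {x : E2} (hx : x ∈ (extChartAt (𝓡 2) p).target) :
    ∃ e : E2 ≃L[ℝ] E2, ∀ g : M → R41,
      MDifferentiableAt (𝓡 2) 𝓘(ℝ, R41) g ((extChartAt (𝓡 2) p).symm x) → ∀ v,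
      fderiv ℝ (inChart g p) x v = dM g ((extChartAt (𝓡 2) p).symm x) (e v) := by
  have hinv := isInvertible_mfderivWithin_extChartAt_symm (I := 𝓡 2) hx
  rw [ModelWithCorners.range_eq_univ, mfderivWithin_univ] at hinv
  obtain ⟨e, he⟩ := hinv
  refine ⟨e, fun g hg v => ?_⟩
  have hs : MDifferentiableAt 𝓘(ℝ, E2) (𝓡 2) (extChartAt (𝓡 2) p).symm x := by
    have := (contMDiffOn_extChartAt_symm (I := 𝓡 2) (n := ∞) p).mdifferentiableOn (by simp) x hx
    exact this.mdifferentiableAt ((isOpen_extChartAt_target p).mem_nhds hx)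
  have h1 := mfderiv_comp x hg hs
  rw [← he] at h1
  have h2 := congrArg (fun L : E2 →L[ℝ] R41 => L v) h1
  rw [mfderiv_eq_fderiv] at h2
  exact h2

variable {f ν : M → R41} {U : Set M}

omit [IsManifold (𝓡 2) ∞ M] in
lemma mdiffAt {g : M → R41} (hU : IsOpen U) (hg : ContMDiffOn (𝓡 2) 𝓘(ℝ, R41) ∞ g U) {q : M}
    (hq : q ∈ U) : MDifferentiableAt (𝓡 2) 𝓘(ℝ, R41) g q :=
  (hg.contMDiffAt (hU.mem_nhds hq)).mdifferentiableAt (by simp)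

variable (hf : ContMDiff (𝓡 2) 𝓘(ℝ, R41) ∞ f) (hH : ∀ p, f p ∈ H3) (hU : IsOpen U)
  (hν : IsUnitNormalOn f ν U)
include hf hH hU hν

lemma jet_inChart (p : M) {x : E2} (hx : x ∈ patch p U) :
    Jet (inChart f p x) (inChart ν p x) (fderiv ℝ (inChart f p) x) (fderiv ℝ (inChart ν p) x) := by
  have hΩ := isOpen_patch p hU
  have sF := contDiffOn_inChart (hf.contMDiffOn (s := U)) p
  have sN := contDiffOn_inChart hν.smooth p
  have dF : ∀ y ∈ patch p U, DifferentiableAt ℝ (inChart f p) y := fun y hy =>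
    (sF.contDiffAt (hΩ.mem_nhds hy)).differentiableAt (by simp)
  have dN : ∀ y ∈ patch p U, DifferentiableAt ℝ (inChart ν p) y := fun y hy =>
    (sN.contDiffAt (hΩ.mem_nhds hy)).differentiableAt (by simp)
  have hFF : ∀ y ∈ patch p U, mink (inChart f p y) (inChart f p y) = -1 := fun y hy => (hH _).1
  have hFN : ∀ y ∈ patch p U, mink (inChart f p y) (inChart ν p y) = 0 := fun y hy =>
    hν.tangent _ hy.2
  have hNN : ∀ y ∈ patch p U, mink (inChart ν p y) (inChart ν p y) = 1 := fun y hy =>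
    hν.unit _ hy.2
  have hAN : ∀ y ∈ patch p U, ∀ v, mink (fderiv ℝ (inChart f p) y v) (inChart ν p y) = 0 := by
    intro y hy v
    obtain ⟨e, he⟩ := exists_equiv_fderiv p hy.1
    rw [he f (hf.mdifferentiableAt (by simp))]
    exact hν.normal _ hy.2 (e v)
  have hconst : ∀ {G G' : E2 → R41} {c : ℝ}, DifferentiableAt ℝ G x → DifferentiableAt ℝ G' x →
      (∀ y ∈ patch p U, mink (G y) (G' y) = c) → ∀ v,
      mink (fderiv ℝ G x v) (G' x) + mink (G x) (fderiv ℝ G' x v) = 0 := by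
    intro G G' c h1 h2 h3 v
    rw [← fderiv_mink h1 h2]
    have : (fun y => mink (G y) (G' y)) =ᶠ[𝓝 x] fun _ => c := by
      filter_upwards [hΩ.mem_nhds hx] with y hy using h3 y hy
    rw [this.fderiv_eq]; simp
  have hBN : ∀ v, mink (fderiv ℝ (inChart ν p) x v) (inChart ν p x) = 0 := by
    intro v
    have := hconst (dN x hx) (dN x hx) hNN v
    rw [mink_comm (inChart ν p x)] at this; linarith
  have hAF : ∀ v, mink (fderiv ℝ (inChart f p) x v) (inChart f p x) = 0 := by
    intro v
    have := hconst (dF x hx) (dF x hx) hFF v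
    rw [mink_comm (inChart f p x)] at this; linarith
  refine ⟨hFF x hx, hFN x hx, hNN x hx, hAF, hAN x hx, ?_, hBN, ?_⟩
  · intro v
    have := hconst (dF x hx) (dN x hx) hFN v
    rw [hAN x hx] at this
    rw [mink_comm]; linarith
  · intro v w
    -- Symmetry of the second fundamental form: differentiate `⟨df v, ν⟩ = 0` and use the symmetry
    -- of the second derivative of `f`.
    have h1 : ∀ v, HasFDerivAt (fun y => fderiv ℝ (inChart f p) y v)
        ((fderiv ℝ (fderiv ℝ (inChart f p)) x).flip v) x := fun v => by
      simpa using (((sF.fderiv_of_isOpen hΩ (m := ∞) (by simp)).contDiffAt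
        (hΩ.mem_nhds hx)).differentiableAt (by simp)).hasFDerivAt.clm_apply (hasFDerivAt_const v x)
    have h2 : IsSymmSndFDerivAt ℝ (inChart f p) x :=
      (sF.contDiffAt (hΩ.mem_nhds hx)).isSymmSndFDerivAt (by simp; exact two_le_infty)
    have h3 := fun v w => hconst (h1 v).differentiableAt (dN x hx) (fun y hy => hAN y hy v) w
    have h4 := h3 v w
    have h5 := h3 w v
    rw [(h1 v).fderiv] at h4
    rw [(h1 w).fderiv] at h5
    simp only [ContinuousLinearMap.flip_apply] at h4 h5
    rw [h2.eq v w] at h5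
    linarith

lemma jet_dM {q : M} (hq : q ∈ U) : Jet (f q) (ν q) (dM f q) (dM ν q) := by
  have := jet_inChart hf hH hU hν q (mem_patch_self hq)
  rw [← dM_eq_fderiv (hf.mdifferentiableAt (by simp)),
    ← dM_eq_fderiv (mdiffAt hU hν.smooth hq),
    inChart_apply _ (mem_extChartAt_source q), inChart_apply _ (mem_extChartAt_source q)] at this
  exact this

omit hH [IsManifold (𝓡 2) ∞ M] in
lemma dM_parallel {q : M} (hq : q ∈ U) (δ : ℝ) :
    dM (parallel f ν δ) q = parA (dM f q) (dM ν q) δ ∧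
    dM (parallelNormal f ν δ) q = parA (dM ν q) (dM f q) δ := by
  have h1 := hf.mdifferentiableAt (x := q) (by simp)
  have h2 := mdiffAt hU hν.smooth hq
  constructor
  · exact ((h1.hasMFDerivAt.const_smul (Real.cosh δ)).add
      (h2.hasMFDerivAt.const_smul (Real.sinh δ))).mfderiv
  · exact ((h2.hasMFDerivAt.const_smul (Real.cosh δ)).add
      (h1.hasMFDerivAt.const_smul (Real.sinh δ))).mfderiv

/-- The curvature relation of a parallel surface in terms of first-order data. -/
lemma curv_relation_iff {q : M} (hq : q ∈ U) {δ : ℝ} (hreg : RegularAt (parallel f ν δ) q)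
    (a b : ℝ) :
    a * (meanCurv (parallel f ν δ) (parallelNormal f ν δ) q - 1)
      + b * gaussCurv (parallel f ν δ) q = 0 ↔
    Rel (parallel f ν δ q) (parallelNormal f ν δ q) (parA (dM f q) (dM ν q) δ)
      (parA (dM ν q) (dM f q) δ) a b := by
  have hΩ := isOpen_patch q hU
  have sF := contDiffOn_inChart (hf.contMDiffOn (s := U)) q
  have sN := contDiffOn_inChart hν.smooth q
  have e1 : inChart (parallel f ν δ) q
      = fun x => Real.cosh δ • inChart f q x + Real.sinh δ • inChart ν q x := rfl
  have e2 : inChart (parallelNormal f ν δ) q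
      = fun x => Real.cosh δ • inChart ν q x + Real.sinh δ • inChart f q x := rfl
  have hd : ∀ y ∈ patch q U, HasFDerivAt (inChart f q) (fderiv ℝ (inChart f q) y) y ∧
      HasFDerivAt (inChart ν q) (fderiv ℝ (inChart ν q) y) y := fun y hy =>
    ⟨((sF.contDiffAt (hΩ.mem_nhds hy)).differentiableAt (by simp)).hasFDerivAt,
      ((sN.contDiffAt (hΩ.mem_nhds hy)).differentiableAt (by simp)).hasFDerivAt⟩
  have h1 : ∀ y ∈ patch q U, fderiv ℝ (inChart (parallel f ν δ) q) y
      = parA (fderiv ℝ (inChart f q) y) (fderiv ℝ (inChart ν q) y) δ := fun y hy =>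
    (((hd y hy).1.const_smul (Real.cosh δ)).add ((hd y hy).2.const_smul (Real.sinh δ))).fderiv
  have h2 : ∀ y ∈ patch q U, fderiv ℝ (inChart (parallelNormal f ν δ) q) y
      = parA (fderiv ℝ (inChart ν q) y) (fderiv ℝ (inChart f q) y) δ := fun y hy =>
    (((hd y hy).2.const_smul (Real.cosh δ)).add ((hd y hy).1.const_smul (Real.sinh δ))).fderiv
  have hx := mem_patch_self hq
  have hJ : ∀ y ∈ patch q U, Jet (inChart (parallel f ν δ) q y) (inChart (parallelNormal f ν δ) q y)
      (fderiv ℝ (inChart (parallel f ν δ) q) y) (fderiv ℝ (inChart (parallelNormal f ν δ) q) y) := by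
    intro y hy
    rw [h1 y hy, h2 y hy]
    exact (jet_inChart hf hH hU hν q hy).parallel δ
  have c1 : fderiv ℝ (inChart (parallel f ν δ) q) (extChartAt (𝓡 2) q q)
      = parA (dM f q) (dM ν q) δ := by
    rw [h1 _ hx, ← dM_eq_fderiv (hf.mdifferentiableAt (by simp)),
      ← dM_eq_fderiv (mdiffAt hU hν.smooth hq)]
  have c2 : fderiv ℝ (inChart (parallelNormal f ν δ) q) (extChartAt (𝓡 2) q q)
      = parA (dM ν q) (dM f q) δ := by
    rw [h2 _ hx, ← dM_eq_fderiv (hf.mdifferentiableAt (by simp)),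
      ← dM_eq_fderiv (mdiffAt hU hν.smooth hq)]
  have hinj : Function.Injective (fderiv ℝ (inChart (parallel f ν δ) q) (extChartAt (𝓡 2) q q)) := by
    rw [c1, ← (dM_parallel hf hU hν hq δ).1]
    exact hreg
  have key := coord_rel_iff (F := inChart (parallel f ν δ) q)
    (N := inChart (parallelNormal f ν δ) q) hΩ ((sF.const_smul (Real.cosh δ)).add (sN.const_smul (Real.sinh δ)))
    ((sN.const_smul (Real.cosh δ)).add (sF.const_smul (Real.sinh δ))) hJ hx hinj a b
  rw [c1, c2, inChart_apply _ (mem_extChartAt_source q),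
    inChart_apply _ (mem_extChartAt_source q)] at key
  exact key

end Charts

/-! ## Unique continuation on the surface -/

lemma Reg.neg {A B : E2 →L[ℝ] R41} {δ : ℝ} (h : Function.Injective (parA A B δ)) :
    Function.Injective (parA A (-B) (-δ)) := by
  have : parA A (-B) (-δ) = parA A B δ := by simp [parA]
  rwa [this]

section Global

variable {M : Type*} [TopologicalSpace M] [ChartedSpace E2 M]

/-! ### Changing the unit normal, and surface pieces carrying a relation. -/

lemma dM_comb {g h : M → R41} {q : M} (hg : MDifferentiableAt (𝓡 2) 𝓘(ℝ, R41) g q)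
    (hh : MDifferentiableAt (𝓡 2) 𝓘(ℝ, R41) h q) (c d : ℝ) :
    dM (fun r => c • g r + d • h r) q = c • dM g q + d • dM h q :=
  ((hg.hasMFDerivAt.const_smul c).add (hh.hasMFDerivAt.const_smul d)).mfderiv

lemma dM_congr {g h : M → R41} {q : M} (H : g =ᶠ[𝓝 q] h) : dM g q = dM h q :=
  H.mfderiv_eq

lemma dM_eq_zero {g : M → R41} {q : M} {C : R41} (H : ∀ᶠ r in 𝓝 q, g r = C) : dM g q = 0 := by
  rw [dM_congr (h := fun _ => C) H]
  exact (hasMFDerivAt_const C q).mfderiv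

lemma dM_neg {g : M → R41} {q : M} (hg : MDifferentiableAt (𝓡 2) 𝓘(ℝ, R41) g q) :
    dM (-g) q = -dM g q := hg.hasMFDerivAt.neg.mfderiv

lemma comb_dM_eq_zero {g h : M → R41} {q : M} (hg : MDifferentiableAt (𝓡 2) 𝓘(ℝ, R41) g q)
    (hh : MDifferentiableAt (𝓡 2) 𝓘(ℝ, R41) h q) {c d : ℝ} {C : R41}
    (H : ∀ᶠ r in 𝓝 q, c • g r + d • h r = C) (v : E2) : c • dM g q v + d • dM h q v = 0 := by
  have := dM_comb hg hh c d
  rw [dM_eq_zero H] at this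
  exact (congrArg (fun L : E2 →L[ℝ] R41 => L v) this).symm

lemma IsUnitNormalOn.mono {f ν : M → R41} {U V : Set M} (h : IsUnitNormalOn f ν U) (hV : V ⊆ U) :
    IsUnitNormalOn f ν V :=
  ⟨h.smooth.mono hV, fun q hq => h.unit q (hV hq), fun q hq => h.tangent q (hV hq),
    fun q hq => h.normal q (hV hq)⟩

lemma IsUnitNormalOn.congr {f ν ν' : M → R41} {U : Set M} (h : IsUnitNormalOn f ν U)
    (H : ∀ q ∈ U, ν' q = ν q) : IsUnitNormalOn f ν' U :=
  ⟨h.smooth.congr H, fun q hq => by rw [H q hq]; exact h.unit q hq,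
    fun q hq => by rw [H q hq]; exact h.tangent q hq,
    fun q hq v => by rw [H q hq]; exact h.normal q hq v⟩

lemma IsUnitNormalOn.neg {f ν : M → R41} {U : Set M} (h : IsUnitNormalOn f ν U) :
    IsUnitNormalOn f (-ν) U :=
  ⟨h.smooth.neg, fun q hq => by
    simp only [Pi.neg_apply, mink_neg_left, mink_neg_right, h.unit q hq, neg_neg],
    fun q hq => by simp only [Pi.neg_apply, mink_neg_right, h.tangent q hq, neg_zero],
    fun q hq v => (mink_neg_right _ _).trans (neg_eq_zero.2 (h.normal q hq v))⟩

omit [TopologicalSpace M] [ChartedSpace E2 M] in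
lemma Spans.neg {ℓ : M → Submodule ℝ R41} {ν : M → R41} {U : Set M} (h : Spans ℓ ν U) :
    Spans ℓ (-ν) U := fun q hq => by
  rw [h q hq, Pi.neg_apply, ← Set.neg_singleton, Submodule.span_neg]

omit [TopologicalSpace M] [ChartedSpace E2 M] in
lemma Spans.mono {ℓ : M → Submodule ℝ R41} {ν : M → R41} {U V : Set M} (h : Spans ℓ ν U)
    (hV : V ⊆ U) : Spans ℓ ν V := fun q hq => h q (hV hq)

omit [TopologicalSpace M] [ChartedSpace E2 M] in
lemma Spans.congr {ℓ : M → Submodule ℝ R41} {ν ν' : M → R41} {U : Set M} (h : Spans ℓ ν U)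
    (H : ∀ q ∈ U, ν' q = ν q) : Spans ℓ ν' U := fun q hq => by rw [H q hq]; exact h q hq

/-- Two unit normals spanning the same line field agree up to sign, locally. -/
lemma eventually_eq_or_neg {f ν ν' : M → R41} {ℓ : M → Submodule ℝ R41} {U U' : Set M}
    (hU : IsOpen U) (hU' : IsOpen U') (h : IsUnitNormalOn f ν U) (h' : IsUnitNormalOn f ν' U')
    (hs : Spans ℓ ν U) (hs' : Spans ℓ ν' U') {q : M} (hq : q ∈ U) (hq' : q ∈ U') :
    (∀ᶠ r in 𝓝 q, ν' r = ν r) ∨ (∀ᶠ r in 𝓝 q, ν' r = -ν r) := by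
  have key : ∀ r ∈ U ∩ U', (ν' r = ν r ∧ mink (ν' r) (ν r) = 1)
      ∨ (ν' r = -ν r ∧ mink (ν' r) (ν r) = -1) := by
    intro r hr
    have h1 : ν' r ∈ Submodule.span ℝ {ν r} := by
      rw [← hs r hr.1, hs' r hr.2]; exact Submodule.mem_span_singleton_self _
    obtain ⟨c, hc⟩ := Submodule.mem_span_singleton.1 h1
    have h2 := h'.unit r hr.2
    rw [← hc, mink_smul_left, mink_smul_right, h.unit r hr.1] at h2
    rw [← hc, mink_smul_left, h.unit r hr.1]
    have h3 : (c - 1) * (c + 1) = 0 := by linarith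
    rcases mul_eq_zero.1 h3 with h4 | h4
    · left
      have : c = 1 := by linarith
      simp [this]
    · right
      have : c = -1 := by linarith
      simp [this]
  have hcont : ContinuousAt (fun r => mink (ν' r) (ν r)) q := by
    have c1 : ∀ i, ContinuousAt (fun r => ν r i) q := fun i =>
      (continuous_apply i).continuousAt.comp (h.smooth.continuousOn.continuousAt (hU.mem_nhds hq))
    have c2 : ∀ i, ContinuousAt (fun r => ν' r i) q := fun i =>
      (continuous_apply i).continuousAt.comp
        (h'.smooth.continuousOn.continuousAt (hU'.mem_nhds hq'))
    simp only [mink]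
    exact ((((c2 0).mul (c1 0)).neg.add ((c2 1).mul (c1 1))).add ((c2 2).mul (c1 2))).add
      ((c2 3).mul (c1 3))
  have hn : U ∩ U' ∈ 𝓝 q := (hU.inter hU').mem_nhds ⟨hq, hq'⟩
  rcases key q ⟨hq, hq'⟩ with h1 | h1
  · left
    filter_upwards [hn, hcont.eventually (lt_mem_nhds (show (0 : ℝ) < mink (ν' q) (ν q) by rw [h1.2]; norm_num))]
      with r hr hr'
    rcases key r hr with h2 | h2
    · exact h2.1
    · exfalso; linarith [h2.2]
  · right
    filter_upwards [hn, hcont.eventually (gt_mem_nhds (show mink (ν' q) (ν q) < (0 : ℝ) by rw [h1.2]; norm_num))]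
      with r hr hr'
    rcases key r hr with h2 | h2
    · exfalso; linarith [h2.2]
    · exact h2.1

/-- An open piece of a front, one of whose parallel fronts is an immersion, with a unit normal that
satisfies the linear relation with coefficients `a, b`. -/
structure MSurf (f ν : M → R41) (U : Set M) (a b : ℝ) : Prop where
  isOpen : IsOpen U
  normal : IsUnitNormalOn f ν U
  reg : ∃ δ : ℝ, ∀ q ∈ U, Function.Injective (parA (dM f q) (dM ν q) δ)
  rel : ∀ q ∈ U, Rel (f q) (ν q) (dM f q) (dM ν q) a b

variable {f ν : M → R41} {U V : Set M} {a b : ℝ}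

lemma MSurf.mdiff (S : MSurf f ν U a b) {q : M} (hq : q ∈ U) :
    MDifferentiableAt (𝓡 2) 𝓘(ℝ, R41) ν q := mdiffAt S.isOpen S.normal.smooth hq

lemma MSurf.regAt (S : MSurf f ν U a b) {q : M} (hq : q ∈ U) : Reg (dM f q) (dM ν q) := by
  obtain ⟨δ, h⟩ := S.reg
  exact ⟨δ, h q hq⟩

lemma MSurf.mono (S : MSurf f ν U a b) (hV : IsOpen V) (h : V ⊆ U) : MSurf f ν V a b := by
  obtain ⟨δ, hδ⟩ := S.reg
  exact ⟨hV, S.normal.mono h, ⟨δ, fun q hq => hδ q (h hq)⟩, fun q hq => S.rel q (h hq)⟩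

lemma MSurf.congr {ν' : M → R41} (S : MSurf f ν U a b) (H : ∀ q ∈ U, ν' q = ν q) :
    MSurf f ν' U a b := by
  have hd : ∀ q ∈ U, dM ν' q = dM ν q := fun q hq =>
    dM_congr (by filter_upwards [S.isOpen.mem_nhds hq] with r hr using H r hr)
  obtain ⟨δ, hδ⟩ := S.reg
  refine ⟨S.isOpen, S.normal.congr H, ⟨δ, fun q hq => ?_⟩, fun q hq => ?_⟩
  · rw [hd q hq]; exact hδ q hq
  · rw [hd q hq, H q hq]; exact S.rel q hq

lemma MSurf.with_rel {a' b' : ℝ} (S : MSurf f ν U a b)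
    (h : ∀ q ∈ U, Rel (f q) (ν q) (dM f q) (dM ν q) a' b') : MSurf f ν U a' b' :=
  ⟨S.isOpen, S.normal, S.reg, h⟩

lemma MSurf.neg {a' b' : ℝ} (S : MSurf f ν U a b)
    (h : ∀ q ∈ U, Rel (f q) (-ν q) (dM f q) (-dM ν q) a' b') : MSurf f (-ν) U a' b' := by
  have hd : ∀ q ∈ U, dM (-ν) q = -dM ν q := fun q hq => dM_neg (S.mdiff hq)
  obtain ⟨δ, hδ⟩ := S.reg
  refine ⟨S.isOpen, S.normal.neg, ⟨-δ, fun q hq => ?_⟩, fun q hq => ?_⟩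
  · rw [hd q hq]; exact Reg.neg (hδ q hq)
  · rw [hd q hq]; exact h q hq

variable [IsManifold (𝓡 2) ∞ M]

lemma eventually_const_of_dM_eq_zero {g : M → R41} (hU : IsOpen U)
    (hg : ContMDiffOn (𝓡 2) 𝓘(ℝ, R41) ∞ g U) (h : ∀ q ∈ U, dM g q = 0) {p : M} (hp : p ∈ U) :
    ∀ᶠ r in 𝓝 p, g r = g p := by
  have hs := contDiffOn_inChart hg p
  have hΩ := isOpen_patch p hU
  obtain ⟨r, hr, hball⟩ := Metric.isOpen_iff.1 hΩ _ (mem_patch_self hp)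
  have hc : ∀ x ∈ Metric.ball (extChartAt (𝓡 2) p p) r, inChart g p x = g p := by
    intro x hx
    rw [← inChart_apply g (mem_extChartAt_source p)]
    refine Metric.isOpen_ball.is_const_of_fderiv_eq_zero (convex_ball _ _).isPreconnected
      ((hs.differentiableOn (by simp)).mono hball) (fun y hy => ?_) hx (Metric.mem_ball_self hr)
    obtain ⟨e, he⟩ := exists_equiv_fderiv p (hball hy).1
    ext1 v
    rw [he g (mdiffAt hU hg (hball hy).2), h _ (hball hy).2]
    rfl
  have h1 := (continuousAt_extChartAt (I := 𝓡 2) p).preimage_mem_nhds (Metric.ball_mem_nhds _ hr)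
  filter_upwards [h1, extChartAt_source_mem_nhds (I := 𝓡 2) p] with q hq hqs
  rw [← inChart_apply g hqs]
  exact hc _ hq

omit [IsManifold (𝓡 2) ∞ M] in
/-- Constancy of `g` propagates over a connected set if it does so in charts. -/
lemma const_of_chart_continuation {g : M → R41} {C : R41} (hU : IsPreconnected U) {q₀ : M}
    (hq₀ : q₀ ∈ U) (h₀ : ∀ᶠ r in 𝓝 q₀, g r = C)
    (H : ∀ p ∈ U, ∀ O : Set E2, IsOpen O → extChartAt (𝓡 2) p p ∈ closure O →
      (∀ x ∈ O, inChart g p x = C) → ∀ᶠ x in 𝓝 (extChartAt (𝓡 2) p p), inChart g p x = C) :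
    ∀ q ∈ U, g q = C := by
  set S : Set M := {q | ∀ᶠ r in 𝓝 q, g r = C} with hS
  have hSo : IsOpen S := isOpen_setOfPred_eventually_nhds
  have hsub : U ⊆ S := by
    -- The set where `g = C` locally is open; the hypothesis `H` makes it relatively closed in `U`.
    refine hU.subset_of_closure_inter_subset hSo ⟨q₀, hq₀, h₀⟩ ?_
    rintro p ⟨hpc, hpU⟩
    have hO := isOpen_patch p hSo
    have h1 := H p hpU (patch p S) hO ?_ ?_
    · have h2 := (continuousAt_extChartAt (I := 𝓡 2) p).eventually h1
      change ∀ᶠ r in 𝓝 p, g r = C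
      filter_upwards [h2, extChartAt_source_mem_nhds (I := 𝓡 2) p] with r hr hrs
      rwa [inChart_apply g hrs] at hr
    · rw [mem_closure_iff_nhds]
      intro W hW
      have h2 := (continuousAt_extChartAt (I := 𝓡 2) p).preimage_mem_nhds hW
      obtain ⟨r, ⟨hr1, hr2⟩, hr3⟩ := mem_closure_iff_nhds.1 hpc _
        (inter_mem h2 (extChartAt_source_mem_nhds (I := 𝓡 2) p))
      exact ⟨_, hr1, mem_patch hr3 hr2⟩
    · intro x hx
      exact (show ∀ᶠ r in 𝓝 _, g r = C from hx.2).self_of_nhds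
  exact fun q hq => (show ∀ᶠ r in 𝓝 q, g r = C from hsub hq).self_of_nhds

variable (hf : ContMDiff (𝓡 2) 𝓘(ℝ, R41) ∞ f) (hH : ∀ p, f p ∈ H3)
include hf hH

lemma MSurf.localSurf (S : MSurf f ν U a b) (p : M) :
    LocalSurf (inChart f p) (inChart ν p) (patch p U) a b := by
  have key : ∀ x ∈ patch p U, ∃ e : E2 ≃L[ℝ] E2,
      fderiv ℝ (inChart f p) x = dM f ((extChartAt (𝓡 2) p).symm x) ∘L (e : E2 →L[ℝ] E2) ∧
      fderiv ℝ (inChart ν p) x = dM ν ((extChartAt (𝓡 2) p).symm x) ∘L (e : E2 →L[ℝ] E2) := by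
    intro x hx
    obtain ⟨e, he⟩ := exists_equiv_fderiv p hx.1
    refine ⟨e, ?_, ?_⟩
    · ext1 v; exact he f (hf.mdifferentiableAt (by simp)) v
    · ext1 v; exact he ν (S.mdiff hx.2) v
  refine ⟨isOpen_patch p S.isOpen, contDiffOn_inChart hf.contMDiffOn p,
    contDiffOn_inChart S.normal.smooth p,
    fun x hx => jet_inChart hf hH S.isOpen S.normal p hx, fun x hx => ?_, fun x hx => ?_⟩
  · obtain ⟨e, h1, h2⟩ := key x hx
    obtain ⟨δ, hδ⟩ := S.regAt hx.2
    refine ⟨δ, ?_⟩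
    rw [h1, h2]
    exact hδ.comp e.injective
  · obtain ⟨e, h1, h2⟩ := key x hx
    rw [h1, h2]
    intro v w
    exact S.rel _ hx.2 (e v) (e w)

/-- Unique continuation of horospheres. -/
theorem MSurf.add_const (S : MSurf f ν U a b) (hU : IsPreconnected U) (hab : a + 2 * b ≠ 0)
    {q₀ : M} (hq₀ : q₀ ∈ U) {C : R41} (h₀ : ∀ᶠ r in 𝓝 q₀, f r + ν r = C) :
    ∀ q ∈ U, f q + ν q = C :=
  const_of_chart_continuation (g := fun q => f q + ν q) hU hq₀ h₀ fun p hp _ hO hpO hC =>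
    (S.localSurf hf hH p).hv_eventually_const hab (mem_patch_self hp) hO hpO
      fun x hx => hC x hx.2

/-- Unique continuation of surfaces parallel to a point or to a totally geodesic plane. -/
theorem MSurf.comb_const (S : MSurf f ν U a b) (hU : IsPreconnected U) (hab : a + 2 * b ≠ 0)
    {q₀ : M} (hq₀ : q₀ ∈ U) {C : R41} (h₀ : ∀ᶠ r in 𝓝 q₀, -(a + b) • f r + b • ν r = C) :
    ∀ q ∈ U, -(a + b) • f q + b • ν q = C :=
  const_of_chart_continuation (g := fun q => -(a + b) • f q + b • ν q) hU hq₀ h₀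
    fun p hp _ hO hpO hC =>
    (S.localSurf hf hH p).yv_eventually_const hab (mem_patch_self hp) hO hpO
      fun x hx => hC x hx.2

lemma MSurf.jet (S : MSurf f ν U a b) {q : M} (hq : q ∈ U) :
    Jet (f q) (ν q) (dM f q) (dM ν q) := jet_dM hf hH S.isOpen S.normal hq

/-- If both relations hold for the two choices of the unit normal, the surface is parallel to a
point or to a totally geodesic plane. -/
theorem exists_comb_const {a' b' : ℝ} (S : MSurf f ν U a b) (S' : MSurf f (-ν) U a' b')
    (ha : a ≠ 0) (ha' : a' ≠ 0) {p : M} (hp : p ∈ U) :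
    ∃ c d : ℝ, c ^ 2 ≠ d ^ 2 ∧ ∀ᶠ r in 𝓝 p, c • f r + d • ν r = c • f p + d • ν p := by
  obtain ⟨δ, hδ⟩ := S.reg
  obtain ⟨H, K, hHK⟩ := exists_const_curv a b a' b' δ ha ha'
  have L := S.localSurf hf hH p
  have L' := S'.localSurf hf hH p
  have hneg : inChart (-ν) p = -inChart ν p := rfl
  have hfneg : ∀ x, fderiv ℝ (inChart (-ν) p) x = -fderiv ℝ (inChart ν p) x := fun x => by
    rw [hneg, fderiv_neg]
  have hcoord : ∀ x ∈ patch p U,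
      Function.Injective (parA (fderiv ℝ (inChart f p) x) (fderiv ℝ (inChart ν p) x) δ) := by
    intro x hx
    obtain ⟨e, he⟩ := exists_equiv_fderiv p hx.1
    have h1 : fderiv ℝ (inChart f p) x = dM f ((extChartAt (𝓡 2) p).symm x) ∘L (e : E2 →L[ℝ] E2) := by
      ext1 v; exact he f (hf.mdifferentiableAt (by simp)) v
    have h2 : fderiv ℝ (inChart ν p) x = dM ν ((extChartAt (𝓡 2) p).symm x) ∘L (e : E2 →L[ℝ] E2) := by
      ext1 v; exact he ν (S.mdiff hx.2) v
    rw [h1, h2]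
    exact (hδ _ hx.2).comp e.injective
  have hC := fun x hx => hHK _ _ _ _ (L.jet x hx) (hcoord x hx) (L.rel x hx) (by
    have := L'.rel x hx
    rwa [hfneg] at this)
  have h1 : ∀ y ∈ patch p U, fderiv ℝ (fun x => Real.cosh δ • inChart f p x
      + Real.sinh δ • inChart ν p x) y
      = parA (fderiv ℝ (inChart f p) y) (fderiv ℝ (inChart ν p) y) δ := fun y hy =>
    (((L.diffF hy).hasFDerivAt.const_smul (Real.cosh δ)).add
      ((L.diffN hy).hasFDerivAt.const_smul (Real.sinh δ))).fderiv
  have h2 : ∀ y ∈ patch p U, fderiv ℝ (fun x => Real.cosh δ • inChart ν p x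
      + Real.sinh δ • inChart f p x) y
      = parA (fderiv ℝ (inChart ν p) y) (fderiv ℝ (inChart f p) y) δ := fun y hy =>
    (((L.diffN hy).hasFDerivAt.const_smul (Real.cosh δ)).add
      ((L.diffF hy).hasFDerivAt.const_smul (Real.sinh δ))).fderiv
  have hKH : K = H ^ 2 := by
    refine gaussKronecker_eq_sq (F := fun x => Real.cosh δ • inChart f p x
        + Real.sinh δ • inChart ν p x)
      (N := fun x => Real.cosh δ • inChart ν p x + Real.sinh δ • inChart f p x) L.isOpen
      ((L.smF.const_smul (Real.cosh δ)).add (L.smN.const_smul (Real.sinh δ)))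
      ((L.smN.const_smul (Real.cosh δ)).add (L.smF.const_smul (Real.sinh δ)))
      (fun x hx => ?_) (fun x hx => ?_) (hC _ (mem_patch_self hp)).1 (fun x hx => ?_)
      (fun x hx => ?_) (mem_patch_self hp)
    · rw [h1 x hx, h2 x hx]; exact (L.jet x hx).parallel δ
    · rw [h1 x hx]; exact hcoord x hx
    · rw [h1 x hx, h2 x hx]; exact (hC x hx).2.1
    · rw [h1 x hx, h2 x hx]; exact (hC x hx).2.2
  -- These are the coefficients of `ν_δ + H f_δ`, which is constant on an umbilic surface; `c² - d²
  -- = H² - 1 = K - 1 ≠ 0`.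
  set c := Real.sinh δ + H * Real.cosh δ with hc
  set d := Real.cosh δ + H * Real.sinh δ with hd
  refine ⟨c, d, ?_, ?_⟩
  · intro h
    apply (hC _ (mem_patch_self hp)).1
    rw [hKH]
    have := Real.cosh_sq' δ
    rw [hc, hd] at h
    linear_combination h - (H ^ 2 - 1) * this
  · refine eventually_const_of_dM_eq_zero (g := fun r => c • f r + d • ν r) S.isOpen
      (((contMDiffOn_const (I := 𝓡 2) (I' := 𝓘(ℝ, ℝ)) (c := c)).smul hf.contMDiffOn).add
        ((contMDiffOn_const (I := 𝓡 2) (I' := 𝓘(ℝ, ℝ)) (c := d)).smul S.normal.smooth)) (fun q hq => ?_) hp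
    have hq2 := hHK _ _ _ _ (S.jet hf hH hq) (hδ q hq) (S.rel q hq) (by
      have := S'.rel q hq
      rwa [dM_neg (S.mdiff hq)] at this)
    rw [hKH] at hq2
    have hu := ((S.jet hf hH hq).parallel δ).umbilic (hδ q hq) hq2.2.1 hq2.2.2
    rw [dM_comb (hf.mdifferentiableAt (by simp)) (S.mdiff hq)]
    ext1 v
    refine Eq.trans ?_ (hu v)
    simp only [_root_.add_apply, _root_.smul_apply, hc, hd]
    module

end Global

/-! ## Globalization -/

lemma eq_univ_of_local {X : Type*} [TopologicalSpace X] [PreconnectedSpace X] {T : Set X}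
    (hT : T.Nonempty)
    (h : ∀ p, ∃ U : Set X, IsOpen U ∧ p ∈ U ∧ ((U ∩ T).Nonempty → U ⊆ T)) : T = Set.univ := by
  refine IsClopen.eq_univ ⟨⟨isOpen_iff_mem_nhds.2 fun p hp => ?_⟩, isOpen_iff_mem_nhds.2
    fun p hp => ?_⟩ hT
  · obtain ⟨U, hU, hpU, hUT⟩ := h p
    filter_upwards [hU.mem_nhds hpU] with r hr hrT
    exact hp (hUT ⟨r, hr, hrT⟩ hpU)
  · obtain ⟨U, hU, hpU, hUT⟩ := h p
    exact mem_of_superset (hU.mem_nhds hpU) (hUT ⟨p, hpU, hp⟩)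

section Global

variable {M : Type*} [TopologicalSpace M] [ChartedSpace E2 M] {f ν ν' : M → R41}
  {ℓ : M → Submodule ℝ R41} {U U' : Set M} {a b a' b' : ℝ}

omit [TopologicalSpace M] [ChartedSpace E2 M] in
lemma parallel_zero (f ν : M → R41) : parallel f ν 0 = f := by
  funext q; simp [parallel]

omit [TopologicalSpace M] [ChartedSpace E2 M] in
lemma parallelNormal_zero (f ν : M → R41) : parallelNormal f ν 0 = ν := by
  funext q; simp [parallelNormal]

variable [IsManifold (𝓡 2) ∞ M] (hf : ContMDiff (𝓡 2) 𝓘(ℝ, R41) ∞ f) (hH : ∀ p, f p ∈ H3)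
include hf hH

lemma curv_relation_iff_of_regularAt (hU : IsOpen U) (hν : IsUnitNormalOn f ν U) {q : M}
    (hq : q ∈ U) {δ : ℝ} (hreg : RegularAt (parallel f ν δ) q) (a b : ℝ) :
    a * (meanCurv (parallel f ν δ) (parallelNormal f ν δ) q - 1)
      + (b * Real.exp (2 * δ) + a * (Real.exp (2 * δ) - 1) / 2) * gaussCurv (parallel f ν δ) q = 0
      ↔ Rel (f q) (ν q) (dM f q) (dM ν q) a b :=
  (curv_relation_iff hf hH hU hν hq hreg _ _).trans (rel_parallel_iff _ _ _ _ δ a b)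

lemma gaussCurv_eq_zero_of_rel (hU : IsOpen U) (hν : IsUnitNormalOn f ν U) {q : M}
    (hq : q ∈ U) (hreg : RegularAt f q) (h : Rel (f q) (ν q) (dM f q) (dM ν q) 0 1) :
    gaussCurv f q = 0 := by
  have := (curv_relation_iff_of_regularAt hf hH hU hν hq (δ := 0)
    (by rwa [parallel_zero]) 0 1).2 h
  simpa [parallel_zero] using this

omit hf hH in
/-- Near each point there is a connected piece on which a linear relation holds. -/
lemma exists_mSurf (h : IsHLWFront f ℓ) (p : M) : ∃ (U : Set M) (ν : M → R41) (a b : ℝ),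
    p ∈ U ∧ IsPreconnected U ∧ Spans ℓ ν U ∧ (a ≠ 0 ∨ b ≠ 0) ∧ MSurf f ν U a b := by
  have := ChartedSpace.locallyConnectedSpace E2 M
  obtain ⟨U, hU, hp, ν, hν, hs, δ, hreg, a, b, hab, hrel⟩ := h.2 p
  have hsub := connectedComponentIn_subset U p
  -- Inverting `b ↦ b_δ` carries the relation of the parallel immersion back to `f`.
  set e := Real.exp (2 * δ) with he
  have he0 : e ≠ 0 := (Real.exp_pos _).ne'
  have hb : (b - a * (e - 1) / 2) / e * e + a * (e - 1) / 2 = b := by field_simp; ring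
  refine ⟨connectedComponentIn U p, ν, a, (b - a * (e - 1) / 2) / e, mem_connectedComponentIn hp,
    isPreconnected_connectedComponentIn, hs.mono hsub, ?_, MSurf.mono (U := U) ?_
      hU.connectedComponentIn hsub⟩
  · by_contra! hc
    rw [hc.2, hc.1] at hb
    apply hab
    rw [hc.1, ← hb]
    simp
  · refine ⟨hU, hν, ⟨δ, fun q hq => ?_⟩, fun q hq => ?_⟩
    · rw [← (dM_parallel h.1.smooth hU hν hq δ).1]
      exact hreg q hq
    · rw [← curv_relation_iff_of_regularAt h.1.smooth h.1.mem_H3 hU hν hq (hreg q hq), ← he, hb]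
      exact hrel q hq

/-- A surface parallel to a point or to a totally geodesic plane remains so. -/
lemma MSurf.comb_const_of_eventually (S : MSurf f ν U a b) (hU : IsPreconnected U)
    (hab : a ≠ 0 ∨ b ≠ 0) {c d : ℝ} (hcd : c ^ 2 ≠ d ^ 2) {r : M} (hr : r ∈ U) {C : R41}
    (h : ∀ᶠ s in 𝓝 r, c • f s + d • ν s = C) : ∀ q ∈ U, c • f q + d • ν q = C := by
  have h1 := Rel.ratio_of_comb_eq_zero (S.jet hf hH hr) (S.regAt hr)
    (comb_dM_eq_zero (hf.mdifferentiableAt (by simp)) (S.mdiff hr) h) hcd (S.rel r hr)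
  have hne : c ^ 2 + d ^ 2 ≠ 0 := by
    intro h0
    apply hcd
    nlinarith [sq_nonneg c, sq_nonneg d]
  -- By `h1` the vectors `(-(a + b), b)` and `(c, d)` are collinear, and `t` is the projection
  -- coefficient. Thus `y = t (c f + d ν)`, and `a + 2b = t (d - c)` is nonzero.
  obtain ⟨t, ht1, ht2⟩ : ∃ t : ℝ, -(a + b) = t * c ∧ b = t * d := by
    refine ⟨(-(a + b) * c + b * d) / (c ^ 2 + d ^ 2), ?_, ?_⟩
    · rw [div_mul_eq_mul_div, eq_div_iff hne]; linear_combination (-d) * h1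
    · rw [div_mul_eq_mul_div, eq_div_iff hne]; linear_combination c * h1
  have ht : t ≠ 0 := by
    rintro rfl
    rcases hab with h0 | h0 <;> apply h0 <;> linarith
  have hab2 : a + 2 * b ≠ 0 := by
    intro h0
    apply hcd
    have : t * (c - d) = 0 := by linear_combination ht2 - ht1 - h0
    rcases mul_eq_zero.1 this with h2 | h2
    · exact absurd h2 ht
    · rw [sub_eq_zero.1 h2]
  intro q hq
  have h2 := S.comb_const hf hH hU hab2 hr (C := t • C) (by
    filter_upwards [h] with s hs
    rw [ht1, ← hs, show b • ν s = (t * d) • ν s by rw [← ht2]]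
    module) q hq
  apply smul_right_injective R41 ht
  simp only
  rw [← h2, ht1, show b • ν q = (t * d) • ν q by rw [← ht2]]
  module

/-- The relation of a unit normal, and its not being horospherical, extend over connected sets. -/
lemma MSurf.extend {β : ℝ} (S : MSurf f ν U a b) (hU : IsPreconnected U)
    (hab : a ≠ 0 ∨ b ≠ 0) (S' : MSurf f ν' U' 1 β) {r : M} (hr : r ∈ U) (hr' : r ∈ U')
    (heq : ∀ᶠ s in 𝓝 r, ν' s = ν s)
    (hn : 1 + 2 * β ≠ 0 → ∀ C : R41, ¬ ∀ᶠ s in 𝓝 r, f s + ν' s = C) :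
    MSurf f ν U 1 β ∧
      ∀ q ∈ U, 1 + 2 * β ≠ 0 → ∀ C : R41, ¬ ∀ᶠ s in 𝓝 q, f s + ν s = C := by
  obtain ⟨W, hWs, hW, hrW⟩ := mem_nhds_iff.1
    (inter_mem ((S.isOpen.inter S'.isOpen).mem_nhds ⟨hr, hr'⟩) heq)
  have T : MSurf f ν W 1 β := (S'.mono hW fun s hs => (hWs hs).1.2).congr
    fun s hs => (show ν' s = ν s from (hWs hs).2).symm
  have hn' : 1 + 2 * β ≠ 0 → ∀ C : R41, ¬ ∀ᶠ s in 𝓝 r, f s + ν s = C := fun h C hC =>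
    hn h C (by filter_upwards [hC, heq] with s h1 h2; rw [h2, h1])
  by_cases hβ : a * β - b = 0
  · have ha : a ≠ 0 := by
      rintro rfl
      rcases hab with h | h
      · exact h rfl
      · apply h; linarith
    have S1 : MSurf f ν U 1 β := S.with_rel fun q hq => by
      have := (S.rel q hq).smul a⁻¹
      rwa [inv_mul_cancel₀ ha, show a⁻¹ * b = β by field_simp; linarith] at this
    refine ⟨S1, fun q hq h C hC => hn' h C ?_⟩
    filter_upwards [S.isOpen.mem_nhds hr] with s hs
    exact S1.add_const hf hH hU h hq hC s hs
  -- With different ratios both relations hold near `r`, so `f + ν` is constant there.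
  · have hz : ∀ s ∈ W, ∀ v, dM f s v + dM ν s v = 0 := fun s hs =>
      (T.jet hf hH hs).horospherical (T.regAt hs)
        (Rel.of_two (S.rel s (hWs hs).1.1) (T.rel s hs) (by simpa using hβ) 1 0)
        (Rel.of_two (S.rel s (hWs hs).1.1) (T.rel s hs) (by simpa using hβ) 0 1)
    have hc : ∀ᶠ s in 𝓝 r, f s + ν s = f r + ν r :=
      eventually_const_of_dM_eq_zero (g := fun s => f s + ν s) hW
        (hf.contMDiffOn.add T.normal.smooth) (fun s hs => by
          have := dM_comb (q := s) (hf.mdifferentiableAt (by simp)) (T.mdiff hs) 1 1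
          simp only [one_smul] at this
          rw [this]
          ext1 v
          exact hz s hs v) hrW
    -- By `hn'` this is possible only if `1 + 2β = 0`. Then `a + 2b ≠ 0`, as otherwise the ratios
    -- would agree, and unique continuation for the relation `(a, b)` makes all of `U`
    -- horospherical. There every relation holds.
    have hβ2 : 1 + 2 * β = 0 := by
      by_contra h
      exact hn' h _ hc
    have hU2 := S.add_const hf hH hU (fun h => hβ (by linear_combination (a / 2) * hβ2 - h / 2))
      hr hc
    refine ⟨S.with_rel fun q hq => Rel.of_add_eq_zero (fun v => ?_) 1 β, fun q _ h => absurd hβ2 h⟩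
    have := comb_dM_eq_zero (q := q) (c := 1) (d := 1) (hf.mdifferentiableAt (by simp))
      (S.mdiff hq) (C := f r + ν r) (by
        filter_upwards [S.isOpen.mem_nhds hq] with s hs
        simpa using hU2 s hs) v
    simpa using this

/-- Two unit normals spanning the same line field and satisfying relations with nonzero leading
coefficients agree, unless the front is parallel to a point or to a totally geodesic plane. -/
lemma MSurf.eventually_eq (S : MSurf f ν U a b) (S' : MSurf f ν' U' a' b') (ha : a ≠ 0)
    (ha' : a' ≠ 0) (hs : Spans ℓ ν U) (hs' : Spans ℓ ν' U') {q : M} (hq : q ∈ U) (hq' : q ∈ U')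
    (hn : ∀ c d : ℝ, c ^ 2 ≠ d ^ 2 → ∀ C : R41, ¬ ∀ᶠ s in 𝓝 q, c • f s + d • ν s = C) :
    ∀ᶠ s in 𝓝 q, ν' s = ν s := by
  rcases eventually_eq_or_neg S.isOpen S'.isOpen S.normal S'.normal hs hs' hq hq' with h | h
  · exact h
  · exfalso
    obtain ⟨W, hWs, hW, hqW⟩ := mem_nhds_iff.1
      (inter_mem ((S.isOpen.inter S'.isOpen).mem_nhds ⟨hq, hq'⟩) h)
    have T := S.mono hW fun s hs => (hWs hs).1.1
    have T' : MSurf f (-ν) W a' b' := (S'.mono hW fun s hs => (hWs hs).1.2).congr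
      fun s hs => (show ν' s = -ν s from (hWs hs).2).symm
    obtain ⟨c, d, hcd, hc⟩ := exists_comb_const hf hH T T' ha ha' hqW
    exact hn c d hcd _ hc

omit [IsManifold (𝓡 2) ∞ M] hf hH in
/-- Local unit normals that are restrictions of one field form a global unit normal. -/
lemma isGlobalUnitNormal_of_local {N : M → R41}
    (h : ∀ q, ∃ U : Set M, IsOpen U ∧ q ∈ U ∧ IsUnitNormalOn f N U ∧ Spans ℓ N U) :
    IsGlobalUnitNormal f ℓ N := by
  refine ⟨⟨fun q _ => ?_, fun q _ => ?_, fun q _ => ?_, fun q _ => ?_⟩, fun q _ => ?_⟩ <;>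
    obtain ⟨U, hU, hq, hN, hs⟩ := h q
  · exact (hN.smooth.contMDiffAt (hU.mem_nhds hq)).contMDiffWithinAt
  · exact hN.unit q hq
  · exact hN.tangent q hq
  · exact hN.normal q hq
  · exact hs q hq

variable [ConnectedSpace M]

/-- A front somewhere parallel to a point or to a totally geodesic plane has a global unit normal
that satisfies a linear relation. -/
lemma exists_global_of_comb_const (h : IsHLWFront f ℓ) {p₀ : M} (hp₀ : RegularAt f p₀) {c d : ℝ}
    (hcd : c ^ 2 ≠ d ^ 2) {C : R41} {q₀ : M} (hU : IsOpen U) (hq₀ : q₀ ∈ U)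
    (hν : IsUnitNormalOn f ν U) (hs : Spans ℓ ν U) (hc : ∀ᶠ s in 𝓝 q₀, c • f s + d • ν s = C) :
    ∃ N : M → R41, IsGlobalUnitNormal f ℓ N ∧ ∃ a b : ℝ, (a ≠ 0 ∨ b ≠ 0) ∧
      ∀ q, Rel (f q) (N q) (dM f q) (dM N q) a b := by
  set T : Set M := {q | ∃ (U : Set M) (ν : M → R41), IsOpen U ∧ q ∈ U ∧ IsUnitNormalOn f ν U ∧
    Spans ℓ ν U ∧ ∀ s ∈ U, c • f s + d • ν s = C} with hT
  have hTu : T = Set.univ := by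
    refine eq_univ_of_local ⟨q₀, ?_⟩ fun p => ?_
    · obtain ⟨W, hWs, hW, hqW⟩ := mem_nhds_iff.1 (inter_mem (hU.mem_nhds hq₀) hc)
      exact ⟨W, ν, hW, hqW, hν.mono fun s hs => (hWs hs).1, hs.mono fun s hs => (hWs hs).1,
        fun s hs => (hWs hs).2⟩
    · obtain ⟨V, μ, a, b, hpV, hV, hsV, hab, S⟩ := exists_mSurf h p
      refine ⟨V, S.isOpen, hpV, ?_⟩
      rintro ⟨r, hrV, W, η, hW, hrW, hη, hsW, hCW⟩
      have hev : ∀ᶠ s in 𝓝 r, c • f s + d • η s = C := by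
        filter_upwards [hW.mem_nhds hrW] with s hs using hCW s hs
      rcases eventually_eq_or_neg S.isOpen hW S.normal hη hsV hsW hrV hrW with he | he
      · have := S.comb_const_of_eventually hf hH hV hab hcd hrV (C := C) (by
          filter_upwards [hev, he] with s h1 h2; rw [← h1, h2])
        exact fun q hq => ⟨V, μ, S.isOpen, hq, S.normal, hsV, this⟩
      -- With the opposite normal the constant combination has coefficients `c, -d`; replacing `μ`
      -- by `-μ` restores `d`.
      · have := S.comb_const_of_eventually hf hH hV hab (c := c) (d := -d) (by simpa using hcd) hrV
          (C := C) (by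
            filter_upwards [hev, he] with s h1 h2; rw [← h1, h2, smul_neg, neg_smul])
        refine fun q hq => ⟨V, -μ, S.isOpen, hq, S.normal.neg, hsV.neg, fun s hs => ?_⟩
        rw [← this s hs, Pi.neg_apply, smul_neg, neg_smul]
  have hall : ∀ q, q ∈ T := fun q => hTu ▸ Set.mem_univ q
  -- If `d = 0`, then `f` would be constant near the regular point `p₀`.
  have hd : d ≠ 0 := by
    rintro rfl
    obtain ⟨V, μ, hV, hpV, hμ, -, hC⟩ := hall p₀
    have hc0 : c ≠ 0 := fun h0 => hcd (by simp [h0])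
    have hz := comb_dM_eq_zero (q := p₀) (hf.mdifferentiableAt (by simp))
      (mdiffAt hV hμ.smooth hpV) (c := c) (d := 0) (C := C) (by
        filter_upwards [hV.mem_nhds hpV] with s hs using hC s hs)
    have h2 : ∀ v, dM f p₀ v = 0 := fun v => by
      have := hz v
      rw [zero_smul, add_zero] at this
      exact (smul_eq_zero.1 this).resolve_left hc0
    have h3 : e0 = 0 := hp₀ ((h2 e0).trans (h2 0).symm)
    have h4 := congrArg (fun v : E2 => v 0) h3
    simp [e0] at h4
  -- The normal is determined by `f` through `c f + d ν = C`, so the local normals agree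
  -- automatically.
  set N : M → R41 := fun q => d⁻¹ • (C - c • f q) with hN
  have hNeq : ∀ (V : Set M) (μ : M → R41), (∀ s ∈ V, c • f s + d • μ s = C) →
      ∀ s ∈ V, N s = μ s := by
    intro V μ hC s hs
    simp only [hN]
    rw [← hC s hs, add_sub_cancel_left, inv_smul_smul₀ hd]
  have hglob : IsGlobalUnitNormal f ℓ N := isGlobalUnitNormal_of_local fun q => by
    obtain ⟨V, μ, hV, hqV, hμ, hsV, hC⟩ := hall q
    exact ⟨V, hV, hqV, hμ.congr (hNeq V μ hC), hsV.congr (hNeq V μ hC)⟩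
  refine ⟨N, hglob, -(c + d), d, Or.inr hd, fun q => Rel.of_comb_eq_zero ?_⟩
  refine comb_dM_eq_zero (hf.mdifferentiableAt (by simp))
    (mdiffAt isOpen_univ hglob.1.smooth (Set.mem_univ q)) (C := C) (Eventually.of_forall fun s => ?_)
  simp only [hN]
  rw [smul_inv_smul₀ hd, add_sub_cancel]

/-- A non-flat front nowhere parallel to a point or to a totally geodesic plane has a global unit
normal that satisfies a linear relation. -/
lemma exists_global_of_not_comb_const (h : IsHLWFront f ℓ) {p₀ : M} (hp₀ : RegularAt f p₀)
    (hK : gaussCurv f p₀ ≠ 0)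
    (hn : ∀ (U : Set M) (ν : M → R41) (q : M), IsOpen U → q ∈ U → IsUnitNormalOn f ν U →
      Spans ℓ ν U → ∀ c d : ℝ, c ^ 2 ≠ d ^ 2 → ∀ C : R41, ¬ ∀ᶠ s in 𝓝 q, c • f s + d • ν s = C) :
    ∃ N : M → R41, IsGlobalUnitNormal f ℓ N ∧ ∃ a b : ℝ, (a ≠ 0 ∨ b ≠ 0) ∧
      ∀ q, Rel (f q) (N q) (dM f q) (dM N q) a b := by
  obtain ⟨U₀, ν₀, a₀, b₀, hp₀U, -, hs₀, hab₀, S₀⟩ := exists_mSurf h p₀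
  -- A relation with `a₀ = 0` says `K = 0`, contrary to the choice of `p₀`.
  have ha₀ : a₀ ≠ 0 := by
    rintro rfl
    have hb : b₀ ≠ 0 := hab₀.resolve_left fun h => h rfl
    refine hK (gaussCurv_eq_zero_of_rel hf hH S₀.isOpen S₀.normal hp₀U hp₀ ?_)
    simpa [hb] using (S₀.rel p₀ hp₀U).smul b₀⁻¹
  set β := a₀⁻¹ * b₀ with hβ
  -- The last clause keeps the ratio from being lost on a horosphere, where all ratios hold. It is
  -- needed only for `1 + 2β ≠ 0`, since otherwise every other ratio is elliptic and `MSurf.extend`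
  -- continues the horosphere itself.
  set T : Set M := {q | ∃ (U : Set M) (ν : M → R41), q ∈ U ∧ MSurf f ν U 1 β ∧ Spans ℓ ν U ∧
    (1 + 2 * β ≠ 0 → ∀ C : R41, ¬ ∀ᶠ s in 𝓝 q, f s + ν s = C)} with hT
  have hTu : T = Set.univ := by
    refine eq_univ_of_local ⟨p₀, U₀, ν₀, hp₀U, S₀.with_rel fun q hq => ?_, hs₀, ?_⟩ fun p => ?_
    · simpa [ha₀, hβ] using (S₀.rel q hq).smul a₀⁻¹
    · intro _ C hC
      refine hK (gaussCurv_eq_zero_of_rel hf hH S₀.isOpen S₀.normal hp₀U hp₀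
        (Rel.of_add_eq_zero (fun v => ?_) 0 1))
      have := comb_dM_eq_zero (q := p₀) (hf.mdifferentiableAt (by simp))
        (S₀.mdiff hp₀U) (c := 1) (d := 1) (C := C) (by simpa using hC) v
      simpa using this
    · obtain ⟨V, μ, a, b, hpV, hV, hsV, hab, S⟩ := exists_mSurf h p
      refine ⟨V, S.isOpen, hpV, ?_⟩
      rintro ⟨r, hrV, W, η, hrW, S', hsW, hnW⟩
      -- For `a = 0` the piece is flat and its relation does not see the sign of the normal, so the
      -- sign can be chosen to match `η`. For `a ≠ 0` the signs already agree by
      -- `MSurf.eventually_eq`.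
      by_cases ha : a = 0
      · have hb : b ≠ 0 := hab.resolve_left fun h => h ha
        rcases eventually_eq_or_neg S.isOpen S'.isOpen S.normal S'.normal hsV hsW hrV hrW
          with he | he
        · have := S.extend hf hH hV hab S' hrV hrW he hnW
          exact fun q hq => ⟨V, μ, hq, this.1, hsV, this.2 q hq⟩
        · have S1 : MSurf f (-μ) V 0 1 := S.neg fun q hq => Rel.neg_iff.2 fun v w => by
            have := S.rel q hq v w
            rw [ha, zero_mul, zero_add] at this
            rw [(mul_eq_zero.1 this).resolve_left hb]
            ring
          have := S1.extend hf hH hV (Or.inr one_ne_zero) S' hrV hrW he hnW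
          exact fun q hq => ⟨V, -μ, hq, this.1, hsV.neg, this.2 q hq⟩
      · have he := S.eventually_eq hf hH S' ha one_ne_zero hsV hsW hrV hrW
          (hn V μ r S.isOpen hrV S.normal hsV)
        have := S.extend hf hH hV hab S' hrV hrW he hnW
        exact fun q hq => ⟨V, μ, hq, this.1, hsV, this.2 q hq⟩
  have hall : ∀ q, q ∈ T := fun q => hTu ▸ Set.mem_univ q
  choose V μ hqV S hs _ using hall
  set N : M → R41 := fun q => μ q q with hN
  have hNeq : ∀ q, ∀ s ∈ V q, N s = μ q s := fun q s hsq =>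
    ((S q).eventually_eq hf hH (S s) one_ne_zero one_ne_zero (hs q) (hs s) hsq (hqV s)
      (hn (V q) (μ q) s (S q).isOpen hsq (S q).normal (hs q))).self_of_nhds
  refine ⟨N, isGlobalUnitNormal_of_local fun q => ⟨V q, (S q).isOpen, hqV q,
    (S q).normal.congr (hNeq q), (hs q).congr (hNeq q)⟩, 1, β, Or.inl one_ne_zero, fun q => ?_⟩
  exact ((S q).congr (hNeq q)).rel q (hqV q)

end Global

end HypFront

end

theorem theorem2p1 {M : Type*} [TopologicalSpace M] [T2Space M] [SecondCountableTopology M]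
    [ConnectedSpace M] [ChartedSpace HypFront.E2 M] [IsManifold (𝓡 2) ∞ M]
    (f : M → HypFront.R41) (ℓ : M → Submodule ℝ HypFront.R41)
    (hf : HypFront.IsHLWFront f ℓ) (hflat : ¬ HypFront.IsFlat f) :
    HypFront.IsCoorientable f ℓ ∧
    (∃ ν : M → HypFront.R41, HypFront.IsGlobalUnitNormal f ℓ ν ∧
      ∃ a b : ℝ, a ^ 2 + b ^ 2 ≠ 0 ∧ HypFront.ParallelRelation f ν a b) ∧
    (∀ ν : M → HypFront.R41, HypFront.IsGlobalUnitNormal f ℓ ν →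
      ∀ a b a' b' : ℝ, a ^ 2 + b ^ 2 ≠ 0 → a' ^ 2 + b' ^ 2 ≠ 0 →
        HypFront.ParallelRelation f ν a b → HypFront.ParallelRelation f ν a' b' →
        ∃ c : ℝ, c ≠ 0 ∧ a' = c * a ∧ b' = c * b) := by
  open HypFront Topology in
  have hsm := hf.1.smooth
  have hH := hf.1.mem_H3
  obtain ⟨p₀, hp₀, hK⟩ : ∃ p₀ ∈ regularSet f, gaussCurv f p₀ ≠ 0 := by
    simpa [IsFlat] using hflat
  obtain ⟨N, hN, a, b, hab, hrel⟩ : ∃ N : M → R41, IsGlobalUnitNormal f ℓ N ∧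
      ∃ a b : ℝ, (a ≠ 0 ∨ b ≠ 0) ∧ ∀ q, Rel (f q) (N q) (dM f q) (dM N q) a b := by
    by_cases hn : ∀ (U : Set M) (ν : M → R41) (q : M), IsOpen U → q ∈ U → IsUnitNormalOn f ν U →
        Spans ℓ ν U → ∀ c d : ℝ, c ^ 2 ≠ d ^ 2 → ∀ C : R41,
          ¬ ∀ᶠ s in 𝓝 q, c • f s + d • ν s = C
    · exact exists_global_of_not_comb_const hsm hH hf hp₀ hK hn
    · push Not at hn
      obtain ⟨U, ν, q, hU, hq, hν, hs, c, d, hcd, C, hC⟩ := hn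
      exact exists_global_of_comb_const hsm hH hf hp₀ hcd hU hq hν hs hC
  refine ⟨⟨N, hN⟩, ⟨N, hN, a, b, fun h0 => ?_, fun δ p hp => ?_⟩, ?_⟩
  · rcases hab with h | h <;> apply h <;> nlinarith [sq_nonneg a, sq_nonneg b]
  · exact (curv_relation_iff_of_regularAt hsm hH isOpen_univ hN.1 (Set.mem_univ p) hp a b).2
      (hrel p)
  · intro ν _ a b a' b' hab hab' h h'
    -- At `δ = 0` both pairs solve `a (H - 1) + b K = 0` at a point with `K ≠ 0`, an equation whose
    -- solution space is a line on which `a` determines `b`.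
    have h1 := h 0 p₀ (by rwa [parallel_zero])
    have h2 := h' 0 p₀ (by rwa [parallel_zero])
    simp only [parallel_zero, parallelNormal_zero, mul_zero, Real.exp_zero, mul_one, sub_self,
      zero_div, add_zero] at h1 h2
    set H := meanCurv f ν p₀
    set K := gaussCurv f p₀
    have hdet : a * b' = a' * b := by
      apply mul_right_cancel₀ hK
      linear_combination a * h2 - a' * h1
    have ha : a ≠ 0 := by
      rintro rfl
      have : b = 0 := by simpa [hK] using h1
      simp [this] at hab
    have ha' : a' ≠ 0 := by
      rintro rfl
      have : b' = 0 := by simpa [hK] using h2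
      simp [this] at hab'
    refine ⟨a' / a, div_ne_zero ha' ha, by field_simp, ?_⟩
    field_simp
    linarith
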